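/- Let $G$ be a compact Lie group and let $K<H<G$ be closed Lie subgroups (strict inclusions) such that $G/K$ and $H/K$ are connected. Let $\mathfrak k\subset\mathfrak h\subset\mathfrak g$ be the Lie algebras, let $B$ be the Killing form of $\mathfrak g$, let $Q$ be an $\mathrm{Ad}(G)$-invariant inner product on $\mathfrak g$, and let $\mathfrak p=\mathfrak k^{\perp_Q}\cong T_{eK}(G/K)$ be the isotropy representation of $K$. Suppose that $\mathfrak p=\mathfrak p_1\oplus\mathfrak p_2$ with $\mathfrak p_1,\mathfrak p_2$ irreducible, inequivalent $\mathrm{Ad}(K)$-invariant summands, and that $\mathfrak h=\mathfrak k\oplus\mathfrak p_1$. Put $d_i=\dim\mathfrak p_i$, define $b_1\in\mathbb R$ by $-B|_{\mathfrak p_1}=b_1Q|_{\mathfrak p_1}$, let $[ijk]=\sum Q([e_\alpha,e_\beta],e_\gamma)^2$, where the sum is over $Q$-orthonormal bases $(e_\alpha),(e_\beta),(e_\gamma)$ of $\mathfrak p_i,\mathfrak p_j,\mathfrak p_k$, and let $$C=b_1-\frac{[111]}{2d_1}-\frac{[122]}{d_1}.$$ Suppose that $[122]>0$ and $C>0$.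 A $G$-invariant Riemannian metric on $G/K$ is identified with an $\mathrm{Ad}(K)$-invariant inner product on $\mathfrak p$. A homogeneous Ricci flow on $[0,T)$ is a family $g(t)$, $t\in[0,T)$, of $G$-invariant metrics on $G/K$ with $\partial_t g(t)=-2\,\mathrm{Ric}(g(t))$. Then for every $G$-invariant metric $g_0$ on $G/K$ there are $0<T<\infty$ and a homogeneous Ricci flow $g(t)$ on $[0,T)$ with $g(0)=g_0$ which is maximal and unique: every homogeneous Ricci flow on an interval $[0,T')$ starting at $g_0$ satisfies $T'\le T$ and coincides with $g$ on $[0,T')$. Moreover, $T$ is a type I singularity, that is, $$\sup_{t\in[0,T)}|\mathrm{Rm}(g(t))|_{g(t)}=\infty\quad\text{and}\quad\sup_{t\in[0,T)}(T-t)\,|\mathrm{Rm}(g(t))|_{g(t)}<\infty,$$ and, as $t\to T$, one of the following singular behaviours occurs: 1. the whole space shrinks to a point: $g(t)\to0$ on $\mathfrak p$ and the diameter of $(G/K,g(t))$ tends to $0$; 2. the fibre $H/K$ of $G/K\to G/H$ shrinks to a point, that is, $g(t)\to0$ on $\mathfrak p_1$ and the diameter of $H/K$ for the metric induced by $g(t)$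 tends to $0$, and the total space converges to the base: there is a $G$-invariant Riemannian metric $\bar g$ on $G/H$ such that $g(t)$ tends to the pullback of $\bar g$ to $G/K$, and $(G/K,g(t))$ converges to $(G/H,\bar g)$ in the Gromov–Hausdorff topology. Finally, a necessary condition for 1 to happen is that $G/K$ carries a $G$-invariant Einstein metric. -/

import Mathlib

open scoped Manifold ContDiff ENNReal Topology

noncomputable section

namespace HomogeneousRicci

/-! ## Curvature of an invariant metric on a reductive homogeneous space

Throughout, `𝔤 = 𝔨 ⊕ 𝔭` is a reductive decomposition, `𝔭` is identified with the tangent space of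
`G/K` at the base point, and a `G`-invariant metric on `G/K` is identified with its value at the
base point, an `Ad(K)`-invariant inner product on `𝔭`. -/

section Algebra

open Classical in
/-- The projection of `V = 𝔨 ⊕ 𝔭` onto `𝔭` along `𝔨` (zero if the two are not complementary). -/
def proj {V : Type*} [AddCommGroup V] [Module ℝ V] (𝔨 𝔭 : Submodule ℝ V) : V →ₗ[ℝ] 𝔭 :=
  if h : IsCompl 𝔭 𝔨 then 𝔭.projectionOnto 𝔨 h else 0

variable {𝔤 : Type*} [LieRing 𝔤] [LieAlgebra ℝ 𝔤]

/-- The bilinear map `Λ : 𝔭 × 𝔭 → 𝔭` describes, by way of `Λ X Y = Λ(X) Y`, the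
Levi-Civita connection of the invariant metric `g` : it is metric, and its
torsion `Λ(X) Y - Λ(Y) X - [X, Y]_𝔭` vanishes. -/
structure IsLeviCivita (𝔨 𝔭 : Submodule ℝ 𝔤) (g : LinearMap.BilinForm ℝ 𝔭)
    (Λ : 𝔭 →ₗ[ℝ] 𝔭 →ₗ[ℝ] 𝔭) : Prop where
  metric : ∀ X Y Z : 𝔭, g (Λ X Y) Z + g Y (Λ X Z) = 0
  torsion_free : ∀ X Y : 𝔭, Λ X Y - Λ Y X = proj 𝔨 𝔭 ⁅(X : 𝔤), (Y : 𝔤)⁆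

/-- An inner product: a symmetric, positive definite bilinear form. -/
structure IsInner {V : Type*} [AddCommGroup V] [Module ℝ V] (g : LinearMap.BilinForm ℝ V) :
    Prop where
  symm : ∀ X Y, g X Y = g Y X
  pos : ∀ X, X ≠ 0 → 0 < g X X

open Classical in
/-- The Levi-Civita connection of `g` (see `existsUnique_isLeviCivita`). -/
def leviCivita (𝔨 𝔭 : Submodule ℝ 𝔤) (g : LinearMap.BilinForm ℝ 𝔭) : 𝔭 →ₗ[ℝ] 𝔭 →ₗ[ℝ] 𝔭 :=
  if h : ∃ Λ, IsLeviCivita 𝔨 𝔭 g Λ then h.choose else 0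

/-- The curvature operator at the base point,
`R(X, Y) Z = Λ(X) Λ(Y) Z - Λ(Y) Λ(X) Z - Λ([X, Y]_𝔭) Z - [[X, Y]_𝔨, Z]`.
As `[𝔨, 𝔭] ⊆ 𝔭`, the last projection onto `𝔭` only serves to land in the type `𝔭`. -/
def curvature (𝔨 𝔭 : Submodule ℝ 𝔤) (g : LinearMap.BilinForm ℝ 𝔭) (X Y Z : 𝔭) : 𝔭 :=
  let Λ := leviCivita 𝔨 𝔭 g
  let br : 𝔤 := ⁅(X : 𝔤), (Y : 𝔤)⁆
  Λ X (Λ Y Z) - Λ Y (Λ X Z) - Λ (proj 𝔨 𝔭 br) Z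
    - proj 𝔨 𝔭 ⁅br - (proj 𝔨 𝔭 br : 𝔤), (Z : 𝔤)⁆

/-- The Ricci tensor `Ric(Y, Z) = tr (X ↦ R(X, Y) Z)` at the base point. -/
def ricci (𝔨 𝔭 : Submodule ℝ 𝔤) (g : LinearMap.BilinForm ℝ 𝔭) (Y Z : 𝔭) : ℝ :=
  LinearMap.trace ℝ 𝔭
    { toFun := fun X => curvature 𝔨 𝔭 g X Y Z
      map_add' := fun X X' => by
        simp only [curvature, map_add, LinearMap.add_apply, Submodule.coe_add, add_lie, sub_lie,
          map_sub]
        abel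
      map_smul' := fun c X => by
        simp only [curvature, map_smul, LinearMap.smul_apply, Submodule.coe_smul, smul_lie,
          sub_lie, smul_sub, map_sub, RingHom.id_apply] }

/-- The family `b` is orthonormal for the bilinear form `g`. -/
def IsOrthonormal {V ι : Type*} [AddCommGroup V] [Module ℝ V] (g : LinearMap.BilinForm ℝ V)
    (b : ι → V) : Prop :=
  (∀ i, g (b i) (b i) = 1) ∧ ∀ i j, i ≠ j → g (b i) (b j) = 0

open Classical in
/-- The norm `|Rm(g)|_g` of the curvature tensor: the square root of the sum of the squares of its
components `g(R(eᵢ, eⱼ)eₖ, eₗ)` in a `g`-orthonormal basis of `𝔭`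
(see `exists_orthonormal_basis`). By homogeneity this number is the same at all points. -/
def curvatureNorm (𝔨 𝔭 : Submodule ℝ 𝔤) (g : LinearMap.BilinForm ℝ 𝔭) : ℝ :=
  if h : ∃ b : Module.Basis (Fin (Module.finrank ℝ 𝔭)) ℝ 𝔭, IsOrthonormal g b then
    √(∑ i, ∑ j, ∑ k, ∑ l,
      g (curvature 𝔨 𝔭 g (h.choose i) (h.choose j) (h.choose k)) (h.choose l) ^ 2)
  else 0

/-- The structure constant `∑ Q([e_α, e'_β], e''_γ)²` of three families of vectors. -/
def structConst (Q : LinearMap.BilinForm ℝ 𝔤) {a b c : ℕ}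
    (e : Fin a → 𝔤) (e' : Fin b → 𝔤) (e'' : Fin c → 𝔤) : ℝ :=
  ∑ α, ∑ β, ∑ γ, Q ⁅e α, e' β⁆ (e'' γ) ^ 2

theorem exists_orthonormal_basis {V : Type*} [AddCommGroup V] [Module ℝ V]
    [FiniteDimensional ℝ V] {g : LinearMap.BilinForm ℝ V} (hg : IsInner g) :
    ∃ b : Module.Basis (Fin (Module.finrank ℝ V)) ℝ V, IsOrthonormal g b := by
  let c : InnerProductSpace.Core ℝ V :=
    { inner := fun x y => g x y
      conj_inner_symm := fun x y => by simpa using hg.symm y x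
      re_inner_nonneg := fun x => by
        by_cases h : x = 0
        · simp [h]
        · simpa using (hg.pos x h).le
      add_left := fun x y z => by simp
      smul_left := fun x y r => by simp
      definite := fun x hx => by
        by_contra h
        exact (hg.pos x h).ne' hx }
  let _ := c.toNormedAddCommGroup
  let _ := InnerProductSpace.ofCore c.toCore
  have h := orthonormal_iff_ite.1 (stdOrthonormalBasis ℝ V).orthonormal
  refine ⟨(stdOrthonormalBasis ℝ V).toBasis, fun i => ?_, fun i j hij => ?_⟩
  · have := h i i
    rw [if_pos rfl] at this
    rw [OrthonormalBasis.coe_toBasis]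
    exact this
  · have := h i j
    rw [if_neg hij] at this
    rw [OrthonormalBasis.coe_toBasis]
    exact this

theorem existsUnique_isLeviCivita (𝔨 𝔭 : Submodule ℝ 𝔤) [FiniteDimensional ℝ 𝔭]
    {g : LinearMap.BilinForm ℝ 𝔭} (hg : IsInner g) : ∃! Λ, IsLeviCivita 𝔨 𝔭 g Λ := by
  have hinj : Function.Injective (g : 𝔭 →ₗ[ℝ] Module.Dual ℝ 𝔭) := by
    rw [injective_iff_map_eq_zero]
    intro x hx
    by_contra h
    exact (hg.pos x h).ne' (by rw [hx]; rfl)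
  let φ : 𝔭 ≃ₗ[ℝ] Module.Dual ℝ 𝔭 :=
    LinearMap.linearEquivOfInjective g hinj Subspace.dual_finrank_eq.symm
  have hφ : ∀ f Z, g (φ.symm f) Z = f Z := fun f Z => by
    have : g (φ.symm f) = f := φ.apply_symm_apply f
    rw [this]
  let P : 𝔭 → 𝔭 → 𝔭 := fun X Y => proj 𝔨 𝔭 ⁅(X : 𝔤), (Y : 𝔤)⁆
  have hP : ∀ X Y, P X Y = - P Y X := fun X Y => by
    simp only [P, ← map_neg, lie_skew]
  let F : 𝔭 →ₗ[ℝ] 𝔭 →ₗ[ℝ] Module.Dual ℝ 𝔭 := LinearMap.mk₂ ℝ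
    (fun X Y =>
      { toFun := fun Z => (1 / 2) * (g (P X Y) Z - g (P Y Z) X + g (P Z X) Y)
        map_add' := fun Z Z' => by simp [P]; ring
        map_smul' := fun c Z => by simp [P]; ring })
    (fun X X' Y => by ext Z; simp [P]; ring)
    (fun c X Y => by ext Z; simp [P]; ring)
    (fun X Y Y' => by ext Z; simp [P]; ring)
    (fun c X Y => by ext Z; simp [P]; ring)
  have hF : ∀ X Y Z, F X Y Z = (1 / 2) * (g (P X Y) Z - g (P Y Z) X + g (P Z X) Y) :=
    fun X Y Z => rfl
  refine ⟨F.compr₂ φ.symm.toLinearMap, ⟨fun X Y Z => ?_, fun X Y => ?_⟩, fun Λ hΛ => ?_⟩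
  · rw [hg.symm Y]
    simp only [LinearMap.compr₂_apply, LinearEquiv.coe_coe, hφ, hF]
    rw [hP X Z, hP Z Y, hP Y X]
    simp only [map_neg, LinearMap.neg_apply]
    ring
  · apply hinj
    ext Z
    simp only [LinearMap.compr₂_apply, LinearEquiv.coe_coe, map_sub, LinearMap.sub_apply, hφ, hF]
    change _ = g (P X Y) Z
    rw [hP Y X, hP X Z, hP Z Y]
    simp only [map_neg, LinearMap.neg_apply]
    ring
  · ext1 X
    ext1 Y
    apply hinj
    ext Z
    simp only [LinearMap.compr₂_apply, LinearEquiv.coe_coe, hφ, hF]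
    have t : ∀ X Y, P X Y = Λ X Y - Λ Y X := fun X Y => (hΛ.torsion_free X Y).symm
    have m := hΛ.metric
    simp only [t, map_sub, LinearMap.sub_apply]
    have m1 := m X Y Z
    have m2 := m Y Z X
    have m3 := m Z X Y
    rw [hg.symm Y] at m1
    rw [hg.symm Z] at m2
    rw [hg.symm X] at m3
    linarith

end Algebra

/-! ## Lie groups, Lie subgroups and the adjoint representation -/

section LieGroup

variable {E : Type*} [NormedAddCommGroup E] [NormedSpace ℝ E] {M : Type*} [TopologicalSpace M]
  (I : ModelWithCorners ℝ E M)
  {E' : Type*} [NormedAddCommGroup E'] [NormedSpace ℝ E'] {M' : Type*} [TopologicalSpace M']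
  (I' : ModelWithCorners ℝ E' M')
  {G : Type*} [TopologicalSpace G] [ChartedSpace M G] [Group G]

/-- A smooth real Lie group has enough smoothness for its Lie algebra to be defined. -/
instance instLEInftyMinSmoothness : ENat.LEInfty (minSmoothness ℝ 3) :=
  ⟨by rw [minSmoothness_of_isRCLikeNormedField]; exact ENat.LEInfty.out⟩

/-- The adjoint representation: the derivative at `1` of `x ↦ a * x * a⁻¹`. -/
def Ad (a : G) : GroupLieAlgebra I G →ₗ[ℝ] GroupLieAlgebra I G :=
  (mfderiv I I (fun x : G => a * x * a⁻¹) 1).toLinearMap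

/-- The smooth structure carried by the subgroup `S` makes it a closed Lie subgroup of `G`: `S` is
closed and its inclusion is a smooth immersion (the topology of `S` being the subspace topology). -/
structure IsClosedLieSubgroup (S : Subgroup G) [ChartedSpace M' S] : Prop where
  isClosed : IsClosed (S : Set G)
  contMDiff : ContMDiff I' I ∞ (Subtype.val : S → G)
  injective : ∀ x : S, Function.Injective (mfderiv I' I (Subtype.val : S → G) x)

/-- The derivative at `1` of the inclusion of a Lie subgroup. -/
def lieInclusion (S : Subgroup G) [ChartedSpace M' S] :
    GroupLieAlgebra I' S →ₗ[ℝ] GroupLieAlgebra I G :=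
  (mfderiv I' I (Subtype.val : S → G) 1).toLinearMap

/-- The Lie algebra of a Lie subgroup, as a subspace of the Lie algebra of `G`. -/
def lieAlgebra (S : Subgroup G) [ChartedSpace M' S] : Submodule ℝ (GroupLieAlgebra I G) :=
  LinearMap.range (lieInclusion I I' S)

/-- `Q` is an inner product on the Lie algebra of `G` which is invariant under `Ad(G)`. -/
structure IsAdInvariantInner (Q : LinearMap.BilinForm ℝ (GroupLieAlgebra I G)) : Prop extends
    IsInner Q where
  invariant : ∀ (a : G) (X Y : GroupLieAlgebra I G), Q (Ad I a X) (Ad I a Y) = Q X Y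

/-- The isotropy representation of `G/S`, realised on the `Q`-orthogonal complement of the Lie
algebra of `S`. -/
def isotropySpace (Q : LinearMap.BilinForm ℝ (GroupLieAlgebra I G)) (S : Subgroup G)
    [ChartedSpace M' S] : Submodule ℝ (GroupLieAlgebra I G) :=
  Q.orthogonal (lieAlgebra I I' S)

/-- The projection of the Lie algebra of `G` onto the isotropy representation of `G/S`. -/
def isotropyProj (Q : LinearMap.BilinForm ℝ (GroupLieAlgebra I G)) (S : Subgroup G)
    [ChartedSpace M' S] : GroupLieAlgebra I G →ₗ[ℝ] isotropySpace I I' Q S :=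
  proj (lieAlgebra I I' S) (isotropySpace I I' Q S)

/-- `W` is an irreducible `Ad(S)`-invariant subspace of the Lie algebra of `G`. -/
structure IsIrreducibleSummand (S : Subgroup G) (W : Submodule ℝ (GroupLieAlgebra I G)) :
    Prop where
  invariant : ∀ a ∈ S, ∀ X ∈ W, Ad I a X ∈ W
  ne_bot : W ≠ ⊥
  irreducible : ∀ U ≤ W, (∀ a ∈ S, ∀ X ∈ U, Ad I a X ∈ U) → U = ⊥ ∨ U = W

/-- `W₁` and `W₂` are equivalent as representations of `S`. -/
def AreEquivalent (S : Subgroup G) (W₁ W₂ : Submodule ℝ (GroupLieAlgebra I G)) : Prop :=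
  ∃ f : W₁ ≃ₗ[ℝ] W₂, ∀ a ∈ S, ∀ X Y : W₁, (Y : GroupLieAlgebra I G) = Ad I a X →
    (f Y : GroupLieAlgebra I G) = Ad I a (f X)

/-! ## Invariant metrics, Einstein metrics and the homogeneous Ricci flow -/

/-- `g` is (the value at the base point of) a `G`-invariant Riemannian metric on `G/S`: an
`Ad(S)`-invariant inner product on the isotropy representation. -/
structure IsInvariantMetric (Q : LinearMap.BilinForm ℝ (GroupLieAlgebra I G)) (S : Subgroup G)
    [ChartedSpace M' S] (g : LinearMap.BilinForm ℝ (isotropySpace I I' Q S)) : Prop extends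
    IsInner g where
  invariant : ∀ a ∈ S, ∀ X Y X' Y' : isotropySpace I I' Q S,
    (X' : GroupLieAlgebra I G) = Ad I a X → (Y' : GroupLieAlgebra I G) = Ad I a Y →
    g X' Y' = g X Y

section Ricci

variable [LieGroup I (minSmoothness ℝ 3) G] [CompleteSpace E]
  (Q : LinearMap.BilinForm ℝ (GroupLieAlgebra I G)) (S : Subgroup G) [ChartedSpace M' S]

/-- The Ricci tensor of the invariant metric `g` on `G/S`. -/
def Ric (g : LinearMap.BilinForm ℝ (isotropySpace I I' Q S))
    (X Y : isotropySpace I I' Q S) : ℝ :=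
  ricci (lieAlgebra I I' S) (isotropySpace I I' Q S) g X Y

/-- The norm of the curvature tensor of the invariant metric `g` on `G/S`. -/
def RmNorm (g : LinearMap.BilinForm ℝ (isotropySpace I I' Q S)) : ℝ :=
  curvatureNorm (lieAlgebra I I' S) (isotropySpace I I' Q S) g

/-- `g` is a `G`-invariant Einstein metric on `G/S`. -/
def IsInvariantEinstein (g : LinearMap.BilinForm ℝ (isotropySpace I I' Q S)) : Prop :=
  IsInvariantMetric I I' Q S g ∧ ∃ c : ℝ, ∀ X Y, Ric I I' Q S g X Y = c * g X Y

/-- `g` is a homogeneous Ricci flow on `G/S` on the time interval `[0, T)` with initial metric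
`g₀`. -/
structure IsHomogeneousRicciFlow (g₀ : LinearMap.BilinForm ℝ (isotropySpace I I' Q S)) (T : ℝ)
    (g : ℝ → LinearMap.BilinForm ℝ (isotropySpace I I' Q S)) : Prop where
  init : g 0 = g₀
  metric : ∀ t ∈ Set.Ico 0 T, IsInvariantMetric I I' Q S (g t)
  flow : ∀ t ∈ Set.Ico 0 T, ∀ X Y, HasDerivWithinAt (fun s => g s X Y)
    (-2 * Ric I I' Q S (g t) X Y) (Set.Ico 0 T) t

/-- The family of metrics `g` on `[0, T)` develops a type I singularity at the time `T < ∞`. -/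
structure IsTypeISingularity (T : ℝ)
    (g : ℝ → LinearMap.BilinForm ℝ (isotropySpace I I' Q S)) : Prop where
  unbounded : ¬ BddAbove ((fun t => RmNorm I I' Q S (g t)) '' Set.Ico 0 T)
  rate : BddAbove ((fun t => (T - t) * RmNorm I I' Q S (g t)) '' Set.Ico 0 T)

end Ricci

/-! ## Riemannian distances on coset spaces and Gromov-Hausdorff distance -/

/-- The infimum of the lengths of the `C¹` paths from `a` to `b` in `G`, where the length of a
velocity vector `v` at `x` is measured by the function `N` at the left translate `x⁻¹ v` of `v` to
the Lie algebra. -/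
def pathEDist (N : GroupLieAlgebra I G → ℝ) (a b : G) : ℝ≥0∞ :=
  letI : ∀ x : G, ENorm (TangentSpace I x) := fun x =>
    ⟨fun v => ENNReal.ofReal (N (mfderiv I I (fun y : G => x⁻¹ * y) x v))⟩
  Manifold.riemannianEDist I a b

/-- The distance on `G/S` obtained by minimising the length of paths in `G` joining two cosets. Let
`N` be the seminorm on the Lie algebra of `G` given by the norm, for an invariant metric on `G/S`,
of the image in the tangent space of `G/S` at the base point. Then the length of a path in `G` is
the length of its image in `G/S`; as all `C¹` paths in `G/S` lift to `C¹` paths in `G`, this is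
the Riemannian distance of `G/S`. -/
def cosetEDist (S : Subgroup G) (N : GroupLieAlgebra I G → ℝ) (x y : G ⧸ S) : ℝ≥0∞ :=
  ⨅ (a : G) (b : G) (_ : (a : G ⧸ S) = x) (_ : (b : G ⧸ S) = y), pathEDist I N a b

/-- The Riemannian distance of `G/S`, for the invariant metric `g`. -/
def metricEDist (Q : LinearMap.BilinForm ℝ (GroupLieAlgebra I G)) (S : Subgroup G)
    [ChartedSpace M' S] (g : LinearMap.BilinForm ℝ (isotropySpace I I' Q S)) :
    G ⧸ S → G ⧸ S → ℝ≥0∞ :=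
  cosetEDist I S fun X => √(g (isotropyProj I I' Q S X) (isotropyProj I I' Q S X))

/-- The Riemannian distance of the fibre `L/S` of `G/S → G/L`, for the metric induced on the fibre
by the invariant metric `g` on `G/S`. -/
def fibreEDist {E'' : Type*} [NormedAddCommGroup E''] [NormedSpace ℝ E''] {M'' : Type*}
    [TopologicalSpace M''] (I'' : ModelWithCorners ℝ E'' M'')
    (Q : LinearMap.BilinForm ℝ (GroupLieAlgebra I G)) (S L : Subgroup G)
    [ChartedSpace M' S] [ChartedSpace M'' L]
    (g : LinearMap.BilinForm ℝ (isotropySpace I I' Q S)) :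
    L ⧸ S.subgroupOf L → L ⧸ S.subgroupOf L → ℝ≥0∞ :=
  cosetEDist I'' (S.subgroupOf L) fun X =>
    √(g (isotropyProj I I' Q S (lieInclusion I I'' L X))
      (isotropyProj I I' Q S (lieInclusion I I'' L X)))

end LieGroup

/-- The diameter of a space with respect to a distance function. -/
def diameter {A : Type*} (d : A → A → ℝ≥0∞) : ℝ≥0∞ := ⨆ (x) (y), d x y

/-- `R` is an `ε`-approximation between `A` and `B`. -/
structure IsApproximation {A B : Type*} (dA : A → A → ℝ≥0∞) (dB : B → B → ℝ≥0∞) (ε : ℝ≥0∞)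
    (R : Set (A × B)) : Prop where
  fst_surj : ∀ a, ∃ b, (a, b) ∈ R
  snd_surj : ∀ b, ∃ a, (a, b) ∈ R
  close : ∀ p ∈ R, ∀ q ∈ R, dA p.1 q.1 < dB p.2 q.2 + ε ∧ dB p.2 q.2 < dA p.1 q.1 + ε

/-- The Gromov-Hausdorff distance: the infimum of the `ε` for which there is an
`ε`-approximation. -/
def gromovHausdorffEDist {A B : Type*} (dA : A → A → ℝ≥0∞) (dB : B → B → ℝ≥0∞) : ℝ≥0∞ :=
  sInf {ε | ∃ R : Set (A × B), IsApproximation dA dB ε R}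

/-! ## The two singular behaviours -/

section Singular

open Filter

variable {E : Type*} [NormedAddCommGroup E] [NormedSpace ℝ E] {M : Type*} [TopologicalSpace M]
  (I : ModelWithCorners ℝ E M)
  {E' : Type*} [NormedAddCommGroup E'] [NormedSpace ℝ E'] {M' : Type*} [TopologicalSpace M']
  (I' : ModelWithCorners ℝ E' M')
  {E'' : Type*} [NormedAddCommGroup E''] [NormedSpace ℝ E''] {M'' : Type*} [TopologicalSpace M'']
  (I'' : ModelWithCorners ℝ E'' M'')
  {G : Type*} [TopologicalSpace G] [ChartedSpace M G] [Group G]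
  (Q : LinearMap.BilinForm ℝ (GroupLieAlgebra I G))
  (S L : Subgroup G) [ChartedSpace M' S] [ChartedSpace M'' L]
  (T : ℝ) (g : ℝ → LinearMap.BilinForm ℝ (isotropySpace I I' Q S))

/-- As `t → T`, the whole space `(G/S, g(t))` shrinks to a point: the metric tends to zero, and
so does the diameter. -/
structure ShrinksToPoint : Prop where
  metric : ∀ X : isotropySpace I I' Q S, Tendsto (fun t => g t X X) (𝓝[<] T) (𝓝 0)
  diam : Tendsto (fun t => diameter (metricEDist I I' Q S (g t))) (𝓝[<] T) (𝓝 0)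

/-- As `t → T`, the fibre `L/S` of `G/S → G/L` shrinks to a point: the metric tends to zero on the
vertical space `𝔩 ∩ 𝔭`, and so does the diameter of the fibre. -/
structure FibreShrinksToPoint : Prop where
  metric : ∀ X : isotropySpace I I' Q S, (X : GroupLieAlgebra I G) ∈ lieAlgebra I I'' L →
    Tendsto (fun t => g t X X) (𝓝[<] T) (𝓝 0)
  diam : Tendsto (fun t => diameter (fibreEDist I I' I'' Q S L (g t))) (𝓝[<] T) (𝓝 0)

/-- As `t → T`, the space `(G/S, g(t))` converges to `(G/L, h)`: the metrics `g(t)` tend to the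
pullback of `h` along `G/S → G/L`, and there is convergence in the Gromov-Hausdorff topology. -/
structure ConvergesToBase (h : LinearMap.BilinForm ℝ (isotropySpace I I'' Q L)) : Prop where
  metric : ∀ X Y : GroupLieAlgebra I G,
    Tendsto (fun t => g t (isotropyProj I I' Q S X) (isotropyProj I I' Q S Y)) (𝓝[<] T)
      (𝓝 (h (isotropyProj I I'' Q L X) (isotropyProj I I'' Q L Y)))
  gromovHausdorff : Tendsto (fun t => gromovHausdorffEDist (metricEDist I I' Q S (g t))
    (metricEDist I I'' Q L h)) (𝓝[<] T) (𝓝 0)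

end Singular

end HomogeneousRicci

end

/-!
The theorem reduces to an autonomous ordinary differential equation for two positive functions. By
Schur's lemma (`IsInner.exists_eq_mul_of_irreducible`, `IsInner.eq_zero_of_not_equivalent`), the
inequivalent irreducible summands `𝔭₁` and `𝔭₂` are orthogonal, and every invariant metric has the
form `x₁ Q|𝔭₁ + x₂ Q|𝔭₂` (`diagMetric`); the Ricci tensor, being invariant under `Ad(K)`, has this
form as well. Koszul's formula gives the Levi-Civita connection explicitly
(`IsTwoSummand.coe_leviCivita`), and the two coefficients of the Ricci tensor follow by taking traces
(`IsIrreducibleTwoSummand.exists_ricciForm_eq`). What enters here is that `𝔥 = 𝔨 ⊕ 𝔭₁` is a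
subalgebra, so that `[𝔭₁, 𝔭₁]` has no component in `𝔭₂`, and that `Q` is `ad`-invariant; the latter
requires that the derivative of `Ad` is the Lie bracket (`hasFDerivAt_Ad_chart`). The Ricci flow
becomes (`IsScalingFlow`)

  `x₁' = - C - a u²`, `x₂' = - β + b u`, where `u = x₁ / x₂`, `a = [122] / (2 d₁)`,
  `b = [122] / d₂`,

and `β` is a constant. Since `C > 0`, the first factor decreases at least at the rate `C`, so the
flow ends at a finite time `T` and `x₁ ≥ C (T - t)`. The ratio satisfies `u' = - q(u) / x₂` with
`q(u) = (a + b) u² - β u + C`, and therefore stays bounded. Both factors converge, and `x₁ → 0`, as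
otherwise the solution could be continued. If `q` has a zero `u` in `(0, u(0)]`, then `x₁ ≥ u x₂`
is preserved and `x₂ → 0`; moreover the metric with ratio `u` is Einstein. If there is no such zero,
`u` decreases so fast that `log x₂` is bounded from below, and `x₂` has a positive limit
(`IsScalingFlow.singular_behaviour`).

Rescaling shows what to expect of the curvature: with a bounded ratio it is at most of the order of
`1 / x₁` (`IsTwoSummand.exists_curvatureNorm_le`), hence of the order of `1 / (T - t)`. It is
unbounded because the Ricci curvature of a fixed vector in `𝔭₁` is at least `C / 2`, while the length
of the vector tends to zero.

The distances are controlled by comparison of length functions on the Lie algebra. A connected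
quotient of a compact group has finite diameter (`exists_bound_cosetEDist`), so the space, or the
fibre `H/K`, has diameter at most of the order of the square root of the factors. If only `x₁ → 0`,
paths in the base lift to paths in `G` whose lengths converge, and their ends are joined to given
points within the shrinking fibres; this bounds the distances of `G/K` by those of `G/H`, up to an
error which is uniform by equicontinuity and compactness (`tendsto_gromovHausdorffEDist`).
-/

open scoped Manifold ContDiff ENNReal Topology

noncomputable section

namespace HomogeneousRicci

/-! ### The adjoint representation and its derivative -/

section AdLemmas

set_option linter.unusedSectionVars false

variable {E : Type*} [NormedAddCommGroup E] [NormedSpace ℝ E] {M : Type*} [TopologicalSpace M]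
  {I : ModelWithCorners ℝ E M}
  {G : Type*} [TopologicalSpace G] [ChartedSpace M G] [Group G] [LieGroup I ∞ G]

lemma contMDiff_conj (a : G) : ContMDiff I I ∞ (fun x : G => a * x * a⁻¹) :=
  (contMDiff_mul_left (I := I) (n := ∞) (a := a)).mul contMDiff_const

lemma mdifferentiableAt_mul_left' (a x : G) : MDifferentiableAt I I (fun y : G => a * y) x :=
  (contMDiff_mul_left (I := I) (n := ∞) (a := a)).mdifferentiableAt (by simp)

lemma mdifferentiableAt_mul_right' (a x : G) : MDifferentiableAt I I (fun y : G => y * a) x :=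
  (contMDiff_mul_right (I := I) (n := ∞) (a := a)).mdifferentiableAt (by simp)

lemma mdifferentiableAt_conj (a x : G) : MDifferentiableAt I I (fun y : G => a * y * a⁻¹) x :=
  (contMDiff_conj (I := I) a).mdifferentiableAt (by simp)

/-- Chain rule in a form which forgets the base points: tangent vectors are regarded as elements of
the model space. -/
lemma mfderiv_comp_apply_eq {E₁ E₂ E₃ : Type*} [NormedAddCommGroup E₁] [NormedSpace ℝ E₁]
    [NormedAddCommGroup E₂] [NormedSpace ℝ E₂] [NormedAddCommGroup E₃] [NormedSpace ℝ E₃]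
    {M₁ M₂ M₃ : Type*} [TopologicalSpace M₁] [TopologicalSpace M₂] [TopologicalSpace M₃]
    {I₁ : ModelWithCorners ℝ E₁ M₁} {I₂ : ModelWithCorners ℝ E₂ M₂} {I₃ : ModelWithCorners ℝ E₃ M₃}
    {A B C : Type*} [TopologicalSpace A] [ChartedSpace M₁ A] [TopologicalSpace B]
    [ChartedSpace M₂ B] [TopologicalSpace C] [ChartedSpace M₃ C]
    {f : A → B} {g : B → C} {h : A → C} (x : A) (y : B) (hy : f x = y)
    (hg : MDifferentiableAt I₂ I₃ g y) (hf : MDifferentiableAt I₁ I₂ f x)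
    (hh : ∀ z, h z = g (f z)) (v : E₁) :
    (show E₃ from mfderiv I₁ I₃ h x v) =
      mfderiv I₂ I₃ g y (show E₂ from mfderiv I₁ I₂ f x v) := by
  subst hy
  obtain rfl : h = g ∘ f := funext hh
  rw [mfderiv_comp x hg hf]
  rfl

/-- Left multiplication by `a` is conjugation by `a` followed by right multiplication by `a`. -/
lemma mfderiv_mul_left_eq_mul_right_Ad (a : G) (Y : GroupLieAlgebra I G) :
    (show E from mfderiv I I (fun x : G => a * x) 1 Y) =
      mfderiv I I (fun x : G => x * a) 1 (Ad I a Y) :=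
  mfderiv_comp_apply_eq (E₁ := E) (E₂ := E) (E₃ := E) (1 : G) 1 (by simp)
    (mdifferentiableAt_mul_right' a _)
    (mdifferentiableAt_conj a 1) (fun z => by simp) Y

lemma Ad_mul (a b : G) (X : GroupLieAlgebra I G) : Ad I (a * b) X = Ad I a (Ad I b X) :=
  mfderiv_comp_apply_eq (E₁ := E) (E₂ := E) (E₃ := E) (1 : G) 1 (by simp)
    (mdifferentiableAt_conj a _)
    (mdifferentiableAt_conj b 1) (fun z => by group) X

lemma Ad_one (X : GroupLieAlgebra I G) : Ad I (1 : G) X = X := by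
  have : (fun x : G => 1 * x * 1⁻¹) = id := by ext; simp
  simp only [Ad]
  change mfderiv I I (fun x : G => 1 * x * 1⁻¹) 1 X = X
  rw [this, mfderiv_id]
  rfl

lemma Ad_Ad_inv (a : G) (X : GroupLieAlgebra I G) : Ad I a (Ad I a⁻¹ X) = X := by
  rw [← Ad_mul, mul_inv_cancel, Ad_one]

lemma isInvertible_mfderiv_conj (a x : G) :
    (mfderiv I I (fun y : G => a * y * a⁻¹) x).IsInvertible := by
  let f := mfderiv I I (fun y : G => a * y * a⁻¹) x
  let f' := mfderiv I I (fun y : G => a⁻¹ * y * a⁻¹⁻¹) (a * x * a⁻¹)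
  have h1 : ∀ v : E, f' (f v) = v := fun v => by
    have := mfderiv_comp_apply_eq (h := id) x (a * x * a⁻¹) rfl
      (mdifferentiableAt_conj (I := I) a⁻¹ _) (mdifferentiableAt_conj (I := I) a x)
      (fun z => by simp; group) v
    rw [mfderiv_id] at this
    exact this.symm
  have h2 : ∀ v : E, f (f' v) = v := fun v => by
    have := mfderiv_comp_apply_eq (h := id) (a * x * a⁻¹) x (by group)
      (mdifferentiableAt_conj (I := I) a _) (mdifferentiableAt_conj (I := I) a⁻¹ _)
      (fun z => by simp; group) v
    rw [mfderiv_id] at this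
    exact this.symm
  exact ⟨ContinuousLinearEquiv.equivOfInverse f f' h1 h2, rfl⟩

variable [CompleteSpace E]

open VectorField in
/-- Conjugation by `a` relates the left-invariant field of `X` to that of `Ad a X`. -/
lemma mpullback_conj_mulInvariantVectorField (a : G) (X : GroupLieAlgebra I G) :
    mpullback I I (fun x : G => a * x * a⁻¹) (mulInvariantVectorField (Ad I a X)) =
      mulInvariantVectorField X := by
  ext x
  rw [mpullback_apply]
  have h : (mulInvariantVectorField (Ad I a X) (a * x * a⁻¹)) =
      mfderiv I I (fun y : G => a * y * a⁻¹) x (mulInvariantVectorField X x) := by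
    have h1 := mfderiv_comp_apply_eq (h := fun z => a * (x * z) * a⁻¹) (1 : G) x (by simp)
      (mdifferentiableAt_conj (I := I) a x) (mdifferentiableAt_mul_left' (I := I) x 1)
      (fun z => by simp) X
    have h2 := mfderiv_comp_apply_eq (h := fun z => a * (x * z) * a⁻¹) (1 : G) 1 (by simp)
      (mdifferentiableAt_mul_left' (I := I) (a * x * a⁻¹) 1) (mdifferentiableAt_conj (I := I) a 1)
      (fun z => by group) X
    exact h2.symm.trans h1
  rw [h]
  exact (isInvertible_mfderiv_conj a x).inverse_apply_self _

lemma mulInvariantVectorField_one (X : GroupLieAlgebra I G) :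
    mulInvariantVectorField X (1 : G) = X := by
  have : (fun x : G => 1 * x) = id := by ext; simp
  rw [mulInvariantVectorField, this, mfderiv_id]
  rfl

/-- `Ad a` is a homomorphism of Lie algebras. -/
lemma Ad_lie (a : G) (X Y : GroupLieAlgebra I G) : Ad I a ⁅X, Y⁆ = ⁅Ad I a X, Ad I a Y⁆ := by
  have h := VectorField.mpullback_mlieBracket (x₀ := (1 : G)) (n := ∞)
    (mdifferentiableAt_mulInvariantVectorField (Ad I a X))
    (mdifferentiableAt_mulInvariantVectorField (Ad I a Y)) (contMDiff_conj (I := I) a 1)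
    (by rw [minSmoothness_of_isRCLikeNormedField]; exact ENat.LEInfty.out)
  rw [mpullback_conj_mulInvariantVectorField, mpullback_conj_mulInvariantVectorField,
    ← mulInvariantVector_mlieBracket, ← GroupLieAlgebra.bracket_def, ← GroupLieAlgebra.bracket_def,
    ← Ad_Ad_inv a ⁅Ad I a X, Ad I a Y⁆, mpullback_conj_mulInvariantVectorField,
    mulInvariantVectorField_one] at h
  rw [← h]; exact Ad_Ad_inv a _

variable [I.Boundaryless]

variable (I G) in
/-- The multiplication of the group, read in the preferred chart at the identity. -/
def chartMul (z : E × E) : E :=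
  extChartAt I (1 : G) ((extChartAt I (1 : G)).symm z.1 * (extChartAt I (1 : G)).symm z.2)

lemma contDiffAt_chartMul :
    ContDiffAt ℝ ∞ (chartMul I G) (extChartAt I (1 : G) 1, extChartAt I (1 : G) 1) := by
  rw [← contMDiffAt_iff_contDiffAt]
  have hs : ContMDiffAt 𝓘(ℝ, E) I ∞ (extChartAt I (1 : G)).symm (extChartAt I (1 : G) 1) :=
    (contMDiffOn_extChartAt_symm (1 : G)).contMDiffAt (extChartAt_target_mem_nhds _)
  have h1 : ContMDiffAt 𝓘(ℝ, E × E) I ∞ (fun z : E × E => (extChartAt I (1 : G)).symm z.1)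
      (extChartAt I (1 : G) 1, extChartAt I (1 : G) 1) :=
    ContMDiffAt.comp (I' := 𝓘(ℝ, E)) (extChartAt I (1 : G) 1, extChartAt I (1 : G) 1) hs
      (contMDiffAt_iff_contDiffAt.2 contDiffAt_fst)
  have h2 : ContMDiffAt 𝓘(ℝ, E × E) I ∞ (fun z : E × E => (extChartAt I (1 : G)).symm z.2)
      (extChartAt I (1 : G) 1, extChartAt I (1 : G) 1) :=
    ContMDiffAt.comp (I' := 𝓘(ℝ, E)) (extChartAt I (1 : G) 1, extChartAt I (1 : G) 1) hs
      (contMDiffAt_iff_contDiffAt.2 contDiffAt_snd)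
  refine ContMDiffAt.comp_of_eq (y := (1 : G)) contMDiffAt_extChartAt (h1.mul h2) (by simp)

lemma mdifferentiableAt_chart_symm {p : E} (hp : p ∈ (extChartAt I (1 : G)).target) :
    MDifferentiableAt 𝓘(ℝ, E) I (extChartAt I (1 : G)).symm p :=
  ((contMDiffOn_extChartAt_symm (n := ∞) (1 : G)).contMDiffAt
    ((isOpen_extChartAt_target (1 : G)).mem_nhds hp)).mdifferentiableAt (by simp)

lemma mfderiv_chart_symm_one (v : E) :
    (show E from mfderiv 𝓘(ℝ, E) I (extChartAt I (1 : G)).symm (extChartAt I (1 : G) 1) v) = v := by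
  have := mfderivWithin_range_extChartAt_symm (I := I) (x := (1 : G))
  rw [I.range_eq_univ, mfderivWithin_univ] at this
  rw [this]; rfl

lemma mdifferentiableAt_chart {a : G} (ha : a ∈ (extChartAt I (1 : G)).source) :
    MDifferentiableAt I 𝓘(ℝ, E) (extChartAt I (1 : G)) a :=
  mdifferentiableAt_extChartAt (by rwa [extChartAt_source] at ha)

/-- In the chart, the partial derivative of the multiplication in the second variable at
`(p, e)` is the left-invariant vector field at the point with coordinate `p`. -/
lemma fderiv_chartMul_right {p : E} (hp : p ∈ (extChartAt I (1 : G)).target)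
    (hd : DifferentiableAt ℝ (chartMul I G) (p, extChartAt I (1 : G) 1)) (Y : E) :
    fderiv ℝ (chartMul I G) (p, extChartAt I (1 : G) 1) (0, Y) =
      mfderiv I 𝓘(ℝ, E) (extChartAt I (1 : G)) ((extChartAt I (1 : G)).symm p)
        (mulInvariantVectorField (I := I) Y ((extChartAt I (1 : G)).symm p)) := by
  set a := (extChartAt I (1 : G)).symm p with ha
  have has : a ∈ (extChartAt I (1 : G)).source := (extChartAt I (1 : G)).map_target hp
  have h1 := mfderiv_comp_apply_eq (h := fun q => extChartAt I (1 : G)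
      (a * (extChartAt I (1 : G)).symm q)) (extChartAt I (1 : G) 1) a (by simp)
    (mdifferentiableAt_chart has) ((mdifferentiableAt_mul_left' (I := I) a _).comp _
      (mdifferentiableAt_chart_symm (mem_extChartAt_target (1 : G)))) (fun z => rfl) Y
  have h2 := mfderiv_comp_apply_eq (h := (fun q => a * q) ∘ (extChartAt I (1 : G)).symm)
    (extChartAt I (1 : G) 1) 1 (by simp)
    (mdifferentiableAt_mul_left' (I := I) a _)
      (mdifferentiableAt_chart_symm (mem_extChartAt_target (1 : G))) (fun z => rfl) Y
  rw [mfderiv_chart_symm_one] at h2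
  rw [h2, mfderiv_eq_fderiv] at h1
  have h3 : HasFDerivAt (fun q => chartMul I G (p, q)) _ (extChartAt I (1 : G) 1) :=
    hd.hasFDerivAt.comp (extChartAt I (1 : G) 1) (hasFDerivAt_prodMk_right p _)
  have h4 : fderiv ℝ (fun q => chartMul I G (p, q)) (extChartAt I (1 : G) 1) Y = _ := h1
  rw [h3.fderiv] at h4
  exact h4

/-- In the chart, the partial derivative of the multiplication in the first variable at
`(e, p)` is the right-invariant vector field at the point with coordinate `p`. -/
lemma fderiv_chartMul_left {p : E} (hp : p ∈ (extChartAt I (1 : G)).target)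
    (hd : DifferentiableAt ℝ (chartMul I G) (extChartAt I (1 : G) 1, p)) (Y : E) :
    fderiv ℝ (chartMul I G) (extChartAt I (1 : G) 1, p) (Y, 0) =
      mfderiv I 𝓘(ℝ, E) (extChartAt I (1 : G)) ((extChartAt I (1 : G)).symm p)
        (mfderiv I I (fun x : G => x * (extChartAt I (1 : G)).symm p) 1 Y : E) := by
  set a := (extChartAt I (1 : G)).symm p with ha
  have has : a ∈ (extChartAt I (1 : G)).source := (extChartAt I (1 : G)).map_target hp
  have h1 := mfderiv_comp_apply_eq (h := fun q => extChartAt I (1 : G)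
      ((extChartAt I (1 : G)).symm q * a)) (extChartAt I (1 : G) 1) a (by simp)
    (mdifferentiableAt_chart has) ((mdifferentiableAt_mul_right' (I := I) a _).comp _
      (mdifferentiableAt_chart_symm (mem_extChartAt_target (1 : G)))) (fun z => rfl) Y
  have h2 := mfderiv_comp_apply_eq (h := (fun q => q * a) ∘ (extChartAt I (1 : G)).symm)
    (extChartAt I (1 : G) 1) 1 (by simp)
    (mdifferentiableAt_mul_right' (I := I) a _)
      (mdifferentiableAt_chart_symm (mem_extChartAt_target (1 : G))) (fun z => rfl) Y
  rw [mfderiv_chart_symm_one] at h2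
  rw [h2, mfderiv_eq_fderiv] at h1
  have h3 : HasFDerivAt (fun q => chartMul I G (q, p)) _ (extChartAt I (1 : G) 1) :=
    HasFDerivAt.comp (f := fun q => (q, p)) (extChartAt I (1 : G) 1) hd.hasFDerivAt
      (hasFDerivAt_prodMk_left _ p)
  have h4 : fderiv ℝ (fun q => chartMul I G (q, p)) (extChartAt I (1 : G) 1) Y = _ := h1
  rw [h3.fderiv] at h4
  exact h4

open VectorField in
lemma mpullbackWithin_chart_symm_mulInvariantVectorField {p : E}
    (hp : p ∈ (extChartAt I (1 : G)).target)
    (hd : DifferentiableAt ℝ (chartMul I G) (p, extChartAt I (1 : G) 1))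
    (Y : GroupLieAlgebra I G) :
    (mpullbackWithin 𝓘(ℝ, E) I (extChartAt I (1 : G)).symm (mulInvariantVectorField Y)
      (Set.range I) p : E) = fderiv ℝ (chartMul I G) (p, extChartAt I (1 : G) 1) (0, Y) := by
  refine Eq.trans ?_ (fderiv_chartMul_right hp hd Y).symm
  rw [mpullbackWithin_apply]
  congr 1
  apply ContinuousLinearMap.inverse_eq
  · exact mfderivWithin_extChartAt_symm_comp_mfderiv_extChartAt hp
  · exact mfderiv_extChartAt_comp_mfderivWithin_extChartAt_symm hp

/-- In the chart, `Ad` is determined by the first partial derivatives of the multiplication. -/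
lemma fderiv_chartMul_Ad {p : E} (hp : p ∈ (extChartAt I (1 : G)).target)
    (hd : DifferentiableAt ℝ (chartMul I G) (p, extChartAt I (1 : G) 1))
    (hd' : DifferentiableAt ℝ (chartMul I G) (extChartAt I (1 : G) 1, p))
    (Y : GroupLieAlgebra I G) :
    fderiv ℝ (chartMul I G) (extChartAt I (1 : G) 1, p)
        ((Ad I ((extChartAt I (1 : G)).symm p) Y : E), 0) =
      fderiv ℝ (chartMul I G) (p, extChartAt I (1 : G) 1) (0, (Y : E)) := by
  refine (fderiv_chartMul_left hp hd' _).trans (Eq.trans ?_ (fderiv_chartMul_right hp hd _).symm)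
  exact congrArg _ (mfderiv_mul_left_eq_mul_right_Ad _ Y).symm

/-- The Lie bracket is the antisymmetrisation of the mixed second derivative of the multiplication
at the identity. -/
lemma bracket_eq_fderiv_fderiv_chartMul (X Y : GroupLieAlgebra I G) :
    ⁅X, Y⁆ =
      (fderiv ℝ (fderiv ℝ (chartMul I G)) (extChartAt I (1 : G) 1, extChartAt I (1 : G) 1)
        ((X : E), 0) (0, (Y : E)) -
      fderiv ℝ (fderiv ℝ (chartMul I G)) (extChartAt I (1 : G) 1, extChartAt I (1 : G) 1)
        ((Y : E), 0) (0, (X : E)) : E) := by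
  set e := extChartAt I (1 : G) 1 with he
  have hC2 : ContDiffAt ℝ 2 (chartMul I G) (e, e) :=
    contDiffAt_chartMul.of_le ENat.LEInfty.out
  have hD2 : DifferentiableAt ℝ (fderiv ℝ (chartMul I G)) (e, e) :=
    (hC2.fderiv_right (m := 1) one_add_one_eq_two.le).differentiableAt (by simp)
  have hev : ∀ᶠ z in 𝓝 (e, e), DifferentiableAt ℝ (chartMul I G) z := by
    filter_upwards [hC2.eventually (by simp)] with z hz
    exact hz.differentiableAt (by simp)
  have hev1 : ∀ᶠ p in 𝓝 e, DifferentiableAt ℝ (chartMul I G) (p, e) :=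
    (Continuous.tendsto (f := fun p : E => (p, e)) (by fun_prop) e).eventually hev
  -- the invariant vector fields in the chart, and their derivatives
  have hV : ∀ Z : GroupLieAlgebra I G, (fun p : E =>
      (VectorField.mpullbackWithin 𝓘(ℝ, E) I (extChartAt I (1 : G)).symm
      (mulInvariantVectorField Z) (Set.range I) p : E)) =ᶠ[𝓝 e]
        fun p => fderiv ℝ (chartMul I G) (p, e) (0, (Z : E)) := fun Z => by
    filter_upwards [hev1, extChartAt_target_mem_nhds (I := I) (1 : G)] with p hp hp'
    exact mpullbackWithin_chart_symm_mulInvariantVectorField hp' hp Z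
  have hDV : ∀ Z W : E, fderiv ℝ (fun p => fderiv ℝ (chartMul I G) (p, e) (0, Z)) e W =
      fderiv ℝ (fderiv ℝ (chartMul I G)) (e, e) (W, 0) (0, Z) := fun Z W => by
    have h1 : HasFDerivAt (fun p => fderiv ℝ (chartMul I G) (p, e)) _ e :=
      HasFDerivAt.comp (f := fun p => (p, e)) e hD2.hasFDerivAt (hasFDerivAt_prodMk_left e e)
    have h2 := h1.clm_apply (hasFDerivAt_const ((0 : E), Z) e)
    rw [h2.fderiv]
    simp
  have hV1 : ∀ Z : GroupLieAlgebra I G, fderiv ℝ (chartMul I G) (e, e) (0, (Z : E)) = Z :=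
      fun Z => by
    have h1 := fderiv_chartMul_right (I := I) (mem_extChartAt_target (1 : G)) hev1.self_of_nhds Z
    refine h1.trans ?_
    have h2 : (extChartAt I (1 : G)).symm (extChartAt I (1 : G) 1) = 1 := by simp
    rw [h2]
    refine (congrArg _ (mulInvariantVectorField_one Z)).trans ?_
    rw [mfderiv_extChartAt_self]
    rfl
  let V : GroupLieAlgebra I G → E → E := fun Z p =>
    VectorField.mpullbackWithin 𝓘(ℝ, E) I (extChartAt I (1 : G)).symm
      (mulInvariantVectorField Z) (Set.range I) p
  have hinv : ∀ w : E, ((mfderiv I 𝓘(ℝ, E) (extChartAt I (1 : G)) 1).inverse w : E) = w :=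
    fun w => by
      rw [mfderiv_extChartAt_self]
      exact congrArg (fun f : E →L[ℝ] E => f w) ContinuousLinearMap.inverse_id
  have hs : (extChartAt I (1 : G)).symm ⁻¹' Set.univ ∩ Set.range I = Set.univ := by
    rw [I.range_eq_univ, Set.preimage_univ, Set.univ_inter]
  have h : ⁅X, Y⁆ = VectorField.lieBracket ℝ (V X) (V Y) e := by
    rw [GroupLieAlgebra.bracket_def, ← VectorField.mlieBracketWithin_univ,
      VectorField.mlieBracketWithin_apply]
    refine (hinv _).trans ?_
    rw [hs]
    exact congrFun (VectorField.lieBracketWithin_univ (V := V X) (W := V Y)) e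
  have hVX : V X e = X := (hV X).self_of_nhds.trans (hV1 X)
  have hVY : V Y e = Y := (hV Y).self_of_nhds.trans (hV1 Y)
  have hdX : fderiv ℝ (V X) e = _ := (hV X).fderiv_eq
  have hdY : fderiv ℝ (V Y) e = _ := (hV Y).fderiv_eq
  have key : VectorField.lieBracket ℝ (V X) (V Y) e =
      fderiv ℝ (V Y) e (V X e) - fderiv ℝ (V X) e (V Y e) := rfl
  rw [hVX, hVY, hdX, hdY] at key
  exact h.trans (key.trans (congrArg₂ (· - ·) (hDV Y X) (hDV X Y)))

variable (I) in
/-- The orbit map `a ↦ Ad a Y`, with values in the model space of the tangent spaces. -/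
def adOrbit (Y : GroupLieAlgebra I G) (a : G) : E := Ad I a Y

/-- The derivative of the adjoint representation at the identity is the Lie bracket, in the chart:
differentiate the identity `∂₁μ(e, p) (Ad(p) Y) = ∂₂μ(p, e) Y` at `p = e`. -/
lemma hasFDerivAt_Ad_chart (Y : GroupLieAlgebra I G) :
    ∃ L : E →L[ℝ] E, (∀ X : GroupLieAlgebra I G, L X = ⁅X, Y⁆) ∧
      HasFDerivAt (fun p : E => adOrbit I Y ((extChartAt I (1 : G)).symm p)) L
        (extChartAt I (1 : G) 1) := by
  set e := extChartAt I (1 : G) 1 with he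
  have hC2 : ContDiffAt ℝ 2 (chartMul I G) (e, e) :=
    contDiffAt_chartMul.of_le ENat.LEInfty.out
  have hD2 : DifferentiableAt ℝ (fderiv ℝ (chartMul I G)) (e, e) :=
    (hC2.fderiv_right (m := 1) one_add_one_eq_two.le).differentiableAt (by simp)
  have hev : ∀ᶠ z in 𝓝 (e, e), DifferentiableAt ℝ (chartMul I G) z := by
    filter_upwards [hC2.eventually (by simp)] with z hz
    exact hz.differentiableAt (by simp)
  have hev1 : ∀ᶠ p in 𝓝 e, DifferentiableAt ℝ (chartMul I G) (p, e) :=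
    (Continuous.tendsto (f := fun p : E => (p, e)) (by fun_prop) e).eventually hev
  have hev2 : ∀ᶠ p in 𝓝 e, DifferentiableAt ℝ (chartMul I G) (e, p) :=
    (Continuous.tendsto (f := fun p : E => (e, p)) (by fun_prop) e).eventually hev
  have hone : (extChartAt I (1 : G)).symm e = 1 := by simp [he]
  -- `Y`, regarded as an element of the model space
  obtain ⟨y, hy⟩ : ∃ y : E, y = Y := ⟨_, rfl⟩
  let A : E → E := fun p => adOrbit I Y ((extChartAt I (1 : G)).symm p)
  have hAe : A e = y := by
    refine Eq.trans ?_ hy.symm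
    change (Ad I ((extChartAt I (1 : G)).symm e) Y : E) = Y
    rw [hone, Ad_one]
  -- The two sides of the identity are `D1 p (A p)` and `w p`, where `D1 e = 1`; the goal is to
  -- differentiate them at `e`.
  let D1 : E → E →L[ℝ] E := fun p =>
    (fderiv ℝ (chartMul I G) (e, p)).comp (ContinuousLinearMap.inl ℝ E E)
  let w : E → E := fun p => fderiv ℝ (chartMul I G) (p, e) (0, y)
  have hA : ∀ᶠ p in 𝓝 e, D1 p (A p) = w p := by
    filter_upwards [hev1, hev2, extChartAt_target_mem_nhds (I := I) (1 : G)] with p h1 h2 h3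
    exact (fderiv_chartMul_Ad h3 h1 h2 Y).trans (by simp only [w, hy]; rfl)
  have hD1e : D1 e = 1 := by
    ext Z
    have h1 := fderiv_chartMul_left (I := I) (mem_extChartAt_target (1 : G)) hev2.self_of_nhds Z
    refine h1.trans ?_
    rw [← he, hone, mfderiv_extChartAt_self]
    have h2 : (fun x : G => x * 1) = id := by ext; simp
    rw [h2, mfderiv_id]
    rfl
  have hD1 : HasFDerivAt D1 _ e :=
    (HasFDerivAt.comp (f := fun p => (e, p)) e hD2.hasFDerivAt
      (hasFDerivAt_prodMk_right e e)).clm_comp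
      (hasFDerivAt_const (ContinuousLinearMap.inl ℝ E E) e)
  have hw : HasFDerivAt w _ e :=
    (HasFDerivAt.comp (f := fun p => (p, e)) e hD2.hasFDerivAt
      (hasFDerivAt_prodMk_left e e)).clm_apply (hasFDerivAt_const ((0 : E), y) e)
  -- `D1 p` is invertible near `e`, so that `A p = (D1 p)⁻¹ (w p)` is differentiable.
  have hunit : ∀ᶠ p in 𝓝 e, IsUnit (D1 p) := by
    refine hD1.continuousAt.eventually (Units.isOpen.mem_nhds ?_)
    rw [hD1e]
    exact isUnit_one
  have hAd : DifferentiableAt ℝ A e := by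
    have h1 : A =ᶠ[𝓝 e] fun p => Ring.inverse (D1 p) (w p) := by
      filter_upwards [hA, hunit] with p hp hu
      rw [← hp]
      change A p = (Ring.inverse (D1 p) * D1 p) (A p)
      rw [Ring.inverse_mul_cancel _ hu]
      rfl
    refine DifferentiableAt.congr_of_eventuallyEq ?_ h1
    refine DifferentiableAt.clm_apply ?_ hw.differentiableAt
    have h2 : DifferentiableAt ℝ (Ring.inverse : (E →L[ℝ] E) → E →L[ℝ] E) (D1 e) := by
      rw [hD1e]
      exact differentiableAt_inverse isUnit_one
    exact h2.comp e hD1.differentiableAt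
  refine ⟨fderiv ℝ A e, fun X => ?_, hAd.hasFDerivAt⟩
  -- The derivative of `D1` contributes `∂₂∂₁μ` in the order opposite to the one in the formula for
  -- the bracket: the symmetry of second derivatives is needed.
  have h1 := hD1.clm_apply hAd.hasFDerivAt
  have h2 := h1.unique (hw.congr_of_eventuallyEq hA)
  have hsymm : IsSymmSndFDerivAt ℝ (chartMul I G) (e, e) :=
    hC2.isSymmSndFDerivAt minSmoothness_of_isRCLikeNormedField.le
  have h3 : ∀ x : E, fderiv ℝ A e x + fderiv ℝ (fderiv ℝ (chartMul I G)) (e, e) (0, x) (y, 0) =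
      fderiv ℝ (fderiv ℝ (chartMul I G)) (e, e) (x, 0) (0, y) := fun x => by
    have h4 := congrArg (fun f : E →L[ℝ] E => f x) h2
    simpa [hD1e, hAe] using h4
  refine Eq.trans ?_ (bracket_eq_fderiv_fderiv_chartMul X Y).symm
  refine (eq_sub_of_add_eq (h3 X)).trans ?_
  rw [hsymm.eq (0, (X : E)), hy]

/-- The derivative of the adjoint representation at the identity is the Lie bracket, on the group:
`hasFDerivAt_Ad_chart` without coordinates. -/
lemma hasMFDerivAt_Ad (Y : GroupLieAlgebra I G) :
    ∃ L : E →L[ℝ] E, (∀ X : GroupLieAlgebra I G, L X = ⁅X, Y⁆) ∧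
      HasMFDerivAt I 𝓘(ℝ, E) (adOrbit I Y) (1 : G) L := by
  obtain ⟨L, hL, hd⟩ := hasFDerivAt_Ad_chart Y
  refine ⟨L, hL, ?_⟩
  have h1 : HasMFDerivAt I 𝓘(ℝ, E) (extChartAt I (1 : G)) 1 (ContinuousLinearMap.id ℝ E) := by
    have := (mdifferentiableAt_chart (I := I) (mem_extChartAt_source (1 : G))).hasMFDerivAt
    rwa [mfderiv_extChartAt_self] at this
  have h2 := hd.hasMFDerivAt.comp (1 : G) h1
  refine h2.congr_of_eventuallyEq ?_
  filter_upwards [extChartAt_source_mem_nhds (I := I) (1 : G)] with a ha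
  simp only [Function.comp]
  rw [(extChartAt I (1 : G)).left_inv ha]

variable [FiniteDimensional ℝ E]

/-- An `Ad`-invariant bilinear form is `ad`-invariant. -/
lemma ad_invariant_of_Ad_invariant {Q : LinearMap.BilinForm ℝ (GroupLieAlgebra I G)}
    (hQ : ∀ (a : G) (X Y : GroupLieAlgebra I G), Q (Ad I a X) (Ad I a Y) = Q X Y)
    (X Y Z : GroupLieAlgebra I G) : Q ⁅X, Y⁆ Z + Q Y ⁅X, Z⁆ = 0 := by
  obtain ⟨L, hL, hY⟩ := hasFDerivAt_Ad_chart Y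
  obtain ⟨L', hL', hZ⟩ := hasFDerivAt_Ad_chart Z
  let Q₀ : E →ₗ[ℝ] E →ₗ[ℝ] ℝ := Q
  let Qc : E →L[ℝ] E →L[ℝ] ℝ := LinearMap.toContinuousLinearMap
    (LinearMap.toContinuousLinearMap.toLinearMap ∘ₗ Q₀)
  -- Differentiate the constant function `a ↦ Q (Ad a Y) (Ad a Z)` at the identity.
  have h1 := Qc.hasFDerivAt_of_bilinear hY hZ
  have h2 : (fun p : E => Qc (adOrbit I Y ((extChartAt I (1 : G)).symm p))
      (adOrbit I Z ((extChartAt I (1 : G)).symm p))) = fun _ => Q Y Z := funext fun p => hQ _ Y Z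
  rw [h2] at h1
  have h3 := congrArg (fun f : E →L[ℝ] ℝ => f X) (h1.unique (hasFDerivAt_const _ _))
  have h4 : (extChartAt I (1 : G)).symm (extChartAt I (1 : G) 1) = 1 := by simp
  have h5 : Q₀ (Ad I ((extChartAt I (1 : G)).symm (extChartAt I (1 : G) 1)) Y) (L' X) +
    Q₀ (L X) (Ad I ((extChartAt I (1 : G)).symm (extChartAt I (1 : G) 1)) Z) = 0 := h3
  rw [h4, Ad_one, Ad_one, hL, hL'] at h5
  rw [add_comm]
  exact h5

variable {E' : Type*} [NormedAddCommGroup E'] [NormedSpace ℝ E'] {M' : Type*} [TopologicalSpace M']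
  {I' : ModelWithCorners ℝ E' M'}

/-- A subspace invariant under `Ad` of a Lie subgroup is invariant under `ad` of its Lie algebra. -/
lemma lie_mem_of_Ad_mem (S : Subgroup G) [ChartedSpace M' S]
    (hS : ContMDiff I' I ∞ (Subtype.val : S → G)) (W : Submodule ℝ (GroupLieAlgebra I G))
    (hW : ∀ a ∈ S, ∀ X ∈ W, Ad I a X ∈ W) {X Y : GroupLieAlgebra I G}
    (hX : X ∈ lieAlgebra I I' S) (hY : Y ∈ W) : ⁅X, Y⁆ ∈ W := by
  obtain ⟨v, rfl⟩ := hX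
  obtain ⟨L, hL, hd⟩ := hasMFDerivAt_Ad Y
  by_contra hn
  -- A functional which vanishes on `W` vanishes on `Ad a Y` for all `a ∈ S`, hence on the
  -- derivative of this orbit in the direction of `X`.
  obtain ⟨f, hf, hfW⟩ := Submodule.exists_le_ker_of_notMem hn
  let f₀ : E →ₗ[ℝ] ℝ := f
  let fc : E →L[ℝ] ℝ := LinearMap.toContinuousLinearMap f₀
  have h1 : HasMFDerivAt I' I (Subtype.val : S → G) 1 (mfderiv I' I (Subtype.val : S → G) 1) :=
    (hS.mdifferentiableAt (by simp)).hasMFDerivAt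
  have h2 := (fc.hasFDerivAt (x := adOrbit I Y (1 : G))).hasMFDerivAt.comp (1 : S)
    (HasMFDerivAt.comp (1 : S) hd h1)
  have h3 : (fc ∘ adOrbit I Y ∘ (Subtype.val : S → G)) = fun _ => (0 : ℝ) :=
    funext fun a => hfW (hW a a.2 Y hY)
  rw [h3] at h2
  have h4 := hasMFDerivAt_unique h2 (hasMFDerivAt_const (0 : ℝ) (1 : S))
  have h5 := congrArg (fun g : E' →L[ℝ] ℝ => g v) h4
  refine hf (Eq.trans ?_ h5)
  exact (congrArg f₀ (hL _)).symm

/-- On the Lie algebra of a Lie subgroup, the adjoint representation of the group restricts to that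
of the subgroup. -/
lemma Ad_lieInclusion (S : Subgroup G) [ChartedSpace M' S] [LieGroup I' ∞ S]
    (hS : ContMDiff I' I ∞ (Subtype.val : S → G)) (s : S) (X : GroupLieAlgebra I' S) :
    Ad I (s : G) (lieInclusion I I' S X) = lieInclusion I I' S (Ad I' s X) := by
  have hd : ∀ x : S, MDifferentiableAt I' I (Subtype.val : S → G) x := fun x =>
    hS.mdifferentiableAt (by simp)
  have h1 := mfderiv_comp_apply_eq (h := fun x : S => (s : G) * x * (s : G)⁻¹) (1 : S) (1 : G) rfl
    (mdifferentiableAt_conj (I := I) (s : G) 1) (hd 1) (fun z => rfl) X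
  have h2 := mfderiv_comp_apply_eq (h := fun x : S => (s : G) * x * (s : G)⁻¹) (1 : S) (1 : S)
    (by simp) (hd 1) (mdifferentiableAt_conj (I := I') s 1) (fun z => by simp) X
  exact h1.symm.trans h2

lemma Ad_mem_lieAlgebra (S : Subgroup G) [ChartedSpace M' S] [LieGroup I' ∞ S]
    (hS : ContMDiff I' I ∞ (Subtype.val : S → G)) {a : G} (ha : a ∈ S) {X : GroupLieAlgebra I G}
    (hX : X ∈ lieAlgebra I I' S) : Ad I a X ∈ lieAlgebra I I' S := by
  obtain ⟨v, rfl⟩ := hX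
  exact ⟨Ad I' ⟨a, ha⟩ v, (Ad_lieInclusion S hS ⟨a, ha⟩ v).symm⟩

lemma lie_mem_lieAlgebra (S : Subgroup G) [ChartedSpace M' S] [LieGroup I' ∞ S]
    (hS : ContMDiff I' I ∞ (Subtype.val : S → G)) {X Y : GroupLieAlgebra I G}
    (hX : X ∈ lieAlgebra I I' S) (hY : Y ∈ lieAlgebra I I' S) : ⁅X, Y⁆ ∈ lieAlgebra I I' S :=
  lie_mem_of_Ad_mem S hS _ (fun _ ha _ h => Ad_mem_lieAlgebra S hS ha h) hX hY

end AdLemmas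

/-! ### Left-invariant lengths and distances on a Lie group -/

section PathDistance

set_option linter.unusedSectionVars false

variable {E : Type*} [NormedAddCommGroup E] [NormedSpace ℝ E] {M : Type*} [TopologicalSpace M]
  {I : ModelWithCorners ℝ E M}
  {G : Type*} [TopologicalSpace G] [ChartedSpace M G] [Group G]

/-- The left translate of a tangent vector of a Lie group to the Lie algebra
(the Maurer-Cartan form). -/
def maurerCartan (x : G) (v : TangentSpace I x) : GroupLieAlgebra I G :=
  (mfderiv I I (fun y : G => x⁻¹ * y) x v : E)

/-- The left-invariant length structure given by the function `N` on the Lie algebra. -/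
abbrev leftENorm (N : GroupLieAlgebra I G → ℝ) (x : G) : ENorm (TangentSpace I x) :=
  ⟨fun v => ENNReal.ofReal (N (maurerCartan x v))⟩

/-- Absolute homogeneity of a function on a real vector space. -/
def IsHomogeneous {V : Type*} [AddCommGroup V] [Module ℝ V] (N : V → ℝ) : Prop :=
  ∀ (c : ℝ) (X : V), N (c • X) = |c| * N X

lemma maurerCartan_smul (x : G) (c : ℝ) (v : TangentSpace I x) :
    maurerCartan x (c • v) = c • maurerCartan x v :=
  map_smul (mfderiv I I (fun y : G => x⁻¹ * y) x) c v

lemma enormSMulClass_leftENorm {N : GroupLieAlgebra I G → ℝ} (hN : IsHomogeneous N) (x : G) :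
    letI := leftENorm N x
    ENormSMulClass ℝ (TangentSpace I x) := by
  let := leftENorm N x
  refine ⟨fun c v => ?_⟩
  change ENNReal.ofReal (N (maurerCartan x (c • v))) = ‖c‖ₑ * ENNReal.ofReal (N (maurerCartan x v))
  rw [maurerCartan_smul, hN, ENNReal.ofReal_mul (abs_nonneg c), ← Real.enorm_eq_ofReal_abs]

variable {N : GroupLieAlgebra I G → ℝ}

/-- Unfolds `pathEDist`, so that Mathlib's lemmas on `Manifold.riemannianEDist` apply. -/
lemma pathEDist_eq (N : GroupLieAlgebra I G → ℝ) (a b : G) :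
    letI := leftENorm N
    pathEDist I N a b = Manifold.riemannianEDist I a b := rfl

lemma pathEDist_self (hN : IsHomogeneous N) (a : G) : pathEDist I N a a = 0 := by
  let := leftENorm N
  have : ∀ x : G, ENormSMulClass ℝ (TangentSpace I x) := enormSMulClass_leftENorm hN
  simp only [pathEDist_eq]
  exact Manifold.riemannianEDist_self

lemma pathEDist_comm (hN : IsHomogeneous N) (a b : G) : pathEDist I N a b = pathEDist I N b a := by
  let := leftENorm N
  have : ∀ x : G, ENormSMulClass ℝ (TangentSpace I x) := enormSMulClass_leftENorm hN
  simp only [pathEDist_eq]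
  exact Manifold.riemannianEDist_comm

lemma pathEDist_triangle (hN : IsHomogeneous N) (a b c : G) :
    pathEDist I N a c ≤ pathEDist I N a b + pathEDist I N b c := by
  let := leftENorm N
  have : ∀ x : G, ENormSMulClass ℝ (TangentSpace I x) := enormSMulClass_leftENorm hN
  simp only [pathEDist_eq]
  exact Manifold.riemannianEDist_triangle

/-- The distance is at most the length of a path, an integral over its velocity. -/
lemma pathEDist_le_lintegral (hN : IsHomogeneous N) {γ : ℝ → G}
    (hγ : ContMDiffOn 𝓘(ℝ, ℝ) I 1 γ (Set.Icc 0 1)) :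
    pathEDist I N (γ 0) (γ 1) ≤ ∫⁻ t in Set.Ioo (0 : ℝ) 1,
      ENNReal.ofReal (N (maurerCartan (γ t) (mfderiv 𝓘(ℝ, ℝ) I γ t (1 : ℝ)))) := by
  let := leftENorm N
  have : ∀ x : G, ENormSMulClass ℝ (TangentSpace I x) := enormSMulClass_leftENorm hN
  refine (Manifold.riemannianEDist_le_pathELength hγ rfl rfl zero_le_one).trans_eq ?_
  rw [Manifold.pathELength_eq_lintegral_mfderiv_Ioo]
  rfl

/-- Paths whose length is close to the distance may be taken to be `C¹` on the whole real line,
which avoids one-sided derivatives. -/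
lemma exists_path_of_pathEDist_lt (hN : IsHomogeneous N) {a b : G} {r : ℝ≥0∞}
    (h : pathEDist I N a b < r) :
    ∃ γ : ℝ → G, γ 0 = a ∧ γ 1 = b ∧ ContMDiff 𝓘(ℝ, ℝ) I 1 γ ∧
      ∫⁻ t in Set.Ioo (0 : ℝ) 1,
        ENNReal.ofReal (N (maurerCartan (γ t) (mfderiv 𝓘(ℝ, ℝ) I γ t (1 : ℝ)))) < r := by
  let := leftENorm N
  have : ∀ x : G, ENormSMulClass ℝ (TangentSpace I x) := enormSMulClass_leftENorm hN
  rw [pathEDist_eq] at h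
  obtain ⟨γ, h0, h1, h2, h3, -, -⟩ :=
    Manifold.exists_lt_locally_constant_of_riemannianEDist_lt (I := I) h zero_lt_one
  refine ⟨γ, h0, h1, h2, ?_⟩
  rw [Manifold.pathELength_eq_lintegral_mfderiv_Ioo] at h3
  exact h3

variable {E' : Type*} [NormedAddCommGroup E'] [NormedSpace ℝ E'] {M' : Type*} [TopologicalSpace M']
  {I' : ModelWithCorners ℝ E' M'}
  {G' : Type*} [TopologicalSpace G'] [ChartedSpace M' G'] [Group G']
  {N' : GroupLieAlgebra I' G' → ℝ}

/-- A map which stretches left-invariant lengths by at most the factor `C` stretches distances by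
at most the factor `C`. -/
lemma pathEDist_map_le (hN : IsHomogeneous N) (hN' : IsHomogeneous N') {F : G' → G}
    (hF : ContMDiff I' I ∞ F) {C : ℝ} (hC : 0 < C)
    (h : ∀ x (v : TangentSpace I' x), N (maurerCartan (F x) (mfderiv I' I F x v)) ≤
      C * N' (maurerCartan x v)) (a b : G') :
    pathEDist I N (F a) (F b) ≤ ENNReal.ofReal C * pathEDist I' N' a b := by
  have hC0 : ENNReal.ofReal C ≠ 0 := by simpa using hC
  rw [mul_comm, ← ENNReal.div_le_iff_le_mul (Or.inl hC0) (Or.inl ENNReal.ofReal_ne_top)]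
  refine le_of_forall_gt fun r hr => ?_
  obtain ⟨γ, h0, h1, hγ, hl⟩ := exists_path_of_pathEDist_lt hN' hr
  have hγ' : ContMDiff 𝓘(ℝ, ℝ) I 1 (F ∘ γ) := (hF.of_le ENat.LEInfty.out).comp hγ
  have h2 := pathEDist_le_lintegral hN hγ'.contMDiffOn
  simp only [Function.comp, h0, h1] at h2
  refine lt_of_le_of_lt ?_ hl
  rw [ENNReal.div_le_iff_le_mul (Or.inl hC0) (Or.inl ENNReal.ofReal_ne_top), mul_comm,
    ← MeasureTheory.lintegral_const_mul' _ _ ENNReal.ofReal_ne_top]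
  refine h2.trans (MeasureTheory.lintegral_mono fun t => ?_)
  rw [← ENNReal.ofReal_mul hC.le]
  refine ENNReal.ofReal_le_ofReal ?_
  have h3 := mfderiv_comp_apply_eq (h := F ∘ γ) t (γ t) rfl
    (hF.mdifferentiableAt (by simp)) (hγ.mdifferentiableAt (by simp)) (fun _ => rfl) (1 : ℝ)
  have h4 := h (γ t) (mfderiv 𝓘(ℝ, ℝ) I' γ t (1 : ℝ))
  rwa [← h3] at h4

variable [LieGroup I ∞ G]

lemma maurerCartan_mul_left (c x : G) (v : TangentSpace I x) :
    maurerCartan (c * x) (mfderiv I I (fun y : G => c * y) x v) = maurerCartan x v :=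
  (mfderiv_comp_apply_eq (h := fun y : G => x⁻¹ * y) x (c * x) rfl
    (mdifferentiableAt_mul_left' (I := I) (c * x)⁻¹ _) (mdifferentiableAt_mul_left' (I := I) c x)
    (fun z => by group) v).symm

/-- The Maurer-Cartan form is equivariant under right translations. -/
lemma maurerCartan_mul_right (c x : G) (v : TangentSpace I x) :
    maurerCartan (x * c) (mfderiv I I (fun y : G => y * c) x v) = Ad I c⁻¹ (maurerCartan x v) := by
  have h1 := mfderiv_comp_apply_eq (h := fun y : G => (x * c)⁻¹ * (y * c)) x (x * c) rfl
    (mdifferentiableAt_mul_left' (I := I) (x * c)⁻¹ _) (mdifferentiableAt_mul_right' (I := I) c x)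
    (fun z => rfl) v
  have h2 := mfderiv_comp_apply_eq (h := fun y : G => (x * c)⁻¹ * (y * c)) x 1 (by simp)
    (mdifferentiableAt_conj (I := I) c⁻¹ 1) (mdifferentiableAt_mul_left' (I := I) x⁻¹ x)
    (fun z => by group) v
  exact h1.symm.trans h2

lemma pathEDist_mul_left_le (hN : IsHomogeneous N) (c a b : G) :
    pathEDist I N (c * a) (c * b) ≤ pathEDist I N a b := by
  simpa using pathEDist_map_le hN hN (contMDiff_mul_left (a := c)) one_pos
    (fun x v => by rw [maurerCartan_mul_left, one_mul]) a b

lemma pathEDist_mul_left (hN : IsHomogeneous N) (c a b : G) :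
    pathEDist I N (c * a) (c * b) = pathEDist I N a b := by
  refine le_antisymm (pathEDist_mul_left_le hN c a b) ?_
  simpa using pathEDist_mul_left_le hN c⁻¹ (c * a) (c * b)

/-- A length function which is `Ad c`-invariant gives a distance invariant under right translation
by `c`. -/
lemma pathEDist_mul_right_le (hN : IsHomogeneous N) {c : G} (hc : ∀ X, N (Ad I c⁻¹ X) = N X)
    (a b : G) : pathEDist I N (a * c) (b * c) ≤ pathEDist I N a b := by
  simpa using pathEDist_map_le hN hN (contMDiff_mul_right (a := c)) one_pos
    (fun x v => by rw [maurerCartan_mul_right, hc, one_mul]) a b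

lemma pathEDist_mono_mul (hN : IsHomogeneous N) {N₂ : GroupLieAlgebra I G → ℝ}
    (hN₂ : IsHomogeneous N₂) {C : ℝ} (hC : 0 < C) (h : ∀ X, N X ≤ C * N₂ X) (a b : G) :
    pathEDist I N a b ≤ ENNReal.ofReal C * pathEDist I N₂ a b := by
  refine pathEDist_map_le (F := id) hN hN₂ contMDiff_id hC (fun x v => ?_) a b
  rw [mfderiv_id]
  exact h _

/-- The inclusion of a Lie subgroup does not increase distances if it does not increase lengths on
the Lie algebra. -/
lemma pathEDist_inclusion_le (S : Subgroup G) [ChartedSpace M' S] [LieGroup I' ∞ S]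
    (hS : ContMDiff I' I ∞ (Subtype.val : S → G)) {N' : GroupLieAlgebra I' S → ℝ}
    (hN : IsHomogeneous N) (hN' : IsHomogeneous N') (h : ∀ X, N (lieInclusion I I' S X) ≤ N' X)
    (a b : S) : pathEDist I N (a : G) (b : G) ≤ pathEDist I' N' a b := by
  have := pathEDist_map_le hN hN' hS one_pos (fun x v => ?_) a b
  · simpa using this
  rw [one_mul]
  refine le_of_eq_of_le (congrArg N ?_) (h _)
  have hd : ∀ x : S, MDifferentiableAt I' I (Subtype.val : S → G) x := fun x =>
    hS.mdifferentiableAt (by simp)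
  have h1 := mfderiv_comp_apply_eq (h := fun y : S => (x : G)⁻¹ * y) x (x : G) rfl
    (mdifferentiableAt_mul_left' (I := I) (x : G)⁻¹ x) (hd x) (fun z => rfl) v
  have h2 := mfderiv_comp_apply_eq (h := fun y : S => (x : G)⁻¹ * y) x (1 : S)
    (by simp) (hd 1) (mdifferentiableAt_mul_left' (I := I') x⁻¹ x) (fun z => by simp) v
  exact h1.symm.trans h2

end PathDistance

/-! ### Short paths near the identity -/

section PathDistance

set_option linter.unusedSectionVars false

variable {E : Type*} [NormedAddCommGroup E] [NormedSpace ℝ E] {M : Type*} [TopologicalSpace M]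
  {I : ModelWithCorners ℝ E M}
  {G : Type*} [TopologicalSpace G] [ChartedSpace M G] [Group G] [LieGroup I ∞ G]

/-- The norm of the model space, as a function on the Lie algebra. -/
def modelNorm (X : GroupLieAlgebra I G) : ℝ := @norm E _ X

open Bundle in
/-- The Maurer-Cartan form is continuous on the tangent bundle: it is the tangent map of the
multiplication, evaluated at the zero vector over `x⁻¹` and a vector over `x`. -/
lemma continuous_maurerCartan :
    Continuous (fun p : TangentBundle I G => (maurerCartan p.1 p.2 : E)) := by
  have : IsManifold I 1 G := IsManifold.of_le (n := ∞) ENat.LEInfty.out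
  -- the map `v ↦ x⁻¹ v`, as a map of the tangent bundle into itself
  let F : TangentBundle I G → TangentBundle I G := fun p =>
    tangentMap (I.prod I) I (fun p : G × G => p.1 * p.2)
      ((equivTangentBundleProd I G I G).symm (TotalSpace.mk' E p.1⁻¹ 0, p))
  have hF : Continuous F := by
    have hz : Continuous (fun g : G => (TotalSpace.mk' E g 0 : TangentBundle I G)) :=
      (contMDiff_zeroSection (IB := I) (n := 1) ℝ (TangentSpace I : G → Type _)).continuous
    have hinv : Continuous (fun g : G => g⁻¹) :=
      (contMDiff_inv (G := G) (I := I) (n := ∞)).continuous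
    have h3 : Continuous (tangentMap (I.prod I) I (fun p : G × G => p.1 * p.2)) :=
      (contMDiff_mul I ∞).continuous_tangentMap (by simp)
    have h2 : Continuous (equivTangentBundleProd I G I G).symm :=
      (contMDiff_equivTangentBundleProd_symm (n := 0)).continuous
    exact h3.comp (h2.comp
      ((hz.comp (hinv.comp (FiberBundle.continuous_proj E (TangentSpace I)))).prodMk continuous_id))
  have hbase : ∀ (y : G) (_ : y = 1) (w w' : E) (_ : w = w'),
      (TotalSpace.mk' E y w : TangentBundle I G) = TotalSpace.mk' E (1 : G) w' := by
    rintro y rfl w w' rfl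
    rfl
  have hFeq : ∀ p, F p = TotalSpace.mk' E (1 : G) (maurerCartan p.1 p.2 : E) := fun p => by
    refine hbase (p.1⁻¹ * p.1) (by simp) _ _ ?_
    have h := mfderiv_prod_eq_add_apply (I := I) (I' := I) (I'' := I) (p := (p.1⁻¹, p.1))
      (v := (0, p.2)) ((contMDiff_mul (G := G) I ∞).mdifferentiableAt (by simp))
    refine h.trans ?_
    exact (congrArg (· + _) (map_zero _)).trans (zero_add _)
  let e := trivializationAt E (TangentSpace I) (1 : G)
  have h1 : ∀ w : GroupLieAlgebra I G, (e (TotalSpace.mk' E (1 : G) w)).2 = w := fun w => by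
    have h := TangentBundle.continuousLinearMapAt_trivializationAt (I := I)
      (mem_chart_source M (1 : G))
    rw [mfderiv_extChartAt_self] at h
    have h' := congrArg (fun f : E →L[ℝ] E => f w) h
    refine Eq.trans ?_ h'
    exact (congrFun (e.coe_linearMapAt_of_mem (R := ℝ) (mem_chart_source M (1 : G))) w).symm
  have h2 : Continuous fun p => (e (F p)).2 := by
    refine continuous_snd.comp (e.continuousOn.comp_continuous hF fun p => ?_)
    rw [e.mem_source, hFeq]
    exact mem_chart_source M (1 : G)
  refine h2.congr fun p => ?_
  rw [hFeq]
  exact h1 _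

lemma exists_bound_maurerCartan_path {γ : ℝ → G} (hγ : ContMDiff 𝓘(ℝ, ℝ) I 1 γ) :
    ∃ c : ℝ, ∀ t ∈ Set.Icc (0 : ℝ) 1,
      modelNorm (maurerCartan (γ t) (mfderiv 𝓘(ℝ, ℝ) I γ t (1 : ℝ))) ≤ c := by
  have : IsManifold I 1 G := IsManifold.of_le (n := ∞) ENat.LEInfty.out
  have h1 : Continuous (fun t : ℝ =>
      (Bundle.TotalSpace.mk' ℝ t (1 : ℝ) : TangentBundle 𝓘(ℝ, ℝ) ℝ)) :=
    (tangentBundleModelSpaceHomeomorph 𝓘(ℝ, ℝ)).symm.continuous.comp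
      (Continuous.prodMk continuous_id (continuous_const (y := (1 : ℝ))))
  have h2 := (continuous_maurerCartan (I := I) (G := G)).comp
    ((hγ.continuous_tangentMap le_rfl).comp h1)
  obtain ⟨c, hc⟩ := isCompact_Icc.exists_bound_of_continuousOn (E := E) (s := Set.Icc (0 : ℝ) 1)
    h2.continuousOn
  exact ⟨c, hc⟩

variable [I.Boundaryless] {N : GroupLieAlgebra I G → ℝ}

/-- Points near the identity are joined to it by short paths, straight in the chart. -/
lemma eventually_pathEDist_one_le (hN : IsHomogeneous N) {c : ℝ}
    (hNc : ∀ X : GroupLieAlgebra I G, N X ≤ c * modelNorm X) {ε : ℝ} (hε : 0 < ε) :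
    ∀ᶠ a in 𝓝 (1 : G), pathEDist I N 1 a ≤ ENNReal.ofReal ε := by
  have : IsManifold I 1 G := IsManifold.of_le (n := ∞) ENat.LEInfty.out
  set φ := extChartAt I (1 : G) with hφ
  set e := φ 1 with he
  have hopen : IsOpen φ.target := isOpen_extChartAt_target (1 : G)
  have hsm : ContMDiffOn 𝓘(ℝ, E) I 1 φ.symm φ.target := contMDiffOn_extChartAt_symm (1 : G)
  -- `W (p, v)` is the velocity, moved to the Lie algebra, of a curve which in the chart passes
  -- through `p` with velocity `v`; it is continuous and vanishes for `v = 0`.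
  let W : E × E → E := fun z =>
    maurerCartan (φ.symm z.1) (mfderiv 𝓘(ℝ, E) I φ.symm z.1 z.2)
  have hW : ContinuousAt W (e, 0) := by
    have h1 : ContinuousAt (tangentMapWithin 𝓘(ℝ, E) I φ.symm φ.target)
        (Bundle.TotalSpace.mk' E e (0 : E) : TangentBundle 𝓘(ℝ, E) E) := by
      refine (hsm.continuousOn_tangentMapWithin le_rfl hopen.uniqueMDiffOn).continuousAt ?_
      refine IsOpen.mem_nhds (hopen.preimage (FiberBundle.continuous_proj E _)) ?_
      exact mem_extChartAt_target (1 : G)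
    have h2 : Continuous (fun z : E × E =>
        (Bundle.TotalSpace.mk' E z.1 z.2 : TangentBundle 𝓘(ℝ, E) E)) :=
      (tangentBundleModelSpaceHomeomorph 𝓘(ℝ, E)).symm.continuous
    have h3 := continuous_maurerCartan (I := I) (G := G).continuousAt.comp
      (ContinuousAt.comp (f := fun z : E × E =>
        (Bundle.TotalSpace.mk' E z.1 z.2 : TangentBundle 𝓘(ℝ, E) E)) (x := (e, 0)) h1
        h2.continuousAt)
    refine h3.congr ?_
    filter_upwards [(hopen.preimage continuous_fst).mem_nhds
      (show (e, (0 : E)) ∈ Prod.fst ⁻¹' φ.target from mem_extChartAt_target (1 : G))] with z hz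
    simp only [Function.comp, tangentMapWithin, W]
    rw [mfderivWithin_of_isOpen hopen hz]
  have hW0 : W (e, 0) = 0 := by
    have h1 : mfderiv 𝓘(ℝ, E) I φ.symm e (0 : E) = 0 := map_zero _
    have h2 : (maurerCartan (φ.symm e) (0 : TangentSpace I (φ.symm e)) : E) = 0 :=
      map_zero (mfderiv I I (fun y : G => (φ.symm e)⁻¹ * y) (φ.symm e))
    exact (congrArg (maurerCartan (φ.symm e)) h1).trans h2
  have hc' : 0 < max c 0 + 1 := by positivity
  obtain ⟨r, hr, hr1, hr2⟩ : ∃ r > 0, (∀ z : E × E, dist z (e, 0) < r →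
      ‖W z‖ < ε / (max c 0 + 1)) ∧ Metric.ball e r ⊆ φ.target := by
    have h1 : ∀ᶠ z in 𝓝 (e, (0 : E)), ‖W z‖ < ε / (max c 0 + 1) := by
      have := hW.norm
      refine this.eventually_lt continuousAt_const ?_
      rw [hW0, norm_zero]
      positivity
    obtain ⟨r₁, hr₁, h₁⟩ := Metric.eventually_nhds_iff.1 h1
    obtain ⟨r₂, hr₂, h₂⟩ := Metric.isOpen_iff.1 hopen e (mem_extChartAt_target (1 : G))
    exact ⟨min r₁ r₂, lt_min hr₁ hr₂, fun z hz => h₁ (hz.trans_le (min_le_left _ _)),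
      (Metric.ball_subset_ball (min_le_right _ _)).trans h₂⟩
  have hφ1 : ∀ᶠ a in 𝓝 (1 : G), φ a ∈ Metric.ball e r :=
    (continuousAt_extChartAt (I := I) (1 : G)).eventually (Metric.ball_mem_nhds e hr)
  filter_upwards [hφ1, extChartAt_source_mem_nhds (I := I) (1 : G)] with a ha has
  set p := φ a with hp
  -- the straight segment from `e` to `p`, and the path in the group which it represents
  let σ : ℝ → E := fun t => e + t • (p - e)
  have hσ : ∀ t ∈ Set.Icc (0 : ℝ) 1, σ t ∈ Metric.ball e r := fun t ht => by
    have h1 : dist p e < r := ha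
    rw [dist_eq_norm] at h1
    simp only [σ, Metric.mem_ball, dist_eq_norm, add_sub_cancel_left, norm_smul, Real.norm_eq_abs,
      abs_of_nonneg ht.1]
    nlinarith [norm_nonneg (p - e), ht.2]
  have hσd : ContDiff ℝ 1 σ := by fun_prop
  let γ : ℝ → G := fun t => φ.symm (σ t)
  have hγ : ContMDiffOn 𝓘(ℝ, ℝ) I 1 γ (Set.Icc 0 1) :=
    hsm.comp hσd.contMDiff.contMDiffOn fun t ht => hr2 (hσ t ht)
  have h0 : γ 0 = 1 := by
    simp only [γ, σ, zero_smul, add_zero]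
    exact φ.left_inv (mem_extChartAt_source (1 : G))
  have h1 : γ 1 = a := by
    simp only [γ, σ, one_smul, add_sub_cancel]
    exact φ.left_inv has
  have h2 := pathEDist_le_lintegral hN hγ
  rw [h0, h1] at h2
  -- its speed is at most `ε`, because both `σ t` and `p - e` are small
  have h3 : ∀ t ∈ Set.Ioo (0 : ℝ) 1,
      ENNReal.ofReal (N (maurerCartan (γ t) (mfderiv 𝓘(ℝ, ℝ) I γ t (1 : ℝ)))) ≤
        ENNReal.ofReal ε := fun t ht => by
    have ht' : t ∈ Set.Icc (0 : ℝ) 1 := Set.Ioo_subset_Icc_self ht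
    refine ENNReal.ofReal_le_ofReal ?_
    have hσ' : HasDerivAt σ (p - e) t := by
      have h1 := ((hasDerivAt_id t).smul_const (p - e)).const_add e
      rwa [one_smul] at h1
    have h4 := mfderiv_comp_apply_eq (h := γ) t (σ t) rfl
      ((hsm.contMDiffAt (hopen.mem_nhds (hr2 (hσ t ht')))).mdifferentiableAt one_ne_zero)
      hσ'.differentiableAt.mdifferentiableAt (fun _ => rfl) (1 : ℝ)
    have h5 : (mfderiv 𝓘(ℝ, ℝ) 𝓘(ℝ, E) σ t (1 : ℝ) : E) = p - e := by
      rw [mfderiv_eq_fderiv]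
      refine (congrArg (fun f : ℝ →L[ℝ] E => f 1) hσ'.hasFDerivAt.fderiv).trans ?_
      exact one_smul ℝ (p - e)
    have h6 : maurerCartan (γ t) (mfderiv 𝓘(ℝ, ℝ) I γ t (1 : ℝ)) = W (σ t, p - e) := by
      refine congrArg (maurerCartan (γ t)) (h4.trans ?_)
      exact congrArg (mfderiv 𝓘(ℝ, E) I φ.symm (σ t)) h5
    have h7 : ‖W (σ t, p - e)‖ < ε / (max c 0 + 1) := by
      refine hr1 _ ?_
      rw [Prod.dist_eq, max_lt_iff]
      refine ⟨hσ t ht', ?_⟩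
      have h1 : dist p e < r := ha
      rw [dist_eq_norm] at h1 ⊢
      simpa using h1
    rw [lt_div_iff₀ hc'] at h7
    refine (hNc _).trans ?_
    rw [h6]
    change c * ‖W (σ t, p - e)‖ ≤ ε
    nlinarith [le_max_left c 0, norm_nonneg (W (σ t, p - e))]
  refine h2.trans ((MeasureTheory.setLIntegral_mono measurable_const h3).trans_eq ?_)
  simp

end PathDistance

/-! ### Distances on coset spaces -/

section CosetDistance

set_option linter.unusedSectionVars false

variable {E : Type*} [NormedAddCommGroup E] [NormedSpace ℝ E] {M : Type*} [TopologicalSpace M]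
  {I : ModelWithCorners ℝ E M}
  {G : Type*} [TopologicalSpace G] [ChartedSpace M G] [Group G]
  {S : Subgroup G} {N : GroupLieAlgebra I G → ℝ}

lemma cosetEDist_le_pathEDist (a b : G) : cosetEDist I S N a b ≤ pathEDist I N a b :=
  iInf_le_of_le a (iInf_le_of_le b (iInf_le_of_le rfl (iInf_le _ rfl)))

lemma exists_pathEDist_lt_of_cosetEDist_lt {x y : G ⧸ S} {r : ℝ≥0∞}
    (h : cosetEDist I S N x y < r) :
    ∃ a b : G, (a : G ⧸ S) = x ∧ (b : G ⧸ S) = y ∧ pathEDist I N a b < r := by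
  simpa only [cosetEDist, iInf_lt_iff, exists_prop] using h

lemma cosetEDist_comm (hN : IsHomogeneous N) (x y : G ⧸ S) :
    cosetEDist I S N x y = cosetEDist I S N y x := by
  have h : ∀ x y : G ⧸ S, cosetEDist I S N x y ≤ cosetEDist I S N y x := fun x y => by
    refine le_of_forall_gt fun r hr => ?_
    obtain ⟨a, b, rfl, rfl, hab⟩ := exists_pathEDist_lt_of_cosetEDist_lt hr
    refine (cosetEDist_le_pathEDist b a).trans_lt ?_
    rwa [pathEDist_comm hN]
  exact le_antisymm (h x y) (h y x)

variable [LieGroup I ∞ G]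

/-- Left translations of `G/S` do not increase distances. -/
lemma cosetEDist_mul_left_le (hN : IsHomogeneous N) (c a b : G) :
    cosetEDist I S N ((c * a : G) : G ⧸ S) ((c * b : G) : G ⧸ S) ≤ cosetEDist I S N a b := by
  refine le_of_forall_gt fun r hr => ?_
  obtain ⟨a', b', ha, hb, hab⟩ := exists_pathEDist_lt_of_cosetEDist_lt hr
  have ha' : ((c * a : G) : G ⧸ S) = ((c * a' : G) : G ⧸ S) := by
    rw [QuotientGroup.eq] at ha ⊢
    simpa [mul_assoc] using inv_mem ha
  have hb' : ((c * b : G) : G ⧸ S) = ((c * b' : G) : G ⧸ S) := by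
    rw [QuotientGroup.eq] at hb ⊢
    simpa [mul_assoc] using inv_mem hb
  rw [ha', hb']
  exact (cosetEDist_le_pathEDist _ _).trans_lt (by rwa [pathEDist_mul_left hN])

/-- Paths ending and starting in the same coset can be concatenated after a right translation,
which does not change lengths measured by an `Ad(S)`-invariant function. -/
lemma cosetEDist_triangle (hN : IsHomogeneous N) (hS : ∀ s ∈ S, ∀ X, N (Ad I s X) = N X)
    (x y z : G ⧸ S) : cosetEDist I S N x z ≤ cosetEDist I S N x y + cosetEDist I S N y z := by
  refine le_of_forall_gt fun r hr => ?_
  obtain ⟨u, hu, v, hv, huv⟩ := ENNReal.exists_add_lt_of_add_lt hr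
  obtain ⟨a, b, rfl, rfl, hab⟩ := exists_pathEDist_lt_of_cosetEDist_lt hu
  obtain ⟨b', c, hb', rfl, hbc⟩ := exists_pathEDist_lt_of_cosetEDist_lt hv
  rw [QuotientGroup.eq] at hb'
  have hc : (c : G ⧸ S) = ((c * (b'⁻¹ * b) : G) : G ⧸ S) := by
    rw [QuotientGroup.eq]
    simpa using hb'
  rw [hc]
  have h1 := pathEDist_mul_right_le hN (c := b'⁻¹ * b) (fun X => hS _ (inv_mem hb') X) b' c
  rw [mul_inv_cancel_left] at h1
  calc cosetEDist I S N a ((c * (b'⁻¹ * b) : G) : G ⧸ S)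
      ≤ pathEDist I N a (c * (b'⁻¹ * b)) := cosetEDist_le_pathEDist _ _
    _ ≤ pathEDist I N a b + pathEDist I N b (c * (b'⁻¹ * b)) := pathEDist_triangle hN _ _ _
    _ ≤ u + v := add_le_add hab.le (h1.trans hbc.le)
    _ < r := huv

/-- Distances in `G/L` and `G/S`, for `S ≤ L`, compare as the length functions do: paths joining
two cosets of `S` join the corresponding cosets of `L`. -/
lemma cosetEDist_mono_mul (hN : IsHomogeneous N) {N₂ : GroupLieAlgebra I G → ℝ}
    (hN₂ : IsHomogeneous N₂) {C : ℝ} (hC : 0 < C) (h : ∀ X, N X ≤ C * N₂ X) {L : Subgroup G}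
    (hSL : S ≤ L) (a b : G) :
    cosetEDist I L N a b ≤ ENNReal.ofReal C * cosetEDist I S N₂ a b := by
  have hC0 : ENNReal.ofReal C ≠ 0 := by simpa using hC
  rw [mul_comm, ← ENNReal.div_le_iff_le_mul (Or.inl hC0) (Or.inl ENNReal.ofReal_ne_top)]
  refine le_of_forall_gt fun r hr => ?_
  obtain ⟨a', b', ha, hb, hab⟩ := exists_pathEDist_lt_of_cosetEDist_lt hr
  refine lt_of_le_of_lt ?_ hab
  rw [ENNReal.div_le_iff_le_mul (Or.inl hC0) (Or.inl ENNReal.ofReal_ne_top), mul_comm]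
  have ha' : (a : G ⧸ L) = a' := by
    rw [QuotientGroup.eq] at ha ⊢
    simpa using inv_mem (hSL ha)
  have hb' : (b : G ⧸ L) = b' := by
    rw [QuotientGroup.eq] at hb ⊢
    simpa using inv_mem (hSL hb)
  rw [ha', hb']
  exact (cosetEDist_le_pathEDist _ _).trans (pathEDist_mono_mul hN hN₂ hC h a' b')

variable [I.Boundaryless]

/-- The points at finite distance from the identity form an open subgroup. -/
def finiteDistSubgroup (N : GroupLieAlgebra I G → ℝ) (hN : IsHomogeneous N) : Subgroup G where
  carrier := {a | pathEDist I N 1 a < ⊤}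
  one_mem' := by simp [pathEDist_self hN]
  mul_mem' {a b} ha hb := by
    refine (pathEDist_triangle hN 1 a (a * b)).trans_lt (ENNReal.add_lt_top.2 ⟨ha, ?_⟩)
    have := pathEDist_mul_left hN a 1 b
    rw [mul_one] at this
    rw [this]
    exact hb
  inv_mem' {a} ha := by
    change pathEDist I N 1 a⁻¹ < ⊤
    rw [← pathEDist_mul_left hN a, mul_one, mul_inv_cancel, pathEDist_comm hN]
    exact ha

variable [CompactSpace G]

/-- The quotient of a compact Lie group by a subgroup has finite diameter if it is connected: the
open subgroup of the points at finite distance from the identity is compact, hence bounded, and it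
acts transitively. -/
lemma exists_bound_cosetEDist (hN : IsHomogeneous N) {c : ℝ}
    (hNc : ∀ X : GroupLieAlgebra I G, N X ≤ c * modelNorm X) [ConnectedSpace (G ⧸ S)] :
    ∃ D : ℝ, 0 < D ∧ ∀ x y : G ⧸ S, cosetEDist I S N x y ≤ ENNReal.ofReal D := by
  have : IsTopologicalGroup G := topologicalGroup_of_lieGroup I ∞
  let U := finiteDistSubgroup N hN
  have hnear := eventually_pathEDist_one_le hN hNc one_pos
  have hopen : IsOpen (U : Set G) := U.isOpen_of_mem_nhds (g := 1) (by
    filter_upwards [hnear] with a ha using ha.trans_lt ENNReal.ofReal_lt_top)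
  have hcpt : IsCompact (U : Set G) := (U.isClosed_of_isOpen hopen).isCompact
  -- a compact set at finite distance from the identity is at bounded distance from it
  obtain ⟨D, hD⟩ : ∃ D : ℝ, ∀ a ∈ U, pathEDist I N 1 a ≤ ENNReal.ofReal D := by
    refine hcpt.induction_on (p := fun s => ∃ D : ℝ, ∀ a ∈ s, pathEDist I N 1 a ≤ ENNReal.ofReal D)
      ⟨0, by simp⟩ (fun s t hst ⟨D, hD⟩ => ⟨D, fun a ha => hD a (hst ha)⟩) ?_ ?_
    · rintro s t ⟨D, hD⟩ ⟨D', hD'⟩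
      refine ⟨max D D', fun a ha => ?_⟩
      rcases ha with ha | ha
      · exact (hD a ha).trans (ENNReal.ofReal_le_ofReal (le_max_left _ _))
      · exact (hD' a ha).trans (ENNReal.ofReal_le_ofReal (le_max_right _ _))
    · intro a ha
      refine ⟨_, mem_nhdsWithin_of_mem_nhds ?_, (pathEDist I N 1 a).toReal + 1, fun b hb => hb⟩
      have h1 : Filter.Tendsto (fun b => a⁻¹ * b) (𝓝 a) (𝓝 1) := by
        have h2 : Continuous fun b : G => a⁻¹ * b := by fun_prop
        simpa using h2.tendsto a
      filter_upwards [h1.eventually hnear] with b hb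
      rw [← pathEDist_mul_left hN a, mul_one, mul_inv_cancel_left] at hb
      refine (pathEDist_triangle hN 1 a b).trans ?_
      rw [ENNReal.ofReal_add ENNReal.toReal_nonneg zero_le_one,
        ENNReal.ofReal_toReal (ne_of_lt ha)]
      exact add_le_add le_rfl hb
  -- `U` acts transitively on the connected space `G ⧸ S`, as its orbits are open
  have htrans : ∀ x : G ⧸ S, ∃ u ∈ U, (u : G ⧸ S) = x := by
    have h1 : IsOpen ((QuotientGroup.mk : G → G ⧸ S) '' U) := QuotientGroup.isOpenMap_coe _ hopen
    have h2 : IsClosed ((QuotientGroup.mk : G → G ⧸ S) '' U) := by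
      rw [← (QuotientGroup.isQuotientMap_mk (N := S)).isClosed_preimage, ← isOpen_compl_iff,
        isOpen_iff_mem_nhds]
      intro a ha
      have h3 : (fun b => b * a⁻¹) ⁻¹' (U : Set G) ∈ 𝓝 a := by
        refine (hopen.preimage (continuous_mul_const a⁻¹)).mem_nhds ?_
        simp [one_mem]
      filter_upwards [h3] with b hb
      rintro ⟨u, hu, hub⟩
      refine ha ⟨(b * a⁻¹)⁻¹ * u, mul_mem (inv_mem hb) hu, ?_⟩
      rw [QuotientGroup.eq] at hub ⊢
      simpa [mul_assoc] using hub
    have h3 := IsClopen.eq_univ ⟨h2, h1⟩ ⟨_, 1, one_mem U, rfl⟩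
    intro x
    obtain ⟨u, hu, hx⟩ := h3.symm ▸ Set.mem_univ x
    exact ⟨u, hu, hx⟩
  refine ⟨max D 0 + max D 0 + 1, by positivity, fun x y => ?_⟩
  obtain ⟨u, hu, rfl⟩ := htrans x
  obtain ⟨v, hv, rfl⟩ := htrans y
  refine (cosetEDist_le_pathEDist u v).trans ((pathEDist_triangle hN u 1 v).trans ?_)
  rw [pathEDist_comm hN u 1]
  refine (add_le_add (hD u hu) (hD v hv)).trans ?_
  refine (add_le_add (ENNReal.ofReal_le_ofReal (le_max_left D 0))
    (ENNReal.ofReal_le_ofReal (le_max_left D 0))).trans ?_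
  rw [← ENNReal.ofReal_add (le_max_right _ _) (le_max_right _ _)]
  exact ENNReal.ofReal_le_ofReal (by linarith)

end CosetDistance

/-! ### Gromov-Hausdorff convergence to the base -/

section GromovHausdorff

set_option linter.unusedSectionVars false

open Filter

variable {E : Type*} [NormedAddCommGroup E] [NormedSpace ℝ E] {M : Type*} [TopologicalSpace M]
  {I : ModelWithCorners ℝ E M}
  {G : Type*} [TopologicalSpace G] [ChartedSpace M G] [Group G]

lemma isHomogeneous_modelNorm : IsHomogeneous (modelNorm : GroupLieAlgebra I G → ℝ) :=
  fun c X => norm_smul (α := ℝ) (β := E) c X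

variable [LieGroup I ∞ G] [I.Boundaryless]
  {S L : Subgroup G}
  {ι : Type*} {l : Filter ι} {N : ι → GroupLieAlgebra I G → ℝ} {N₀ : GroupLieAlgebra I G → ℝ}

/-- The upper bound for the distance of two points of the total space in terms of their projections
to the base. A nearly minimal path of the base is lifted to a path in `G`; its length converges, and
its ends are joined to the given points by short paths in the fibres. -/
lemma eventually_cosetEDist_le_add
    (hN : ∀ t, IsHomogeneous (N t)) (hS : ∀ᶠ t in l, ∀ s ∈ S, ∀ X, N t (Ad I s X) = N t X)
    (hN₀ : IsHomogeneous N₀)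
    (hlim : ∀ δ > 0, ∀ᶠ t in l, ∀ X, N t X ≤ (1 + δ) * N₀ X + δ * modelNorm X)
    (hfib : ∀ ε > 0, ∀ᶠ t in l, ∀ h ∈ L,
      cosetEDist I S (N t) (1 : G) (h : G) ≤ ENNReal.ofReal ε) {D : ℝ}
    (hD : ∀ x y : G ⧸ L, cosetEDist I L N₀ x y ≤ ENNReal.ofReal D)
    (a b : G) {ε : ℝ} (hε : 0 < ε) :
    ∀ᶠ t in l, cosetEDist I S (N t) a b ≤ cosetEDist I L N₀ a b + ENNReal.ofReal ε := by
  -- a path joining the two cosets of `L`, whose length is almost minimal for the limit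
  have hfin : cosetEDist I L N₀ a b ≠ ⊤ := ne_top_of_le_ne_top ENNReal.ofReal_ne_top (hD a b)
  obtain ⟨a', b', ha, hb, hab⟩ := exists_pathEDist_lt_of_cosetEDist_lt
    (ENNReal.lt_add_right hfin (b := ENNReal.ofReal (ε / 4)) (by simpa using hε))
  obtain ⟨γ, h0, h1, hγ, hl⟩ := exists_path_of_pathEDist_lt hN₀ hab
  obtain ⟨c, hc⟩ := exists_bound_maurerCartan_path hγ
  set len := ∫⁻ t in Set.Ioo (0 : ℝ) 1,
    ENNReal.ofReal (N₀ (maurerCartan (γ t) (mfderiv 𝓘(ℝ, ℝ) I γ t (1 : ℝ)))) with hlen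
  have hlen_top : len ≠ ⊤ := (hl.trans (ENNReal.add_lt_top.2 ⟨hfin.lt_top, by simp⟩)).ne
  -- `δ` is so small that the length of `γ` exceeds its limit by at most `ε / 4`
  obtain ⟨δ, hδ, hδ1, hδ2⟩ : ∃ δ > 0, δ * len.toReal ≤ ε / 8 ∧ δ * max c 0 ≤ ε / 8 := by
    refine ⟨ε / 8 / (len.toReal + max c 0 + 1), by positivity, ?_, ?_⟩
    · rw [div_mul_eq_mul_div, div_le_iff₀ (by positivity)]
      nlinarith [le_max_right c 0, ENNReal.toReal_nonneg (a := len)]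
    · rw [div_mul_eq_mul_div, div_le_iff₀ (by positivity)]
      nlinarith [le_max_right c 0, ENNReal.toReal_nonneg (a := len)]
  have hpath : ∀ᶠ t in l, pathEDist I (N t) a' b' ≤
      cosetEDist I L N₀ a b + ENNReal.ofReal (ε / 4) + ENNReal.ofReal (ε / 4) := by
    filter_upwards [hlim δ hδ] with t ht
    have h2 := pathEDist_le_lintegral (hN t) hγ.contMDiffOn
    rw [h0, h1] at h2
    have h3 : ∫⁻ s in Set.Ioo (0 : ℝ) 1,
        ENNReal.ofReal (N t (maurerCartan (γ s) (mfderiv 𝓘(ℝ, ℝ) I γ s (1 : ℝ)))) ≤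
        ∫⁻ s in Set.Ioo (0 : ℝ) 1, (ENNReal.ofReal (δ * max c 0) + ENNReal.ofReal (1 + δ) *
        ENNReal.ofReal (N₀ (maurerCartan (γ s) (mfderiv 𝓘(ℝ, ℝ) I γ s (1 : ℝ))))) := by
      refine MeasureTheory.setLIntegral_mono' measurableSet_Ioo fun s hs => ?_
      rw [← ENNReal.ofReal_mul (by positivity)]
      refine le_trans (ENNReal.ofReal_le_ofReal ?_) ENNReal.ofReal_add_le
      refine (ht _).trans ?_
      have h4 := (hc s (Set.Ioo_subset_Icc_self hs)).trans (le_max_left c 0)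
      nlinarith
    rw [MeasureTheory.lintegral_add_left measurable_const,
      MeasureTheory.lintegral_const_mul' _ _ ENNReal.ofReal_ne_top, ← hlen] at h3
    refine h2.trans (h3.trans ?_)
    have h5 : ENNReal.ofReal (1 + δ) * len ≤ len + ENNReal.ofReal (ε / 8) := by
      rw [ENNReal.ofReal_add zero_le_one hδ.le, ENNReal.ofReal_one, add_mul, one_mul]
      refine add_le_add le_rfl ?_
      rw [← ENNReal.ofReal_toReal hlen_top, ← ENNReal.ofReal_mul hδ.le]
      exact ENNReal.ofReal_le_ofReal hδ1
    calc (∫⁻ _ in Set.Ioo (0 : ℝ) 1, ENNReal.ofReal (δ * max c 0)) + ENNReal.ofReal (1 + δ) * len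
        ≤ ENNReal.ofReal (ε / 8) + (len + ENNReal.ofReal (ε / 8)) := by
          refine add_le_add ?_ h5
          simpa using ENNReal.ofReal_le_ofReal hδ2
      _ = len + ENNReal.ofReal (ε / 4) := by
          rw [add_left_comm, ← ENNReal.ofReal_add (by positivity) (by positivity)]
          congr 2; ring
      _ ≤ _ := add_le_add hl.le le_rfl
  -- points of the same fibre are close to each other, by homogeneity
  have hfibre : ∀ t, (∀ h ∈ L, cosetEDist I S (N t) (1 : G) (h : G) ≤ ENNReal.ofReal (ε / 4)) →
      ∀ x y : G, (x : G ⧸ L) = y → cosetEDist I S (N t) x y ≤ ENNReal.ofReal (ε / 4) := by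
    intro t ht x y hxy
    rw [QuotientGroup.eq] at hxy
    have h2 := cosetEDist_mul_left_le (S := S) (hN t) x 1 (x⁻¹ * y)
    rw [mul_one, mul_inv_cancel_left] at h2
    exact h2.trans (ht _ hxy)
  -- The error is `ε / 4` for each fibre, for the choice of the path, and for the convergence of its
  -- length.
  filter_upwards [hpath, hfib (ε / 4) (by positivity), hS] with t h2 h3 h4
  have h5 := hfibre t h3 a a' ha.symm
  have h6 := hfibre t h3 b' b hb
  calc cosetEDist I S (N t) a b
      ≤ cosetEDist I S (N t) a a' + (cosetEDist I S (N t) a' b' + cosetEDist I S (N t) b' b) :=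
        (cosetEDist_triangle (hN t) h4 _ (a' : G ⧸ S) _).trans
          (add_le_add le_rfl (cosetEDist_triangle (hN t) h4 _ _ _))
    _ ≤ ENNReal.ofReal (ε / 4) + (cosetEDist I L N₀ a b + ENNReal.ofReal (ε / 4) +
          ENNReal.ofReal (ε / 4) + ENNReal.ofReal (ε / 4)) :=
        add_le_add h5 (add_le_add ((cosetEDist_le_pathEDist _ _).trans h2) h6)
    _ = cosetEDist I L N₀ a b + ENNReal.ofReal ε := by
        have h7 : ENNReal.ofReal ε = ENNReal.ofReal (ε / 4) + ENNReal.ofReal (ε / 4) +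
            ENNReal.ofReal (ε / 4) + ENNReal.ofReal (ε / 4) := by
          rw [← ENNReal.ofReal_add (by positivity) (by positivity),
            ← ENNReal.ofReal_add (by positivity) (by positivity),
            ← ENNReal.ofReal_add (by positivity) (by positivity)]
          congr 1; ring
        rw [h7]; ring

variable [CompactSpace G]

/-- Equicontinuity and compactness make the upper bound for the distances uniform. -/
lemma eventually_forall_cosetEDist_le_add
    (hN : ∀ t, IsHomogeneous (N t)) (hS : ∀ᶠ t in l, ∀ s ∈ S, ∀ X, N t (Ad I s X) = N t X)
    (hN₀ : IsHomogeneous N₀) (hL : ∀ s ∈ L, ∀ X, N₀ (Ad I s X) = N₀ X)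
    {c : ℝ} (hc : 0 < c) (hNc : ∀ᶠ t in l, ∀ X, N t X ≤ c * modelNorm X)
    (hN₀c : ∀ X, N₀ X ≤ c * modelNorm X)
    (hlim : ∀ δ > 0, ∀ᶠ t in l, ∀ X, N t X ≤ (1 + δ) * N₀ X + δ * modelNorm X)
    (hfib : ∀ ε > 0, ∀ᶠ t in l, ∀ h ∈ L,
      cosetEDist I S (N t) (1 : G) (h : G) ≤ ENNReal.ofReal ε) {D : ℝ}
    (hD : ∀ x y : G ⧸ L, cosetEDist I L N₀ x y ≤ ENNReal.ofReal D) {ε : ℝ} (hε : 0 < ε) :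
    ∀ᶠ t in l, ∀ a b : G,
      cosetEDist I S (N t) a b ≤ cosetEDist I L N₀ a b + ENNReal.ofReal ε := by
  have : IsTopologicalGroup G := topologicalGroup_of_lieGroup I ∞
  have hmod : IsHomogeneous (modelNorm : GroupLieAlgebra I G → ℝ) := isHomogeneous_modelNorm
  have hnear := eventually_pathEDist_one_le (I := I) (G := G) hmod (c := 1) (fun X => by simp)
    (ε := ε / (5 * c)) (by positivity)
  -- all functions which are dominated by the norm give distances which are close to each other
  have hsmall : ∀ (N' : GroupLieAlgebra I G → ℝ) (_ : IsHomogeneous N')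
      (_ : ∀ X, N' X ≤ c * modelNorm X) (S' : Subgroup G) (x y : G),
      pathEDist I modelNorm 1 (x⁻¹ * y) ≤ ENNReal.ofReal (ε / (5 * c)) →
      cosetEDist I S' N' x y ≤ ENNReal.ofReal (ε / 5) := by
    intro N' hN' hN'c S' x y hxy
    refine (cosetEDist_le_pathEDist x y).trans ((pathEDist_mono_mul hN' hmod hc hN'c x y).trans ?_)
    rw [← pathEDist_mul_left hmod x⁻¹ x y, inv_mul_cancel]
    refine (mul_le_mul_right hxy _).trans ?_
    rw [← ENNReal.ofReal_mul hc.le]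
    refine ENNReal.ofReal_le_ofReal (le_of_eq ?_)
    field_simp
  -- Near a given pair of points, four triangle inequalities reduce the bound to the one for that
  -- pair; each of them, and the bound itself, costs `ε / 5`.
  have key : ∀ p ∈ (Set.univ : Set (G × G)), ∀ᶠ z : (G × G) × ι in 𝓝 p ×ˢ l,
      cosetEDist I S (N z.2) z.1.1 z.1.2 ≤
        cosetEDist I L N₀ z.1.1 z.1.2 + ENNReal.ofReal ε := by
    rintro ⟨a, b⟩ -
    have hta : ∀ x : G, ∀ᶠ y in 𝓝 x,
        pathEDist I modelNorm 1 (x⁻¹ * y) ≤ ENNReal.ofReal (ε / (5 * c)) := fun x => by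
      have h1 : Tendsto (fun b => x⁻¹ * b) (𝓝 x) (𝓝 1) := by
        have h2 : Continuous fun b : G => x⁻¹ * b := by fun_prop
        simpa using h2.tendsto x
      exact h1.eventually hnear
    have h1 := (continuous_fst.tendsto (a, b)).eventually (hta a)
    have h2 := (continuous_snd.tendsto (a, b)).eventually (hta b)
    have h3 := eventually_cosetEDist_le_add hN hS hN₀ hlim hfib hD a b
      (ε := ε / 5) (by positivity)
    filter_upwards [(h1.and h2).prod_mk (h3.and (hS.and hNc))] with z hz
    obtain ⟨⟨ha, hb⟩, h4, h5, h6⟩ := hz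
    set a' := z.1.1
    set b' := z.1.2
    have e1 := hsmall (N z.2) (hN _) h6 S a a' ha
    have e2 := hsmall (N z.2) (hN _) h6 S b b' hb
    have e3 := hsmall N₀ hN₀ hN₀c L a a' ha
    have e4 := hsmall N₀ hN₀ hN₀c L b b' hb
    rw [cosetEDist_comm (hN _)] at e1
    rw [cosetEDist_comm hN₀] at e4
    calc cosetEDist I S (N z.2) a' b'
        ≤ cosetEDist I S (N z.2) a' a + (cosetEDist I S (N z.2) a b +
            cosetEDist I S (N z.2) b b') :=
          (cosetEDist_triangle (hN _) h5 _ (a : G ⧸ S) _).trans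
            (add_le_add le_rfl (cosetEDist_triangle (hN _) h5 _ _ _))
      _ ≤ ENNReal.ofReal (ε / 5) + ((ENNReal.ofReal (ε / 5) + (cosetEDist I L N₀ a' b' +
            ENNReal.ofReal (ε / 5)) + ENNReal.ofReal (ε / 5)) + ENNReal.ofReal (ε / 5)) := by
          refine add_le_add e1 (add_le_add (h4.trans (add_le_add ?_ le_rfl)) e2)
          exact (cosetEDist_triangle hN₀ hL _ (a' : G ⧸ L) _).trans
            (add_le_add e3 ((cosetEDist_triangle hN₀ hL _ (b' : G ⧸ L) _).trans
              (add_le_add le_rfl e4)))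
      _ = cosetEDist I L N₀ a' b' + ENNReal.ofReal ε := by
          have h7 : ENNReal.ofReal ε = ENNReal.ofReal (ε / 5) + ENNReal.ofReal (ε / 5) +
              ENNReal.ofReal (ε / 5) + ENNReal.ofReal (ε / 5) + ENNReal.ofReal (ε / 5) := by
            rw [← ENNReal.ofReal_add (by positivity) (by positivity),
              ← ENNReal.ofReal_add (by positivity) (by positivity),
              ← ENNReal.ofReal_add (by positivity) (by positivity),
              ← ENNReal.ofReal_add (by positivity) (by positivity)]
            congr 1; ring
          rw [h7]; ring
  -- `G × G` is compact
  have h := isCompact_univ.mem_nhdsSet_prod_of_forall key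
  rw [nhdsSet_univ] at h
  obtain ⟨pa, hpa, pb, hpb, hp⟩ := eventually_prod_iff.1 h
  filter_upwards [hpb] with t ht a b
  exact hp (x := (a, b)) (by simpa using hpa (a, b)) ht

/-- Convergence of the total spaces of `G/S → G/L` to the base if the fibres shrink and the
length functions converge to the one of the base. -/
theorem tendsto_gromovHausdorffEDist (hSL : S ≤ L)
    (hN : ∀ t, IsHomogeneous (N t)) (hS : ∀ᶠ t in l, ∀ s ∈ S, ∀ X, N t (Ad I s X) = N t X)
    (hN₀ : IsHomogeneous N₀) (hL : ∀ s ∈ L, ∀ X, N₀ (Ad I s X) = N₀ X)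
    {c : ℝ} (hc : 0 < c) (hNc : ∀ᶠ t in l, ∀ X, N t X ≤ c * modelNorm X)
    (hN₀c : ∀ X, N₀ X ≤ c * modelNorm X)
    (hlim : ∀ δ > 0, ∀ᶠ t in l, ∀ X, N t X ≤ (1 + δ) * N₀ X + δ * modelNorm X)
    (hlim' : ∀ δ > 0, ∀ᶠ t in l, ∀ X, N₀ X ≤ (1 + δ) * N t X)
    (hfib : ∀ ε > 0, ∀ᶠ t in l, ∀ h ∈ L,
      cosetEDist I S (N t) (1 : G) (h : G) ≤ ENNReal.ofReal ε)
    {D : ℝ} (hD0 : 0 < D) (hD : ∀ x y : G ⧸ L, cosetEDist I L N₀ x y ≤ ENNReal.ofReal D) :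
    Tendsto (fun t => gromovHausdorffEDist (cosetEDist I S (N t)) (cosetEDist I L N₀)) l
      (𝓝 0) := by
  rw [ENNReal.tendsto_nhds_zero]
  intro ε hε
  obtain ⟨η, hη, hηε⟩ : ∃ η : ℝ, 0 < η ∧ ENNReal.ofReal η ≤ ε := by
    rcases eq_or_ne ε ⊤ with rfl | h
    · exact ⟨1, one_pos, le_top⟩
    · exact ⟨ε.toReal, ENNReal.toReal_pos hε.ne' h, (ENNReal.ofReal_toReal h).le⟩
  filter_upwards [eventually_forall_cosetEDist_le_add hN hS hN₀ hL hc hNc hN₀c hlim hfib hD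
    (half_pos hη), hlim' (η / 2 / (D + η / 2)) (by positivity)] with t h1 h2
  refine (sInf_le ?_).trans hηε
  -- each coset of `S` corresponds to the coset of `L` containing it
  refine ⟨Set.range fun a : G => ((a : G ⧸ S), (a : G ⧸ L)), ?_, ?_, ?_⟩
  · intro x
    obtain ⟨a, rfl⟩ := QuotientGroup.mk_surjective x
    exact ⟨a, a, rfl⟩
  · intro x
    obtain ⟨a, rfl⟩ := QuotientGroup.mk_surjective x
    exact ⟨a, a, rfl⟩
  · rintro _ ⟨a, rfl⟩ _ ⟨b, rfl⟩
    have hlt : ENNReal.ofReal (η / 2) < ENNReal.ofReal η :=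
      (ENNReal.ofReal_lt_ofReal_iff hη).2 (half_lt_self hη)
    have hBfin : cosetEDist I L N₀ a b ≠ ⊤ := ne_top_of_le_ne_top ENNReal.ofReal_ne_top (hD a b)
    have hAle : cosetEDist I S (N t) a b ≤ ENNReal.ofReal (D + η / 2) := by
      rw [ENNReal.ofReal_add hD0.le (by positivity)]
      exact (h1 a b).trans (add_le_add (hD a b) le_rfl)
    have hAfin : cosetEDist I S (N t) a b ≠ ⊤ := ne_top_of_le_ne_top ENNReal.ofReal_ne_top hAle
    refine ⟨(h1 a b).trans_lt (ENNReal.add_lt_add_left hBfin hlt), ?_⟩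
    -- The reverse inequality holds up to a factor close to `1`, which is harmless for bounded
    -- distances: `δ (D + η / 2) = η / 2` for the chosen `δ`.
    have h3 := cosetEDist_mono_mul hN₀ (hN t) (by positivity) h2 hSL a b
    rw [ENNReal.ofReal_add zero_le_one (by positivity), ENNReal.ofReal_one, add_mul, one_mul] at h3
    refine h3.trans_lt (ENNReal.add_lt_add_left hAfin (lt_of_le_of_lt ?_ hlt))
    refine (mul_le_mul_right hAle _).trans ?_
    rw [← ENNReal.ofReal_mul (by positivity)]
    refine ENNReal.ofReal_le_ofReal (le_of_eq ?_)
    field_simp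

end GromovHausdorff

/-! ### The ordinary differential equation of the scaling factors -/

section ODE

open Set Filter

/-- Global solvability on a time interval for a bounded, globally Lipschitz vector field. -/
lemma exists_solution_of_lipschitzWith_of_bounded {E : Type*} [NormedAddCommGroup E]
    [NormedSpace ℝ E] [CompleteSpace E] {F : E → E} {k L : NNReal} (hF : LipschitzWith k F)
    (hL : ∀ x, ‖F x‖ ≤ L) (x₀ : E) {S : ℝ} (hS : 0 ≤ S) :
    ∃ z : ℝ → E, z 0 = x₀ ∧ ∀ t ∈ Icc 0 S, HasDerivWithinAt z (F (z t)) (Icc 0 S) t := by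
  have h : IsPicardLindelof (fun _ => F) (tmin := 0) (tmax := S) ⟨0, le_rfl, hS⟩ x₀
      (L * ⟨S, hS⟩) 0 L k :=
    { lipschitzOnWith := fun _ _ => hF.lipschitzOnWith
      continuousOn := fun _ _ => continuousOn_const
      norm_le := fun _ _ x _ => hL x
      mul_max_le := by simp only [sub_zero, sub_self, max_eq_left hS]; exact (sub_zero _).ge }
  exact h.exists_eq_forall_mem_Icc_hasDerivWithinAt₀

variable {f f' : ℝ → ℝ} {T : ℝ}

lemma antitoneOn_Ico_of_hasDerivWithinAt
    (h : ∀ t ∈ Ico 0 T, HasDerivWithinAt f (f' t) (Ico 0 T) t) (h' : ∀ t ∈ Ico 0 T, f' t ≤ 0) :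
    AntitoneOn f (Ico 0 T) := by
  refine antitoneOn_of_hasDerivWithinAt_nonpos (f' := f') (convex_Ico 0 T)
    (fun t ht => (h t ht).continuousWithinAt) (fun t ht => ?_) (fun t ht => ?_)
  · exact (h t (interior_subset ht)).mono interior_subset
  · exact h' t (interior_subset ht)

lemma monotoneOn_Ico_of_hasDerivWithinAt
    (h : ∀ t ∈ Ico 0 T, HasDerivWithinAt f (f' t) (Ico 0 T) t) (h' : ∀ t ∈ Ico 0 T, 0 ≤ f' t) :
    MonotoneOn f (Ico 0 T) := by
  refine monotoneOn_of_hasDerivWithinAt_nonneg (f' := f') (convex_Ico 0 T)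
    (fun t ht => (h t ht).continuousWithinAt) (fun t ht => ?_) (fun t ht => ?_)
  · exact (h t (interior_subset ht)).mono interior_subset
  · exact h' t (interior_subset ht)

/-- The uniqueness theorem for differential equations asks for right derivatives. -/
lemma HasDerivWithinAt.Ici_of_Ico {E : Type*} [NormedAddCommGroup E] [NormedSpace ℝ E]
    {f : ℝ → E} {f' : E} {t : ℝ} (ht : t ∈ Ico 0 T) (h : HasDerivWithinAt f f' (Ico 0 T) t) :
    HasDerivWithinAt f f' (Ici t) t := by
  refine h.mono_of_mem_nhdsWithin (mem_of_superset (Ico_mem_nhdsGE ht.2) ?_)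
  exact Ico_subset_Ico_left ht.1

/-- Barrier principle: a function which decreases strictly wherever it equals `c` never exceeds
`c`. -/
lemma le_const_of_deriv_neg {c : ℝ}
    (h : ∀ t ∈ Ico 0 T, HasDerivWithinAt f (f' t) (Ico 0 T) t) (h0 : f 0 ≤ c)
    (h' : ∀ t ∈ Ico 0 T, f t = c → f' t < 0) : ∀ t ∈ Ico 0 T, f t ≤ c := by
  intro t ht
  have hsub : Icc 0 t ⊆ Ico 0 T := fun s hs => ⟨hs.1, hs.2.trans_lt ht.2⟩
  refine image_le_of_deriv_right_lt_deriv_boundary' (f := f) (f' := f') (a := 0) (b := t)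
    (B := fun _ => c) (B' := fun _ => 0)
    (fun s hs => ((h s (hsub hs)).continuousWithinAt).mono hsub) (fun s hs => ?_) h0
    continuousOn_const (fun s _ => hasDerivWithinAt_const _ _ _) (fun s hs => ?_) ⟨ht.1, le_rfl⟩
  · exact HasDerivWithinAt.Ici_of_Ico (hsub (Ico_subset_Icc_self hs))
      (h s (hsub (Ico_subset_Icc_self hs)))
  · exact h' s (hsub (Ico_subset_Icc_self hs))

/-- Barrier principle: a function which does not increase wherever it exceeds `c` never exceeds
`c`. -/
lemma le_const_of_deriv_nonpos {c : ℝ}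
    (h : ∀ t ∈ Ico 0 T, HasDerivWithinAt f (f' t) (Ico 0 T) t) (h0 : f 0 ≤ c)
    (h' : ∀ t ∈ Ico 0 T, c < f t → f' t ≤ 0) : ∀ t ∈ Ico 0 T, f t ≤ c := by
  intro t ht
  -- the strict version applies to `f s - ε s` with the barrier `c + ε`
  have key : ∀ ε > 0, f t - ε * t ≤ c + ε := fun ε hε => by
    refine le_const_of_deriv_neg (f := fun s => f s - ε * s) (f' := fun s => f' s - ε * 1)
      (fun s hs => (h s hs).sub ((hasDerivWithinAt_id s _).const_mul ε)) (by simp; linarith)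
      (fun s hs hse => ?_) t ht
    have : f' s ≤ 0 := h' s hs (by nlinarith [hs.1])
    linarith
  refine le_of_forall_pos_le_add fun ε hε => ?_
  have := key (ε / (t + 1)) (div_pos hε (by linarith [ht.1]))
  have h2 : ε / (t + 1) * t + ε / (t + 1) = ε := by
    have : t + 1 ≠ 0 := by linarith [ht.1]
    field_simp
  linarith

/-- The ratio of the coordinates, made bounded and globally Lipschitz by cutting off the
numerator at `0` and `R` and the denominator at `δ`. -/
def cutRatio (R δ : ℝ) (p : ℝ × ℝ) : ℝ := max (min p.1 R) 0 / max p.2 δ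

/-- The vector field of the flow of the two scaling factors, cut off near the coordinate axes. -/
def cutField (C a b β R δ : ℝ) (p : ℝ × ℝ) : ℝ × ℝ :=
  (-C - a * cutRatio R δ p ^ 2, -β + b * cutRatio R δ p)

lemma cutRatio_nonneg {R δ : ℝ} (hδ : 0 < δ) (p : ℝ × ℝ) : 0 ≤ cutRatio R δ p :=
  div_nonneg (le_max_right _ _) (hδ.le.trans (le_max_right _ _))

lemma cutRatio_le {R δ : ℝ} (hR : 0 ≤ R) (hδ : 0 < δ) (p : ℝ × ℝ) : cutRatio R δ p ≤ R / δ :=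
  div_le_div₀ hR (max_le (min_le_right _ _) hR) hδ (le_max_right _ _)

lemma abs_cutRatio_sub_le {R δ : ℝ} (hR : 0 ≤ R) (hδ : 0 < δ) (p q : ℝ × ℝ) :
    |cutRatio R δ p - cutRatio R δ q| ≤ (1 / δ + R / δ ^ 2) * dist p q := by
  set P := max (min p.1 R) 0
  set P' := max (min q.1 R) 0 with hP'
  set m := max p.2 δ
  set m' := max q.2 δ
  have hm : δ ≤ m := le_max_right _ _
  have hm' : δ ≤ m' := le_max_right _ _
  have h1 : |P - P'| ≤ dist p q := by
    refine (abs_max_sub_max_le_abs _ _ _).trans ((abs_min_sub_min_le_max _ _ _ _).trans ?_)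
    rw [sub_self, abs_zero, max_eq_left (abs_nonneg _)]
    exact le_max_left _ _
  have h2 : |m' - m| ≤ dist p q := by
    refine (abs_max_sub_max_le_abs _ _ _).trans ?_
    rw [abs_sub_comm]
    exact le_max_right _ _
  have hP0 : |P'| ≤ R := by
    rw [abs_of_nonneg (le_max_right _ _)]
    exact max_le (min_le_right _ _) hR
  have e : cutRatio R δ p - cutRatio R δ q = (P - P') / m + P' * (m' - m) / (m * m') := by
    have := hδ.trans_le hm
    have := hδ.trans_le hm'
    change P / m - P' / m' = _
    field_simp
    ring
  rw [e, add_mul]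
  refine (abs_add_le _ _).trans (add_le_add ?_ ?_)
  · rw [abs_div, abs_of_pos (hδ.trans_le hm), one_div, inv_mul_eq_div]
    exact div_le_div₀ dist_nonneg h1 hδ hm
  · rw [abs_div, abs_mul, abs_of_pos (mul_pos (hδ.trans_le hm) (hδ.trans_le hm')),
      div_mul_eq_mul_div]
    refine div_le_div₀ (by positivity) (mul_le_mul hP0 h2 (abs_nonneg _) hR) (by positivity) ?_
    nlinarith

lemma exists_lipschitzWith_cutField (C a b β : ℝ) {R δ : ℝ} (hR : 0 ≤ R) (hδ : 0 < δ) :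
    ∃ k, LipschitzWith k (cutField C a b β R δ) := by
  set k₀ := 1 / δ + R / δ ^ 2
  have hk₀ : 0 ≤ k₀ := by positivity
  refine ⟨⟨|a| * (2 * (R / δ) * k₀) + |b| * k₀, by positivity⟩, LipschitzWith.of_dist_le_mul
    fun p q => ?_⟩
  have h := abs_cutRatio_sub_le hR hδ p q
  have h1 := cutRatio_le hR hδ p
  have h2 := cutRatio_le hR hδ q
  have h3 := cutRatio_nonneg (R := R) hδ p
  have h4 := cutRatio_nonneg (R := R) hδ q
  have e1 : |a * cutRatio R δ q ^ 2 - a * cutRatio R δ p ^ 2| ≤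
      |a| * (2 * (R / δ) * k₀) * dist p q := by
    rw [← mul_sub, abs_mul, mul_assoc]
    refine mul_le_mul_of_nonneg_left ?_ (abs_nonneg a)
    rw [sq_sub_sq, abs_mul, abs_sub_comm, mul_assoc]
    refine mul_le_mul ?_ h (abs_nonneg _) (by positivity)
    rw [abs_of_nonneg (by positivity)]
    linarith
  have e2 : |b * cutRatio R δ p - b * cutRatio R δ q| ≤ |b| * k₀ * dist p q := by
    rw [← mul_sub, abs_mul, mul_assoc]
    exact mul_le_mul_of_nonneg_left h (abs_nonneg b)
  have hd : 0 ≤ dist p q := dist_nonneg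
  refine max_le ?_ ?_
  · rw [Real.dist_eq]
    have : (cutField C a b β R δ p).1 - (cutField C a b β R δ q).1 =
      a * cutRatio R δ q ^ 2 - a * cutRatio R δ p ^ 2 := by simp [cutField]
    rw [this]
    refine e1.trans (mul_le_mul_of_nonneg_right ?_ hd)
    exact le_add_of_nonneg_right (by positivity)
  · rw [Real.dist_eq]
    have : (cutField C a b β R δ p).2 - (cutField C a b β R δ q).2 =
      b * cutRatio R δ p - b * cutRatio R δ q := by simp [cutField]
    rw [this]
    refine e2.trans (mul_le_mul_of_nonneg_right ?_ hd)
    exact le_add_of_nonneg_left (by positivity)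

lemma exists_bound_cutField (C a b β : ℝ) {R δ : ℝ} (hR : 0 ≤ R) (hδ : 0 < δ) :
    ∃ L : NNReal, ∀ p, ‖cutField C a b β R δ p‖ ≤ L := by
  refine ⟨⟨|C| + |a| * (R / δ) ^ 2 + (|β| + |b| * (R / δ)), by positivity⟩, fun p => ?_⟩
  have h1 := cutRatio_le hR hδ p
  have h3 := cutRatio_nonneg (R := R) hδ p
  refine max_le ?_ ?_
  · refine (abs_sub _ _).trans (le_trans (add_le_add (abs_neg C).le ?_)
      (le_add_of_nonneg_right (by positivity)))
    rw [abs_mul, abs_of_nonneg (sq_nonneg (cutRatio R δ p))]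
    gcongr
  · refine (abs_add_le _ _).trans (le_trans (add_le_add (abs_neg β).le ?_)
      (le_add_of_nonneg_left (by positivity)))
    rw [abs_mul, abs_of_nonneg h3]
    gcongr

/-- The pair `(x₁, x₂)` of positive functions on `[0, T)` solves
`x₁' = - C - a (x₁ / x₂)²`, `x₂' = - β + b x₁ / x₂` with initial value `(y₁, y₂)`. For invariant
metrics with two isotropy summands, the Ricci flow of the two scaling factors has this form. -/
structure IsScalingFlow (C a b β y₁ y₂ T : ℝ) (x₁ x₂ : ℝ → ℝ) : Prop where
  init₁ : x₁ 0 = y₁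
  init₂ : x₂ 0 = y₂
  pos₁ : ∀ t ∈ Ico 0 T, 0 < x₁ t
  pos₂ : ∀ t ∈ Ico 0 T, 0 < x₂ t
  deriv₁ : ∀ t ∈ Ico 0 T, HasDerivWithinAt x₁ (-C - a * (x₁ t / x₂ t) ^ 2) (Ico 0 T) t
  deriv₂ : ∀ t ∈ Ico 0 T, HasDerivWithinAt x₂ (-β + b * (x₁ t / x₂ t)) (Ico 0 T) t

namespace IsScalingFlow

variable {C a b β y₁ y₂ T T' : ℝ} {x₁ x₂ x₁' x₂' : ℝ → ℝ}

lemma mono (h : IsScalingFlow C a b β y₁ y₂ T x₁ x₂) (hT : T' ≤ T) :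
    IsScalingFlow C a b β y₁ y₂ T' x₁ x₂ :=
  have hs := Ico_subset_Ico_right hT
  ⟨h.init₁, h.init₂, fun t ht => h.pos₁ t (hs ht), fun t ht => h.pos₂ t (hs ht),
    fun t ht => (h.deriv₁ t (hs ht)).mono hs, fun t ht => (h.deriv₂ t (hs ht)).mono hs⟩

/-- The first factor decreases at least at the rate `C`. -/
lemma antitoneOn_add (h : IsScalingFlow C a b β y₁ y₂ T x₁ x₂) (ha : 0 ≤ a) :
    AntitoneOn (fun t => x₁ t + C * t) (Ico 0 T) :=
  antitoneOn_Ico_of_hasDerivWithinAt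
    (fun t ht => (h.deriv₁ t ht).add ((hasDerivWithinAt_id t _).const_mul C)) fun t _ => by
      have : 0 ≤ a * (x₁ t / x₂ t) ^ 2 := by positivity
      linarith

lemma le_init (h : IsScalingFlow C a b β y₁ y₂ T x₁ x₂) (ha : 0 ≤ a) {t : ℝ} (ht : t ∈ Ico 0 T) :
    x₁ t + C * t ≤ y₁ := by
  simpa [h.init₁] using h.antitoneOn_add ha ⟨le_rfl, ht.1.trans_lt ht.2⟩ ht ht.1

/-- As the first factor decreases at least at the rate `C` and is positive until `T`, it is at least
`C (T - t)`. This bounds `T`, and gives the rate of the singularity. -/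
lemma mul_sub_le (h : IsScalingFlow C a b β y₁ y₂ T x₁ x₂) (ha : 0 ≤ a) {t : ℝ}
    (ht : t ∈ Ico 0 T) : C * (T - t) ≤ x₁ t := by
  have hlim : Tendsto (fun s => C * (s - t)) (𝓝[<] T) (𝓝 (C * (T - t))) :=
    ((continuous_const.mul (continuous_id.sub continuous_const)).tendsto T).mono_left
      nhdsWithin_le_nhds
  refine le_of_tendsto hlim ?_
  filter_upwards [Ico_mem_nhdsLT ht.2] with s hs
  have h1 := h.antitoneOn_add ha ht ⟨ht.1.trans hs.1, hs.2⟩ hs.1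
  have h2 := h.pos₁ s ⟨ht.1.trans hs.1, hs.2⟩
  simp only at h1
  linarith

/-- Away from the axis, the solution is an integral curve of the cut-off vector field. -/
lemma hasDerivWithinAt_cutField (h : IsScalingFlow C a b β y₁ y₂ T x₁ x₂) (ha : 0 ≤ a)
    (hC : 0 ≤ C) {δ t : ℝ} (ht : t ∈ Ico 0 T) (hδ : δ ≤ x₂ t) :
    HasDerivWithinAt (fun s => (x₁ s, x₂ s)) (cutField C a b β (y₁ + 1) δ (x₁ t, x₂ t))
      (Ico 0 T) t := by
  have h1 := h.le_init ha ht
  have h2 := mul_nonneg hC ht.1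
  have e : cutRatio (y₁ + 1) δ (x₁ t, x₂ t) = x₁ t / x₂ t := by
    simp only [cutRatio]
    rw [max_eq_left hδ, min_eq_left (by linarith), max_eq_left (h.pos₁ t ht).le]
  have := (h.deriv₁ t ht).prodMk (h.deriv₂ t ht)
  simpa only [cutField, e] using this

/-- On compact intervals the second factor is bounded away from zero, so that the cut-off of the
vector field is harmless there. -/
lemma exists_lower_bound (h : IsScalingFlow C a b β y₁ y₂ T x₁ x₂) {s : ℝ} (hs : s < T) :
    ∃ δ > 0, ∀ t ∈ Icc 0 s, δ ≤ x₂ t := by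
  have hsub : Icc 0 s ⊆ Ico 0 T := fun t ht => ⟨ht.1, ht.2.trans_lt hs⟩
  rcases (Icc 0 s).eq_empty_or_nonempty with he | hne
  · exact ⟨1, one_pos, fun t ht => by simp [he] at ht⟩
  · obtain ⟨t₀, ht₀, hmin⟩ := isCompact_Icc.exists_isMinOn hne
      (f := x₂) fun t ht => ((h.deriv₂ t (hsub ht)).continuousWithinAt).mono hsub
    exact ⟨x₂ t₀, h.pos₂ t₀ (hsub ht₀), fun t ht => hmin ht⟩

/-- On `[0, t]`, two solutions are integral curves of the same globally Lipschitz field. -/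
lemma unique (h : IsScalingFlow C a b β y₁ y₂ T x₁ x₂)
    (h' : IsScalingFlow C a b β y₁ y₂ T x₁' x₂') (ha : 0 ≤ a) (hC : 0 ≤ C) (hy : 0 ≤ y₁) {t : ℝ}
    (ht : t ∈ Ico 0 T) : x₁ t = x₁' t ∧ x₂ t = x₂' t := by
  obtain ⟨δ, hδ, hδ1⟩ := h.exists_lower_bound ht.2
  obtain ⟨δ', hδ', hδ1'⟩ := h'.exists_lower_bound ht.2
  set η := min δ δ'
  obtain ⟨k, hk⟩ := exists_lipschitzWith_cutField C a b β (R := y₁ + 1) (by linarith)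
    (lt_min hδ hδ')
  have hsub : Icc 0 t ⊆ Ico 0 T := fun s hs => ⟨hs.1, hs.2.trans_lt ht.2⟩
  have d1 : ∀ s ∈ Icc 0 t, _ := fun s hs => h.hasDerivWithinAt_cutField ha hC (hsub hs)
    (δ := η) ((min_le_left _ _).trans (hδ1 s hs))
  have d2 : ∀ s ∈ Icc 0 t, _ := fun s hs => h'.hasDerivWithinAt_cutField ha hC (hsub hs)
    (δ := η) ((min_le_right _ _).trans (hδ1' s hs))
  have := ODE_solution_unique (v := fun _ => cutField C a b β (y₁ + 1) η) (fun _ => hk)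
    (fun s hs => ((d1 s hs).continuousWithinAt).mono hsub)
    (fun s hs => HasDerivWithinAt.Ici_of_Ico (hsub (Ico_subset_Icc_self hs))
      (d1 s (Ico_subset_Icc_self hs)))
    (fun s hs => ((d2 s hs).continuousWithinAt).mono hsub)
    (fun s hs => HasDerivWithinAt.Ici_of_Ico (hsub (Ico_subset_Icc_self hs))
      (d2 s (Ico_subset_Icc_self hs))) (by simp [h.init₁, h'.init₁, h.init₂, h'.init₂])
    (right_mem_Icc.2 ht.1)
  simpa using this

end IsScalingFlow

variable {C a b β y₁ y₂ : ℝ}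

/-- An integral curve of the cut-off vector field solves the original equation as long as it stays
in the region without cut-off, and a little longer. -/
lemma exists_isScalingFlow_of_cutField {R δ S s : ℝ} {z : ℝ → ℝ × ℝ} (hδ : 0 < δ)
    (hz0 : z 0 = (y₁, y₂))
    (hz : ∀ t ∈ Icc 0 S, HasDerivWithinAt z (cutField C a b β R δ (z t)) (Icc 0 S) t)
    (hs : 0 ≤ s) (hsS : s < S) (hin : ∀ t ∈ Icc 0 s, δ < (z t).1 ∧ (z t).1 < R ∧ δ < (z t).2) :
    ∃ T > s, IsScalingFlow C a b β y₁ y₂ T (fun t => (z t).1) (fun t => (z t).2) := by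
  have hopen : IsOpen {p : ℝ × ℝ | δ < p.1 ∧ p.1 < R ∧ δ < p.2} :=
    (isOpen_lt continuous_const continuous_fst).inter
      ((isOpen_lt continuous_fst continuous_const).inter
        (isOpen_lt continuous_const continuous_snd))
  have hev := (hz s ⟨hs, hsS.le⟩).continuousWithinAt.eventually
    (hopen.mem_nhds (hin s ⟨hs, le_rfl⟩))
  have hev' : ∀ᶠ t in 𝓝[≥] s, δ < (z t).1 ∧ (z t).1 < R ∧ δ < (z t).2 := by
    have : Icc 0 S ∈ 𝓝[≥] s := mem_of_superset (Icc_mem_nhdsGE hsS) (Icc_subset_Icc_left hs)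
    exact hev.filter_mono (nhdsWithin_le_iff.2 this)
  obtain ⟨u, hu, hu'⟩ := (mem_nhdsGE_iff_exists_Ico_subset).1 hev'
  have hu : s < u := hu
  set T := min u S
  have hT : s < T := lt_min hu hsS
  have hin' : ∀ t ∈ Ico 0 T, δ < (z t).1 ∧ (z t).1 < R ∧ δ < (z t).2 := by
    intro t ht
    rcases le_or_gt t s with h | h
    · exact hin t ⟨ht.1, h⟩
    · exact hu' ⟨h.le, ht.2.trans_le (min_le_left _ _)⟩
  have hsub : Ico 0 T ⊆ Icc 0 S := fun t ht => ⟨ht.1, ht.2.le.trans (min_le_right _ _)⟩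
  have hcut : ∀ t ∈ Ico 0 T, cutRatio R δ (z t) = (z t).1 / (z t).2 := fun t ht => by
    obtain ⟨h1, h2, h3⟩ := hin' t ht
    simp only [cutRatio]
    rw [max_eq_left h3.le, min_eq_left h2.le, max_eq_left (hδ.trans h1).le]
  refine ⟨T, hT, by simp [hz0], by simp [hz0], fun t ht => hδ.trans (hin' t ht).1,
    fun t ht => hδ.trans (hin' t ht).2.2, fun t ht => ?_, fun t ht => ?_⟩
  · have := (ContinuousLinearMap.fst ℝ ℝ ℝ).hasFDerivAt.comp_hasDerivWithinAt t
      ((hz t (hsub ht)).mono hsub)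
    simpa [cutField, hcut t ht, Function.comp_def] using this
  · have := (ContinuousLinearMap.snd ℝ ℝ ℝ).hasFDerivAt.comp_hasDerivWithinAt t
      ((hz t (hsub ht)).mono hsub)
    simpa [cutField, hcut t ht, Function.comp_def] using this

/-- Short-time existence. -/
lemma exists_isScalingFlow (C a b β : ℝ) (hy₁ : 0 < y₁) (hy₂ : 0 < y₂) :
    ∃ T > 0, ∃ x₁ x₂, IsScalingFlow C a b β y₁ y₂ T x₁ x₂ := by
  have hδ : 0 < min y₁ y₂ / 2 := half_pos (lt_min hy₁ hy₂)
  obtain ⟨k, hk⟩ := exists_lipschitzWith_cutField C a b β (R := y₁ + 1) (by linarith) hδ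
  obtain ⟨L, hL⟩ := exists_bound_cutField C a b β (R := y₁ + 1) (by linarith) hδ
  obtain ⟨z, hz0, hz⟩ := exists_solution_of_lipschitzWith_of_bounded hk hL (y₁, y₂) zero_le_one
  obtain ⟨T, hT, h⟩ := exists_isScalingFlow_of_cutField hδ hz0 hz le_rfl one_pos fun t ht => by
    obtain rfl : t = 0 := le_antisymm ht.2 ht.1
    rw [hz0]
    have h1 := min_le_left y₁ y₂
    have h2 := min_le_right y₁ y₂
    exact ⟨by simp only; linarith, by simp, by simp only; linarith⟩
  exact ⟨T, hT, _, _, h⟩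

/-- A solution which stays away from the axes can be continued. -/
lemma IsScalingFlow.exists_extension {T δ : ℝ} {x₁ x₂ : ℝ → ℝ}
    (h : IsScalingFlow C a b β y₁ y₂ T x₁ x₂) (ha : 0 ≤ a) (hC : 0 < C) (hT : 0 < T)
    (hδ : 0 < δ) (h₁ : ∀ t ∈ Ico 0 T, δ ≤ x₁ t) (h₂ : ∀ t ∈ Ico 0 T, δ ≤ x₂ t) :
    ∃ T' > T, ∃ x₁ x₂, IsScalingFlow C a b β y₁ y₂ T' x₁ x₂ := by
  have hy₁ : 0 < y₁ := h.init₁ ▸ h.pos₁ 0 ⟨le_rfl, hT⟩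
  have hδ' : 0 < δ / 2 := half_pos hδ
  obtain ⟨k, hk⟩ := exists_lipschitzWith_cutField C a b β (R := y₁ + 1) (by linarith) hδ'
  obtain ⟨L, hL⟩ := exists_bound_cutField C a b β (R := y₁ + 1) (by linarith) hδ'
  obtain ⟨z, hz0, hz⟩ := exists_solution_of_lipschitzWith_of_bounded hk hL (y₁, y₂)
    (S := T + 1) (by linarith)
  -- The integral curve `z` of the cut-off field agrees with the solution up to `T`.
  have heq : ∀ t ∈ Ico 0 T, z t = (x₁ t, x₂ t) := by
    intro t ht
    have hsub : Icc 0 t ⊆ Ico 0 T := fun s hs => ⟨hs.1, hs.2.trans_lt ht.2⟩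
    have hsub' : Icc 0 t ⊆ Ico 0 (T + 1) := fun s hs => ⟨hs.1, by linarith [hs.2, ht.2]⟩
    have d : ∀ s ∈ Icc 0 t, _ := fun s hs => h.hasDerivWithinAt_cutField ha hC.le (hsub hs)
      (δ := δ / 2) (by linarith [h₂ s (hsub hs)])
    refine ODE_solution_unique (v := fun _ => cutField C a b β (y₁ + 1) (δ / 2)) (fun _ => hk)
      (fun s hs => ((hz s (Ico_subset_Icc_self (hsub' hs))).continuousWithinAt).mono
        (hsub'.trans Ico_subset_Icc_self))
      (fun s hs => HasDerivWithinAt.Ici_of_Ico (hsub' (Ico_subset_Icc_self hs))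
        ((hz s (Ico_subset_Icc_self (hsub' (Ico_subset_Icc_self hs)))).mono Ico_subset_Icc_self))
      (fun s hs => ((d s hs).continuousWithinAt).mono hsub)
      (fun s hs => HasDerivWithinAt.Ici_of_Ico (hsub (Ico_subset_Icc_self hs))
        (d s (Ico_subset_Icc_self hs))) (by simp [h.init₁, h.init₂, hz0])
      (right_mem_Icc.2 ht.1)
  have hbd : ∀ t ∈ Ico 0 T, δ ≤ (z t).1 ∧ (z t).1 ≤ y₁ ∧ δ ≤ (z t).2 := fun t ht => by
    rw [heq t ht]
    exact ⟨h₁ t ht, by linarith [h.le_init ha ht, mul_nonneg hC.le ht.1], h₂ t ht⟩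
  have hcl : IsClosed {p : ℝ × ℝ | δ ≤ p.1 ∧ p.1 ≤ y₁ ∧ δ ≤ p.2} :=
    (isClosed_le continuous_const continuous_fst).inter
      ((isClosed_le continuous_fst continuous_const).inter
        (isClosed_le continuous_const continuous_snd))
  -- By continuity it is still outside of the cut-off region at `T`, and hence a little later.
  have hTmem : z T ∈ {p : ℝ × ℝ | δ ≤ p.1 ∧ p.1 ≤ y₁ ∧ δ ≤ p.2} := by
    have hc : Tendsto z (𝓝[<] T) (𝓝 (z T)) :=
      ((hz T ⟨hT.le, by linarith⟩).continuousWithinAt).tendsto.mono_left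
        (nhdsWithin_le_iff.2 (mem_of_superset (Ico_mem_nhdsLT hT)
          fun t ht => ⟨ht.1, by linarith [ht.2]⟩))
    refine hcl.mem_of_tendsto hc ?_
    filter_upwards [Ico_mem_nhdsLT hT] with t ht using hbd t ht
  obtain ⟨T', hT', h'⟩ := exists_isScalingFlow_of_cutField (s := T) hδ' hz0 hz hT.le (by linarith)
    fun t ht => by
      have hmem : z t ∈ {p : ℝ × ℝ | δ ≤ p.1 ∧ p.1 ≤ y₁ ∧ δ ≤ p.2} := by
        rcases ht.2.lt_or_eq with h | rfl
        · exact hbd t ⟨ht.1, h⟩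
        · exact hTmem
      obtain ⟨e1, e2, e3⟩ := hmem
      exact ⟨by linarith, by linarith, by linarith⟩
  exact ⟨T', hT', _, _, h'⟩

end ODE

/-! ### Maximal solutions and their limits -/

section MaximalFlow

open Set Filter

variable {C a b β y₁ y₂ : ℝ}

/-- Existence of a maximal solution, by gluing all solutions. -/
lemma exists_maximal_isScalingFlow (ha : 0 ≤ a) (hC : 0 < C) (β b : ℝ) (hy₁ : 0 < y₁)
    (hy₂ : 0 < y₂) :
    ∃ T > 0, ∃ x₁ x₂, IsScalingFlow C a b β y₁ y₂ T x₁ x₂ ∧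
      ∀ T' x₁' x₂', IsScalingFlow C a b β y₁ y₂ T' x₁' x₂' → T' ≤ T := by
  set 𝒯 : Set ℝ := {T | ∃ x₁ x₂, IsScalingFlow C a b β y₁ y₂ T x₁ x₂}
  obtain ⟨T₀, hT₀, hT₀'⟩ := exists_isScalingFlow (y₁ := y₁) (y₂ := y₂) C a b β hy₁ hy₂
  -- the first factor vanishes at the time `y₁ / C` at the latest
  have hbdd : BddAbove 𝒯 := by
    refine ⟨y₁ / C, ?_⟩
    rintro T ⟨x₁, x₂, h⟩
    rcases le_or_gt T 0 with h0 | h0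
    · exact h0.trans (by positivity)
    · rw [le_div_iff₀ hC]
      have := h.mul_sub_le ha (left_mem_Ico.2 h0)
      rw [h.init₁] at this
      linarith
  set T := sSup 𝒯
  have hT : 0 < T := hT₀.trans_le (le_csSup hbdd hT₀')
  -- for each `t < T`, a solution `p t` on an interval `[0, τ t)` containing `t`; the glued solution
  -- has the value `p t t` at `t`, and agrees with `p t` on `[0, τ t)` by uniqueness
  have hch : ∀ t, ∃ (τ : ℝ) (p : (ℝ → ℝ) × (ℝ → ℝ)), t < T →
      t < τ ∧ IsScalingFlow C a b β y₁ y₂ τ p.1 p.2 := by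
    intro t
    by_cases ht : t < T
    · obtain ⟨τ, ⟨x₁, x₂, h⟩, hτ⟩ := exists_lt_of_lt_csSup ⟨T₀, hT₀'⟩ ht
      exact ⟨τ, (x₁, x₂), fun _ => ⟨hτ, h⟩⟩
    · exact ⟨0, (0, 0), fun h => absurd h ht⟩
  choose τ p hp using hch
  have hpt : ∀ t ∈ Ico 0 T, ∀ s ∈ Ico 0 (τ t), s < T → (p s).1 s = (p t).1 s ∧
      (p s).2 s = (p t).2 s := by
    intro t ht s hs hsT
    have h1 := (hp s hsT).2.mono (min_le_left _ (τ t))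
    have h2 := (hp t ht.2).2.mono (min_le_right (τ s) _)
    exact h1.unique h2 ha hC.le hy₁.le ⟨hs.1, lt_min (hp s hsT).1 hs.2⟩
  have hnhd : ∀ t ∈ Ico 0 T, ∀ᶠ s in 𝓝[Ico 0 T] t, s ∈ Ico 0 (τ t) ∩ Ico 0 T := by
    intro t ht
    have h1 : ∀ᶠ s in 𝓝[Ico 0 T] t, s < τ t :=
      nhdsWithin_le_nhds (Iio_mem_nhds (hp t ht.2).1)
    filter_upwards [h1, self_mem_nhdsWithin] with s hs hs'
    exact ⟨⟨hs'.1, hs⟩, hs'⟩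
  refine ⟨T, hT, fun t => (p t).1 t, fun t => (p t).2 t, ⟨(hp 0 hT).2.init₁, (hp 0 hT).2.init₂,
    fun t ht => (hp t ht.2).2.pos₁ t ⟨ht.1, (hp t ht.2).1⟩,
    fun t ht => (hp t ht.2).2.pos₂ t ⟨ht.1, (hp t ht.2).1⟩, fun t ht => ?_, fun t ht => ?_⟩,
    fun T' x₁' x₂' h' => le_csSup hbdd ⟨x₁', x₂', h'⟩⟩
  · have h1 := (hp t ht.2).2.deriv₁ t ⟨ht.1, (hp t ht.2).1⟩
    refine (h1.mono_of_mem_nhdsWithin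
      (mem_of_superset (hnhd t ht) inter_subset_left)).congr_of_eventuallyEq ?_ rfl
    filter_upwards [hnhd t ht] with s hs using (hpt t ht s hs.1 hs.2.2).1
  · have h1 := (hp t ht.2).2.deriv₂ t ⟨ht.1, (hp t ht.2).1⟩
    refine (h1.mono_of_mem_nhdsWithin
      (mem_of_superset (hnhd t ht) inter_subset_left)).congr_of_eventuallyEq ?_ rfl
    filter_upwards [hnhd t ht] with s hs using (hpt t ht s hs.1 hs.2.2).2

lemma tendsto_of_antitoneOn_Ico {f : ℝ → ℝ} {T m : ℝ} (hT : 0 < T) (hf : AntitoneOn f (Ico 0 T))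
    (hm : ∀ t ∈ Ico 0 T, m ≤ f t) : ∃ ℓ, Tendsto f (𝓝[<] T) (𝓝 ℓ) := by
  have h1 : MonotoneOn (fun t => - f t) (Ioo 0 T) := fun s hs t ht hst =>
    neg_le_neg (hf (Ioo_subset_Ico_self hs) (Ioo_subset_Ico_self ht) hst)
  have h2 := h1.tendsto_nhdsWithin_Ioo_left (nonempty_Ioo.2 hT) ⟨-m, by
    rintro _ ⟨t, ht, rfl⟩
    exact neg_le_neg (hm t (Ioo_subset_Ico_self ht))⟩
  exact ⟨_, by simpa using h2.neg⟩

namespace IsScalingFlow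

variable {T : ℝ} {x₁ x₂ : ℝ → ℝ}

/-- The derivative of the ratio `u = x₁ / x₂` is `-q(u) / x₂` with `q(u) = (a + b) u² - β u + C`. -/
lemma hasDerivWithinAt_ratio (h : IsScalingFlow C a b β y₁ y₂ T x₁ x₂) {t : ℝ}
    (ht : t ∈ Ico 0 T) :
    HasDerivWithinAt (fun t => x₁ t / x₂ t)
      (-((a + b) * (x₁ t / x₂ t) ^ 2 - β * (x₁ t / x₂ t) + C) / x₂ t) (Ico 0 T) t := by
  have h2 := (h.pos₂ t ht).ne'
  refine ((h.deriv₁ t ht).div (h.deriv₂ t ht) h2).congr_deriv ?_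
  field_simp
  ring

/-- The ratio stays bounded, because it decreases where it exceeds `β / (a + b)`. -/
lemma exists_ratio_bound (h : IsScalingFlow C a b β y₁ y₂ T x₁ x₂) (hab : 0 < a + b)
    (hC : 0 < C) : ∃ U > 0, ∀ t ∈ Ico 0 T, x₁ t / x₂ t ≤ U := by
  refine ⟨max (max (y₁ / y₂) (β / (a + b))) 1, by positivity,
    le_const_of_deriv_nonpos (fun t ht => h.hasDerivWithinAt_ratio ht) ?_ fun t ht hlt => ?_⟩
  · rw [h.init₁, h.init₂]
    exact (le_max_left _ _).trans (le_max_left _ _)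
  · have h1 := ((le_max_right _ _).trans (le_max_left _ _)).trans_lt hlt
    have h2 := (le_max_right _ _).trans_lt hlt
    rw [div_lt_iff₀ hab] at h1
    refine div_nonpos_of_nonpos_of_nonneg ?_ (h.pos₂ t ht).le
    nlinarith

/-- The ray spanned by a zero `u` of `q(u) = (a + b) u² - β u + C` is invariant, and acts as a
barrier. -/
lemma le_ratio_of_root (h : IsScalingFlow C a b β y₁ y₂ T x₁ x₂) (hT : 0 < T) (ha : 0 ≤ a)
    (hb : 0 ≤ b) {u : ℝ} (hu : 0 < u) (hroot : (a + b) * u ^ 2 - β * u + C = 0)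
    (hu0 : u ≤ y₁ / y₂) {t : ℝ} (ht : t ∈ Ico 0 T) : u * x₂ t ≤ x₁ t := by
  have hy₂ : 0 < y₂ := h.init₂ ▸ h.pos₂ 0 ⟨le_rfl, hT⟩
  have := le_const_of_deriv_nonpos (f := fun t => u * x₂ t - x₁ t) (c := 0)
    (fun t ht => ((h.deriv₂ t ht).const_mul u).sub (h.deriv₁ t ht)) (by
      simp only [h.init₁, h.init₂]
      rw [le_div_iff₀ hy₂] at hu0
      linarith) (fun t ht hlt => ?_) t ht
  · linarith
  · have h2 := h.pos₂ t ht
    set v := x₁ t / x₂ t with hv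
    have hv0 : 0 ≤ v := (div_pos (h.pos₁ t ht) h2).le
    have hvu : v ≤ u := by
      rw [hv, div_le_iff₀ h2]
      linarith
    have e : u * (-β + b * v) - (-C - a * v ^ 2) = (v - u) * (a * v + (a + b) * u) := by
      linear_combination hroot
    rw [e]
    exact mul_nonpos_of_nonpos_of_nonneg (by linarith) (by positivity)

/-- Without zero of `q(u) = (a + b) u² - β u + C` below the initial ratio, the ratio decreases
fast enough to control `log x₂`. -/
lemma exists_lower_bound_of_no_root (h : IsScalingFlow C a b β y₁ y₂ T x₁ x₂) (hT : 0 < T)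
    (hC : 0 < C) (hq : ∀ u, 0 < u → u ≤ y₁ / y₂ → (a + b) * u ^ 2 - β * u + C ≠ 0) :
    ∃ c > 0, ∀ t ∈ Ico 0 T, c ≤ x₂ t := by
  have hy₁ : 0 < y₁ := h.init₁ ▸ h.pos₁ 0 ⟨le_rfl, hT⟩
  have hy₂ : 0 < y₂ := h.init₂ ▸ h.pos₂ 0 ⟨le_rfl, hT⟩
  have hu₀ : 0 < y₁ / y₂ := div_pos hy₁ hy₂
  set u₀ := y₁ / y₂
  set q : ℝ → ℝ := fun u => (a + b) * u ^ 2 - β * u + C with hqdef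
  have hqc : Continuous q := by fun_prop
  -- `q 0 = C > 0`, and `q` has no zero on `(0, u₀]`
  have hqpos : ∀ u ∈ Icc 0 u₀, 0 < q u := by
    intro u hu
    by_contra! hneg
    obtain ⟨v, hv, hv0⟩ := intermediate_value_Icc' hu.1 hqc.continuousOn
      (show (0 : ℝ) ∈ Icc (q u) (q 0) from ⟨hneg, by simp [q, hC.le]⟩)
    rcases hv.1.eq_or_lt with h0 | h0
    · rw [← h0] at hv0
      simp [q, hC.ne'] at hv0
    · exact hq v h0 (hv.2.trans hu.2) hv0
  obtain ⟨v, hv, hmin⟩ := isCompact_Icc.exists_isMinOn (nonempty_Icc.2 hu₀.le) hqc.continuousOn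
  have hδ : 0 < q v := hqpos v hv
  set δ := q v
  have hratio : ∀ t ∈ Ico 0 T, x₁ t / x₂ t ≤ u₀ := by
    refine le_const_of_deriv_neg (fun t ht => h.hasDerivWithinAt_ratio ht)
      (by rw [h.init₁, h.init₂]) fun t ht he => ?_
    rw [he]
    exact div_neg_of_neg_of_pos (neg_neg_of_pos (hqpos u₀ ⟨hu₀.le, le_rfl⟩)) (h.pos₂ t ht)
  set M := |β| + |b| * u₀
  have hM : ∀ u ∈ Icc 0 u₀, -M ≤ -β + b * u := fun u hu => by
    have h1 := le_abs_self β
    have h2 : -(|b| * u₀) ≤ b * u := by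
      have := mul_le_mul_of_nonneg_left hu.2 (abs_nonneg b)
      have := mul_le_mul_of_nonneg_right (neg_abs_le b) hu.1
      linarith
    simp only [M]
    linarith
  have hM0 : 0 ≤ M := by positivity
  -- `(log x₂)' ≥ -M / x₂` and `u' = -q(u) / x₂ ≤ -δ / x₂`, so `log x₂ - (M / δ) u` increases
  have hmono : MonotoneOn (fun t => Real.log (x₂ t) - M / δ * (x₁ t / x₂ t)) (Ico 0 T) := by
    refine monotoneOn_Ico_of_hasDerivWithinAt (fun t ht => ((h.deriv₂ t ht).log
      (h.pos₂ t ht).ne').sub ((h.hasDerivWithinAt_ratio ht).const_mul _)) fun t ht => ?_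
    have h2 := h.pos₂ t ht
    have hmem : x₁ t / x₂ t ∈ Icc 0 u₀ := ⟨(div_pos (h.pos₁ t ht) h2).le, hratio t ht⟩
    have h3 := hM _ hmem
    have h4 : δ ≤ q (x₁ t / x₂ t) := hmin hmem
    have h5 : M ≤ M / δ * q (x₁ t / x₂ t) := by
      rw [div_mul_eq_mul_div, le_div_iff₀ hδ]
      exact mul_le_mul_of_nonneg_left h4 hM0
    refine le_of_le_of_eq (div_nonneg (a := -β + b * (x₁ t / x₂ t) + M / δ * q (x₁ t / x₂ t)) ?_
      h2.le) ?_
    · linarith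
    · simp only [hqdef]
      ring
  refine ⟨Real.exp (Real.log y₂ - M / δ * u₀), Real.exp_pos _, fun t ht => ?_⟩
  have h1 := hmono ⟨le_rfl, hT⟩ ht ht.1
  simp only [h.init₁, h.init₂] at h1
  rw [← Real.le_log_iff_exp_le (h.pos₂ t ht)]
  have h2 : 0 ≤ M / δ * (x₁ t / x₂ t) :=
    mul_nonneg (div_nonneg hM0 hδ.le) (div_pos (h.pos₁ t ht) (h.pos₂ t ht)).le
  simp only [u₀]
  linarith

/-- The two singular behaviours of a maximal solution. -/
lemma singular_behaviour (h : IsScalingFlow C a b β y₁ y₂ T x₁ x₂) (hT : 0 < T) (ha : 0 < a)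
    (hb : 0 < b) (hC : 0 < C)
    (hmax : ∀ T' x₁' x₂', IsScalingFlow C a b β y₁ y₂ T' x₁' x₂' → T' ≤ T) :
    Tendsto x₁ (𝓝[<] T) (𝓝 0) ∧
      ((Tendsto x₂ (𝓝[<] T) (𝓝 0) ∧ ∃ u > 0, (a + b) * u ^ 2 - β * u + C = 0) ∨
        ∃ ℓ > 0, Tendsto x₂ (𝓝[<] T) (𝓝 ℓ)) := by
  obtain ⟨U, hU, hU'⟩ := h.exists_ratio_bound (by linarith) hC
  have hIco : Ico 0 T ∈ 𝓝[<] T := Ico_mem_nhdsLT hT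
  have hnonneg : ∀ t ∈ Ico 0 T, 0 ≤ x₁ t / x₂ t := fun t ht =>
    (div_pos (h.pos₁ t ht) (h.pos₂ t ht)).le
  -- the first factor decreases
  obtain ⟨ℓ₁, hℓ₁⟩ := tendsto_of_antitoneOn_Ico hT
    (antitoneOn_Ico_of_hasDerivWithinAt h.deriv₁ fun t ht => by
      have : 0 ≤ a * (x₁ t / x₂ t) ^ 2 := by positivity
      linarith) (fun t ht => (h.pos₁ t ht).le)
  -- the second factor decreases up to a linear function
  obtain ⟨ℓ, hℓ⟩ := tendsto_of_antitoneOn_Ico (f := fun t => x₂ t - (|β| + b * U) * t)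
    (m := - ((|β| + b * U) * T)) hT
    (antitoneOn_Ico_of_hasDerivWithinAt
      (fun t ht => (h.deriv₂ t ht).sub ((hasDerivWithinAt_id t _).const_mul _)) fun t ht => by
        have h1 := mul_le_mul_of_nonneg_left (hU' t ht) hb.le
        have h2 := neg_abs_le β
        linarith) (fun t ht => by
      have h1 : (|β| + b * U) * t ≤ (|β| + b * U) * T :=
        mul_le_mul_of_nonneg_left ht.2.le (by positivity)
      linarith [h.pos₂ t ht])
  obtain ⟨ℓ₂, hℓ₂⟩ : ∃ ℓ₂, Tendsto x₂ (𝓝[<] T) (𝓝 ℓ₂) := by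
    have h1 : Tendsto (fun t => (|β| + b * U) * t) (𝓝[<] T) (𝓝 ((|β| + b * U) * T)) :=
      ((continuous_const.mul continuous_id).tendsto T).mono_left nhdsWithin_le_nhds
    exact ⟨_, by simpa using hℓ.add h1⟩
  have hℓ₁0 : 0 ≤ ℓ₁ := ge_of_tendsto hℓ₁ (mem_of_superset hIco fun t ht => (h.pos₁ t ht).le)
  have hℓ₂0 : 0 ≤ ℓ₂ := ge_of_tendsto hℓ₂ (mem_of_superset hIco fun t ht => (h.pos₂ t ht).le)
  -- otherwise the solution could be continued
  have hzero : ℓ₁ = 0 := by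
    by_contra hne
    have hpos : 0 < ℓ₁ := lt_of_le_of_ne hℓ₁0 (Ne.symm hne)
    have hanti := antitoneOn_Ico_of_hasDerivWithinAt h.deriv₁ fun t ht => by
      have : 0 ≤ a * (x₁ t / x₂ t) ^ 2 := by positivity
      linarith
    have h1 : ∀ t ∈ Ico 0 T, ℓ₁ ≤ x₁ t := fun t ht => by
      refine le_of_tendsto hℓ₁ ?_
      filter_upwards [Ico_mem_nhdsLT ht.2] with s hs
      exact hanti ht ⟨ht.1.trans hs.1, hs.2⟩ hs.1
    have h2 : ∀ t ∈ Ico 0 T, ℓ₁ / U ≤ x₂ t := fun t ht => by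
      have := hU' t ht
      rw [div_le_iff₀ (h.pos₂ t ht)] at this
      rw [div_le_iff₀ hU]
      linarith [h1 t ht]
    obtain ⟨T', hT', x₁', x₂', h'⟩ := h.exists_extension ha.le hC hT (δ := min ℓ₁ (ℓ₁ / U))
      (by positivity) (fun t ht => (min_le_left _ _).trans (h1 t ht))
      (fun t ht => (min_le_right _ _).trans (h2 t ht))
    exact absurd (hmax T' x₁' x₂' h') (not_le.2 hT')
  subst hzero
  refine ⟨hℓ₁, ?_⟩
  -- The alternative is decided by the existence of a zero of the quadratic below the initial ratio.
  by_cases hroot : ∃ u, 0 < u ∧ u ≤ y₁ / y₂ ∧ (a + b) * u ^ 2 - β * u + C = 0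
  · obtain ⟨u, hu, hu0, hq⟩ := hroot
    refine Or.inl ⟨?_, u, hu, hq⟩
    have hle : ℓ₂ ≤ 0 := by
      have h1 : u * ℓ₂ ≤ 0 := le_of_tendsto_of_tendsto (hℓ₂.const_mul u) hℓ₁
        (mem_of_superset hIco fun t ht => h.le_ratio_of_root hT ha.le hb.le hu hq hu0 ht)
      by_contra! hlt
      nlinarith
    rwa [le_antisymm hle hℓ₂0] at hℓ₂
  · push Not at hroot
    obtain ⟨c, hc, hc'⟩ := h.exists_lower_bound_of_no_root hT hC hroot
    exact Or.inr ⟨ℓ₂, hc.trans_le (ge_of_tendsto hℓ₂ (mem_of_superset hIco hc')), hℓ₂⟩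

end IsScalingFlow

end MaximalFlow

/-! ### Inner products and orthogonal projections -/

section OrthogonalProjection

variable {V : Type*} [AddCommGroup V] [Module ℝ V] {Q : LinearMap.BilinForm ℝ V}

lemma IsInner.nonneg (hQ : IsInner Q) (X : V) : 0 ≤ Q X X := by
  by_cases h : X = 0
  · simp [h]
  · exact (hQ.pos X h).le

lemma IsInner.eq_zero (hQ : IsInner Q) {X : V} (h : Q X X = 0) : X = 0 := by
  by_contra hne
  exact (hQ.pos X hne).ne' h

lemma IsInner.restrict (hQ : IsInner Q) (W : Submodule ℝ V) : IsInner (Q.restrict W) where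
  symm _ _ := hQ.symm _ _
  pos _ hX := hQ.pos _ fun h => hX (Subtype.ext h)

lemma IsInner.isRefl (hQ : IsInner Q) : Q.IsRefl := fun X Y h => by rw [hQ.symm, h]

lemma IsInner.isCompl_orthogonal [FiniteDimensional ℝ V] (hQ : IsInner Q) (W : Submodule ℝ V) :
    IsCompl W (Q.orthogonal W) := by
  rw [LinearMap.BilinForm.isCompl_orthogonal_iff_disjoint hQ.isRefl, Submodule.disjoint_def]
  exact fun X hX hX' => hQ.eq_zero (hX' X hX)

/-- `proj 𝔨 𝔭 X` is the element `Y` of `𝔭` with `X - Y ∈ 𝔨`. -/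
lemma coe_proj_of_mem {𝔨 𝔭 : Submodule ℝ V} (h : IsCompl 𝔭 𝔨) {X Y : V} (hY : Y ∈ 𝔭)
    (hXY : X - Y ∈ 𝔨) : (proj 𝔨 𝔭 X : V) = Y := by
  have e : X = Y + (X - Y) := by abel
  rw [proj, dif_pos h, e, map_add, Submodule.projectionOnto_apply_of_mem_left h hY,
    Submodule.projectionOnto_apply_of_mem_right h hXY, add_zero]

/-- The orthogonal projection onto `W`, as an endomorphism of `V`. -/
def orthProj (Q : LinearMap.BilinForm ℝ V) (W : Submodule ℝ V) : V →ₗ[ℝ] V :=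
  W.subtype ∘ₗ proj (Q.orthogonal W) W

lemma orthProj_mem (W : Submodule ℝ V) (X : V) : orthProj Q W X ∈ W := Subtype.coe_prop _

variable [FiniteDimensional ℝ V]

/-- The orthogonal projection is characterised by its inner products with the elements of `W`. -/
lemma IsInner.orthProj_eq (hQ : IsInner Q) {W : Submodule ℝ V} {X Y : V} (hY : Y ∈ W)
    (h : ∀ Z ∈ W, Q Z X = Q Z Y) : orthProj Q W X = Y :=
  coe_proj_of_mem (hQ.isCompl_orthogonal W) hY fun Z hZ => by
    change Q Z (X - Y) = 0
    rw [map_sub, h Z hZ, sub_self]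

lemma IsInner.orthProj_of_mem (hQ : IsInner Q) {W : Submodule ℝ V} {X : V} (hX : X ∈ W) :
    orthProj Q W X = X := hQ.orthProj_eq hX fun _ _ => rfl

lemma IsInner.apply_orthProj_of_mem (hQ : IsInner Q) {W : Submodule ℝ V} {Y : V} (hY : Y ∈ W)
    (X : V) : Q Y (orthProj Q W X) = Q Y X := by
  have hc := hQ.isCompl_orthogonal W
  obtain ⟨A, hA, B, hB, rfl⟩ := Submodule.mem_sup.1 (show X ∈ W ⊔ Q.orthogonal W by
    rw [hc.sup_eq_top]; trivial)
  rw [hQ.orthProj_eq hA fun Z hZ => by rw [map_add, hB Z hZ, add_zero], map_add, hB Y hY, add_zero]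

lemma IsInner.orthProj_apply_of_mem (hQ : IsInner Q) {W : Submodule ℝ V} {Y : V} (hY : Y ∈ W)
    (X : V) : Q (orthProj Q W X) Y = Q X Y := by
  rw [hQ.symm, hQ.apply_orthProj_of_mem hY, hQ.symm]

lemma IsInner.orthProj_apply (hQ : IsInner Q) (W : Submodule ℝ V) (X Y : V) :
    Q (orthProj Q W X) Y = Q (orthProj Q W X) (orthProj Q W Y) :=
  (hQ.apply_orthProj_of_mem (orthProj_mem W X) Y).symm

lemma IsInner.orthProj_eq_zero (hQ : IsInner Q) {W : Submodule ℝ V} {X : V}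
    (h : ∀ Z ∈ W, Q Z X = 0) : orthProj Q W X = 0 :=
  hQ.orthProj_eq W.zero_mem fun Z hZ => by rw [h Z hZ, map_zero]

end OrthogonalProjection

/-! ### The Levi-Civita connection for two isotropy summands -/

section TwoSummands

set_option linter.unusedSectionVars false

variable {𝔤 : Type*} [LieRing 𝔤] [LieAlgebra ℝ 𝔤]

/-- The algebraic structure of the tower `K < H < G` when the isotropy representation of `G/K` has
two summands: `𝔤 = 𝔨 ⊕ 𝔭₁ ⊕ 𝔭₂` is orthogonal for the `ad`-invariant inner product `Q`, the
summands `𝔭₁` and `𝔭₂` are `𝔨`-invariant, and `𝔨 ⊕ 𝔭₁` is closed under the bracket. -/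
structure IsTwoSummand (Q : LinearMap.BilinForm ℝ 𝔤) (𝔨 𝔭₁ 𝔭₂ : Submodule ℝ 𝔤) : Prop where
  inner : IsInner Q
  ad : ∀ X Y Z : 𝔤, Q ⁅X, Y⁆ Z + Q Y ⁅X, Z⁆ = 0
  orth₀₁ : ∀ X ∈ 𝔨, ∀ Y ∈ 𝔭₁, Q X Y = 0
  orth₀₂ : ∀ X ∈ 𝔨, ∀ Y ∈ 𝔭₂, Q X Y = 0
  orth₁₂ : ∀ X ∈ 𝔭₁, ∀ Y ∈ 𝔭₂, Q X Y = 0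
  span : 𝔨 ⊔ (𝔭₁ ⊔ 𝔭₂) = ⊤
  lie₀₀ : ∀ X ∈ 𝔨, ∀ Y ∈ 𝔨, ⁅X, Y⁆ ∈ 𝔨
  lie₀₁ : ∀ X ∈ 𝔨, ∀ Y ∈ 𝔭₁, ⁅X, Y⁆ ∈ 𝔭₁
  lie₀₂ : ∀ X ∈ 𝔨, ∀ Y ∈ 𝔭₂, ⁅X, Y⁆ ∈ 𝔭₂
  lie₁₁ : ∀ X ∈ 𝔭₁, ∀ Y ∈ 𝔭₁, ⁅X, Y⁆ ∈ 𝔨 ⊔ 𝔭₁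

/-- The metric `x₁ Q|𝔭₁ + x₂ Q|𝔭₂` on `𝔭`. -/
def diagMetric (Q : LinearMap.BilinForm ℝ 𝔤) (𝔭₁ 𝔭₂ 𝔭 : Submodule ℝ 𝔤) (x₁ x₂ : ℝ) :
    LinearMap.BilinForm ℝ 𝔭 :=
  x₁ • Q.compl₁₂ (orthProj Q 𝔭₁ ∘ₗ 𝔭.subtype) (orthProj Q 𝔭₁ ∘ₗ 𝔭.subtype) +
    x₂ • Q.compl₁₂ (orthProj Q 𝔭₂ ∘ₗ 𝔭.subtype) (orthProj Q 𝔭₂ ∘ₗ 𝔭.subtype)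

lemma diagMetric_apply (Q : LinearMap.BilinForm ℝ 𝔤) (𝔭₁ 𝔭₂ 𝔭 : Submodule ℝ 𝔤) (x₁ x₂ : ℝ)
    (X Y : 𝔭) : diagMetric Q 𝔭₁ 𝔭₂ 𝔭 x₁ x₂ X Y =
      x₁ * Q (orthProj Q 𝔭₁ X) (orthProj Q 𝔭₁ Y) + x₂ * Q (orthProj Q 𝔭₂ X) (orthProj Q 𝔭₂ Y) :=
  rfl

/-- The Levi-Civita connection of the metric `x₁ Q|𝔭₁ + x₂ Q|𝔭₂`, where `u = x₁ / x₂`. -/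
def lam (Q : LinearMap.BilinForm ℝ 𝔤) (𝔭₁ 𝔭₂ : Submodule ℝ 𝔤) (u : ℝ) (X Y : 𝔤) : 𝔤 :=
  (1 / 2 : ℝ) • orthProj Q 𝔭₁ ⁅orthProj Q 𝔭₁ X, orthProj Q 𝔭₁ Y⁆ +
    (1 - u / 2) • ⁅orthProj Q 𝔭₁ X, orthProj Q 𝔭₂ Y⁆ +
    (u / 2) • ⁅orthProj Q 𝔭₂ X, orthProj Q 𝔭₁ Y⁆ +
    (1 / 2 : ℝ) • (orthProj Q 𝔭₁ ⁅orthProj Q 𝔭₂ X, orthProj Q 𝔭₂ Y⁆ +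
      orthProj Q 𝔭₂ ⁅orthProj Q 𝔭₂ X, orthProj Q 𝔭₂ Y⁆)

/-- Koszul's formula determines the Levi-Civita connection. -/
lemma leviCivita_eq {𝔨 𝔭 : Submodule ℝ 𝔤} [FiniteDimensional ℝ 𝔭] {g : LinearMap.BilinForm ℝ 𝔭}
    (hg : IsInner g) {X Y L : 𝔭}
    (h : ∀ Z, 2 * g L Z = g (proj 𝔨 𝔭 ⁅(X : 𝔤), (Y : 𝔤)⁆) Z - g (proj 𝔨 𝔭 ⁅(Y : 𝔤), (Z : 𝔤)⁆) X +
      g (proj 𝔨 𝔭 ⁅(Z : 𝔤), (X : 𝔤)⁆) Y) : leviCivita 𝔨 𝔭 g X Y = L := by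
  have hex := (existsUnique_isLeviCivita 𝔨 𝔭 hg).exists
  have hΛ : IsLeviCivita 𝔨 𝔭 g (leviCivita 𝔨 𝔭 g) := by
    rw [leviCivita, dif_pos hex]
    exact hex.choose_spec
  set Λ := leviCivita 𝔨 𝔭 g
  rw [← sub_eq_zero]
  refine hg.eq_zero ?_
  set Z := Λ X Y - L
  have h1 := h Z
  rw [← hΛ.torsion_free X Y, ← hΛ.torsion_free Y Z, ← hΛ.torsion_free Z X] at h1
  have m1 := hΛ.metric X Y Z
  have m2 := hΛ.metric Y Z X
  have m3 := hΛ.metric Z X Y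
  rw [hg.symm Y] at m1
  rw [hg.symm Z] at m2
  rw [hg.symm X] at m3
  have e : g Z Z = g (Λ X Y) Z - g L Z := by
    simp only [Z, map_sub, LinearMap.sub_apply]
    ring
  simp only [map_sub, LinearMap.sub_apply] at h1
  simp only [Z, map_sub, LinearMap.sub_apply] at h1 m1 m2 m3 e ⊢
  linarith

namespace IsTwoSummand

variable [FiniteDimensional ℝ 𝔤] {Q : LinearMap.BilinForm ℝ 𝔤} {𝔨 𝔭₁ 𝔭₂ : Submodule ℝ 𝔤}

lemma lie_apply_eq (h : IsTwoSummand Q 𝔨 𝔭₁ 𝔭₂) (X Y Z : 𝔤) : Q ⁅X, Y⁆ Z = - Q ⁅X, Z⁆ Y := by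
  rw [h.inner.symm ⁅X, Z⁆]
  linarith [h.ad X Y Z]

/-- The trilinear form `Q([X, Y], Z)` is invariant under cyclic permutations. -/
lemma lie_apply_cyc (h : IsTwoSummand Q 𝔨 𝔭₁ 𝔭₂) (X Y Z : 𝔤) : Q ⁅X, Y⁆ Z = Q ⁅Y, Z⁆ X := by
  rw [← lie_skew X Y, map_neg, LinearMap.neg_apply, h.lie_apply_eq Y X Z, neg_neg]

lemma lie_apply_self (h : IsTwoSummand Q 𝔨 𝔭₁ 𝔭₂) (X Y : 𝔤) : Q ⁅X, Y⁆ X = 0 := by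
  rw [h.lie_apply_eq, lie_self, map_zero, LinearMap.zero_apply, neg_zero]

lemma orth_sup (h : IsTwoSummand Q 𝔨 𝔭₁ 𝔭₂) {X Y : 𝔤} (hX : X ∈ 𝔨 ⊔ 𝔭₁) (hY : Y ∈ 𝔭₂) :
    Q X Y = 0 := by
  obtain ⟨A, hA, B, hB, rfl⟩ := Submodule.mem_sup.1 hX
  rw [map_add, LinearMap.add_apply, h.orth₀₂ A hA Y hY, h.orth₁₂ B hB Y hY, add_zero]

lemma exists_decomp (h : IsTwoSummand Q 𝔨 𝔭₁ 𝔭₂) (X : 𝔤) :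
    ∃ A ∈ 𝔨, ∃ B ∈ 𝔭₁, ∃ D ∈ 𝔭₂, X = A + (B + D) := by
  obtain ⟨A, hA, Z, hZ, rfl⟩ := Submodule.mem_sup.1 (h.span.ge (Submodule.mem_top (x := X)))
  obtain ⟨B, hB, D, hD, rfl⟩ := Submodule.mem_sup.1 hZ
  exact ⟨A, hA, B, hB, D, hD, rfl⟩

lemma proj₀_of_mem₀ (h : IsTwoSummand Q 𝔨 𝔭₁ 𝔭₂) {X : 𝔤} (hX : X ∈ 𝔨) : orthProj Q 𝔨 X = X :=
  h.inner.orthProj_of_mem hX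

lemma proj₀_of_mem₁ (h : IsTwoSummand Q 𝔨 𝔭₁ 𝔭₂) {X : 𝔤} (hX : X ∈ 𝔭₁) : orthProj Q 𝔨 X = 0 :=
  h.inner.orthProj_eq_zero fun Z hZ => h.orth₀₁ Z hZ X hX

lemma proj₀_of_mem₂ (h : IsTwoSummand Q 𝔨 𝔭₁ 𝔭₂) {X : 𝔤} (hX : X ∈ 𝔭₂) : orthProj Q 𝔨 X = 0 :=
  h.inner.orthProj_eq_zero fun Z hZ => h.orth₀₂ Z hZ X hX

lemma proj₁_of_mem₀ (h : IsTwoSummand Q 𝔨 𝔭₁ 𝔭₂) {X : 𝔤} (hX : X ∈ 𝔨) : orthProj Q 𝔭₁ X = 0 :=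
  h.inner.orthProj_eq_zero fun Z hZ => by rw [h.inner.symm, h.orth₀₁ X hX Z hZ]

lemma proj₁_of_mem₁ (h : IsTwoSummand Q 𝔨 𝔭₁ 𝔭₂) {X : 𝔤} (hX : X ∈ 𝔭₁) : orthProj Q 𝔭₁ X = X :=
  h.inner.orthProj_of_mem hX

lemma proj₁_of_mem₂ (h : IsTwoSummand Q 𝔨 𝔭₁ 𝔭₂) {X : 𝔤} (hX : X ∈ 𝔭₂) : orthProj Q 𝔭₁ X = 0 :=
  h.inner.orthProj_eq_zero fun Z hZ => h.orth₁₂ Z hZ X hX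

lemma proj₂_of_mem₀ (h : IsTwoSummand Q 𝔨 𝔭₁ 𝔭₂) {X : 𝔤} (hX : X ∈ 𝔨) : orthProj Q 𝔭₂ X = 0 :=
  h.inner.orthProj_eq_zero fun Z hZ => by rw [h.inner.symm, h.orth₀₂ X hX Z hZ]

lemma proj₂_of_mem₁ (h : IsTwoSummand Q 𝔨 𝔭₁ 𝔭₂) {X : 𝔤} (hX : X ∈ 𝔭₁) : orthProj Q 𝔭₂ X = 0 :=
  h.inner.orthProj_eq_zero fun Z hZ => by rw [h.inner.symm, h.orth₁₂ X hX Z hZ]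

lemma proj₂_of_mem₂ (h : IsTwoSummand Q 𝔨 𝔭₁ 𝔭₂) {X : 𝔤} (hX : X ∈ 𝔭₂) : orthProj Q 𝔭₂ X = X :=
  h.inner.orthProj_of_mem hX

lemma sum_proj (h : IsTwoSummand Q 𝔨 𝔭₁ 𝔭₂) (X : 𝔤) :
    orthProj Q 𝔨 X + (orthProj Q 𝔭₁ X + orthProj Q 𝔭₂ X) = X := by
  obtain ⟨A, hA, B, hB, D, hD, rfl⟩ := h.exists_decomp X
  simp only [map_add, h.proj₀_of_mem₀ hA, h.proj₀_of_mem₁ hB, h.proj₀_of_mem₂ hD,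
    h.proj₁_of_mem₀ hA, h.proj₁_of_mem₁ hB, h.proj₁_of_mem₂ hD,
    h.proj₂_of_mem₀ hA, h.proj₂_of_mem₁ hB, h.proj₂_of_mem₂ hD]
  abel

lemma mem₂_of_orth (h : IsTwoSummand Q 𝔨 𝔭₁ 𝔭₂) {X : 𝔤} (h₀ : ∀ Z ∈ 𝔨, Q Z X = 0)
    (h₁ : ∀ Z ∈ 𝔭₁, Q Z X = 0) : X ∈ 𝔭₂ := by
  have := h.sum_proj X
  rw [h.inner.orthProj_eq_zero h₀, h.inner.orthProj_eq_zero h₁, zero_add, zero_add] at this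
  rw [← this]
  exact orthProj_mem _ _

/-- The summand `𝔭₂` is invariant under `𝔥 = 𝔨 ⊕ 𝔭₁`, because it is orthogonal to it. -/
lemma lie₁₂ (h : IsTwoSummand Q 𝔨 𝔭₁ 𝔭₂) {X Y : 𝔤} (hX : X ∈ 𝔭₁) (hY : Y ∈ 𝔭₂) :
    ⁅X, Y⁆ ∈ 𝔭₂ := by
  refine h.mem₂_of_orth (fun Z hZ => ?_) fun Z hZ => ?_
  · rw [h.inner.symm, ← h.lie_apply_cyc, h.orth₁₂ _ (h.lie₀₁ Z hZ X hX) Y hY]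
  · rw [h.inner.symm, ← h.lie_apply_cyc, h.orth_sup (h.lie₁₁ Z hZ X hX) hY]

lemma lie₂₁ (h : IsTwoSummand Q 𝔨 𝔭₁ 𝔭₂) {X Y : 𝔤} (hX : X ∈ 𝔭₂) (hY : Y ∈ 𝔭₁) :
    ⁅X, Y⁆ ∈ 𝔭₂ := by
  rw [← lie_skew]
  exact neg_mem (h.lie₁₂ hY hX)

lemma proj₂_lie₁₁ (h : IsTwoSummand Q 𝔨 𝔭₁ 𝔭₂) {X Y : 𝔤} (hX : X ∈ 𝔭₁) (hY : Y ∈ 𝔭₁) :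
    orthProj Q 𝔭₂ ⁅X, Y⁆ = 0 :=
  h.inner.orthProj_eq_zero fun Z hZ => by rw [h.inner.symm, h.orth_sup (h.lie₁₁ X hX Y hY) hZ]

variable {𝔭 : Submodule ℝ 𝔤}

lemma isCompl (h : IsTwoSummand Q 𝔨 𝔭₁ 𝔭₂) (h𝔭 : 𝔭₁ ⊔ 𝔭₂ = 𝔭) : IsCompl 𝔭 𝔨 := by
  subst h𝔭
  refine ⟨Submodule.disjoint_def.2 fun X hX hX' => h.inner.eq_zero ?_, codisjoint_iff.2 ?_⟩
  · obtain ⟨A, hA, B, hB, e⟩ := Submodule.mem_sup.1 hX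
    nth_rewrite 2 [← e]
    rw [map_add, h.orth₀₁ X hX' A hA, h.orth₀₂ X hX' B hB, add_zero]
  · rw [sup_comm, h.span]

lemma coe_proj (h : IsTwoSummand Q 𝔨 𝔭₁ 𝔭₂) (h𝔭 : 𝔭₁ ⊔ 𝔭₂ = 𝔭) (X : 𝔤) :
    (proj 𝔨 𝔭 X : 𝔤) = orthProj Q 𝔭₁ X + orthProj Q 𝔭₂ X := by
  refine coe_proj_of_mem (h.isCompl h𝔭) ?_ ?_
  · rw [← h𝔭]
    exact Submodule.add_mem_sup (orthProj_mem _ _) (orthProj_mem _ _)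
  · rw [sub_eq_of_eq_add (h.sum_proj X).symm]
    exact orthProj_mem _ _

lemma proj₁_coe_proj (h : IsTwoSummand Q 𝔨 𝔭₁ 𝔭₂) (h𝔭 : 𝔭₁ ⊔ 𝔭₂ = 𝔭) (X : 𝔤) :
    orthProj Q 𝔭₁ (proj 𝔨 𝔭 X : 𝔤) = orthProj Q 𝔭₁ X := by
  rw [h.coe_proj h𝔭, map_add, h.proj₁_of_mem₁ (orthProj_mem _ _),
    h.proj₁_of_mem₂ (orthProj_mem _ _), add_zero]

lemma proj₂_coe_proj (h : IsTwoSummand Q 𝔨 𝔭₁ 𝔭₂) (h𝔭 : 𝔭₁ ⊔ 𝔭₂ = 𝔭) (X : 𝔤) :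
    orthProj Q 𝔭₂ (proj 𝔨 𝔭 X : 𝔤) = orthProj Q 𝔭₂ X := by
  rw [h.coe_proj h𝔭, map_add, h.proj₂_of_mem₁ (orthProj_mem _ _),
    h.proj₂_of_mem₂ (orthProj_mem _ _), zero_add]

lemma proj_add_proj (h : IsTwoSummand Q 𝔨 𝔭₁ 𝔭₂) (h𝔭 : 𝔭₁ ⊔ 𝔭₂ = 𝔭) (X : 𝔭) :
    orthProj Q 𝔭₁ X + orthProj Q 𝔭₂ X = (X : 𝔤) := by
  obtain ⟨A, hA, B, hB, e⟩ := Submodule.mem_sup.1 (h𝔭.ge X.2)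
  rw [← e]
  simp only [map_add, h.proj₁_of_mem₁ hA, h.proj₁_of_mem₂ hB, h.proj₂_of_mem₁ hA,
    h.proj₂_of_mem₂ hB, add_zero, zero_add]

lemma isInner_diagMetric (h : IsTwoSummand Q 𝔨 𝔭₁ 𝔭₂) (h𝔭 : 𝔭₁ ⊔ 𝔭₂ = 𝔭) {x₁ x₂ : ℝ}
    (hx₁ : 0 < x₁) (hx₂ : 0 < x₂) : IsInner (diagMetric Q 𝔭₁ 𝔭₂ 𝔭 x₁ x₂) where
  symm X Y := by
    rw [diagMetric_apply, diagMetric_apply, h.inner.symm, h.inner.symm (orthProj Q 𝔭₂ X)]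
  pos X hX := by
    rw [diagMetric_apply]
    have h1 := h.inner.nonneg (orthProj Q 𝔭₁ X)
    have h2 := h.inner.nonneg (orthProj Q 𝔭₂ X)
    refine lt_of_le_of_ne (by positivity) fun h0 => hX ?_
    have e1 : Q (orthProj Q 𝔭₁ X) (orthProj Q 𝔭₁ X) = 0 := by nlinarith
    have e2 : Q (orthProj Q 𝔭₂ X) (orthProj Q 𝔭₂ X) = 0 := by nlinarith
    have := h.proj_add_proj h𝔭 X
    rw [h.inner.eq_zero e1, h.inner.eq_zero e2, add_zero] at this
    exact Subtype.ext this.symm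

lemma lam_mem (h : IsTwoSummand Q 𝔨 𝔭₁ 𝔭₂) (h𝔭 : 𝔭₁ ⊔ 𝔭₂ = 𝔭) (u : ℝ) (X Y : 𝔤) :
    lam Q 𝔭₁ 𝔭₂ u X Y ∈ 𝔭 := by
  have hm : ∀ Z, orthProj Q 𝔭₁ Z ∈ 𝔭 := fun Z => h𝔭 ▸ Submodule.mem_sup_left (orthProj_mem _ _)
  have hm2 : ∀ Z ∈ 𝔭₂, Z ∈ 𝔭 := fun Z hZ => h𝔭 ▸ Submodule.mem_sup_right hZ
  exact add_mem (add_mem (add_mem (𝔭.smul_mem _ (hm _))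
    (𝔭.smul_mem _ (hm2 _ (h.lie₁₂ (orthProj_mem _ _) (orthProj_mem _ _)))))
    (𝔭.smul_mem _ (hm2 _ (h.lie₂₁ (orthProj_mem _ _) (orthProj_mem _ _)))))
    (𝔭.smul_mem _ (add_mem (hm _) (hm2 _ (orthProj_mem _ _))))

/-- The Levi-Civita connection of `x₁ Q|𝔭₁ + x₂ Q|𝔭₂` is `lam` with parameter `x₁ / x₂`; this is
Koszul's formula, evaluated component by component. -/
lemma coe_leviCivita (h : IsTwoSummand Q 𝔨 𝔭₁ 𝔭₂) (h𝔭 : 𝔭₁ ⊔ 𝔭₂ = 𝔭) {x₁ x₂ : ℝ}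
    (hx₁ : 0 < x₁) (hx₂ : 0 < x₂) (X Y : 𝔭) :
    (leviCivita 𝔨 𝔭 (diagMetric Q 𝔭₁ 𝔭₂ 𝔭 x₁ x₂) X Y : 𝔤) = lam Q 𝔭₁ 𝔭₂ (x₁ / x₂) X Y := by
  suffices leviCivita 𝔨 𝔭 (diagMetric Q 𝔭₁ 𝔭₂ 𝔭 x₁ x₂) X Y =
      ⟨lam Q 𝔭₁ 𝔭₂ (x₁ / x₂) X Y, h.lam_mem h𝔭 _ _ _⟩ by rw [this]
  refine leviCivita_eq (h.isInner_diagMetric h𝔭 hx₁ hx₂) fun Z => ?_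
  set X₁ := orthProj Q 𝔭₁ X with hX₁
  set X₂ := orthProj Q 𝔭₂ X with hX₂
  set Y₁ := orthProj Q 𝔭₁ Y with hY₁
  set Y₂ := orthProj Q 𝔭₂ Y with hY₂
  set Z₁ := orthProj Q 𝔭₁ Z with hZ₁
  set Z₂ := orthProj Q 𝔭₂ Z with hZ₂
  have mX₁ : X₁ ∈ 𝔭₁ := orthProj_mem _ _
  have mX₂ : X₂ ∈ 𝔭₂ := orthProj_mem _ _
  have mY₁ : Y₁ ∈ 𝔭₁ := orthProj_mem _ _
  have mY₂ : Y₂ ∈ 𝔭₂ := orthProj_mem _ _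
  have mZ₁ : Z₁ ∈ 𝔭₁ := orthProj_mem _ _
  have mZ₂ : Z₂ ∈ 𝔭₂ := orthProj_mem _ _
  simp only [diagMetric_apply, h.proj₁_coe_proj h𝔭, h.proj₂_coe_proj h𝔭,
    h.inner.orthProj_apply_of_mem mX₁, h.inner.orthProj_apply_of_mem mX₂,
    h.inner.orthProj_apply_of_mem mY₁, h.inner.orthProj_apply_of_mem mY₂,
    h.inner.orthProj_apply_of_mem mZ₁, h.inner.orthProj_apply_of_mem mZ₂,
    ← hX₁, ← hX₂, ← hY₁, ← hY₂, ← hZ₁, ← hZ₂]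
  have pa : ∀ A B : 𝔤, ∀ D ∈ 𝔭₁, ∀ F ∈ 𝔭₂, Q (orthProj Q 𝔭₁ ⁅A, B⁆) F = 0 ∧
    Q (orthProj Q 𝔭₂ ⁅A, B⁆) D = 0 := fun A B D hD F hF =>
      ⟨h.orth₁₂ _ (orthProj_mem _ _) F hF, by
        rw [h.inner.symm, h.orth₁₂ D hD _ (orthProj_mem _ _)]⟩
  -- `Q([A, B], F) = 0` when two arguments are in `𝔭₁` and one is in `𝔭₂`, in any order
  have h112 : ∀ A ∈ 𝔭₁, ∀ B ∈ 𝔭₁, ∀ F ∈ 𝔭₂, Q ⁅A, B⁆ F = 0 := fun A hA B hB F hF =>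
    h.orth_sup (h.lie₁₁ A hA B hB) hF
  have h121 : ∀ A ∈ 𝔭₁, ∀ B ∈ 𝔭₁, ∀ F ∈ 𝔭₂, Q ⁅A, F⁆ B = 0 := fun A hA B hB F hF => by
    rw [h.lie_apply_eq, h112 A hA B hB F hF, neg_zero]
  have h211 : ∀ A ∈ 𝔭₁, ∀ B ∈ 𝔭₁, ∀ F ∈ 𝔭₂, Q ⁅F, A⁆ B = 0 := fun A hA B hB F hF => by
    rw [h.lie_apply_cyc, h112 A hA B hB F hF]
  have e1 : Q (lam Q 𝔭₁ 𝔭₂ (x₁ / x₂) X Y) Z₁ = 1 / 2 * Q ⁅X₁, Y₁⁆ Z₁ + 1 / 2 * Q ⁅X₂, Y₂⁆ Z₁ := by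
    simp only [lam, ← hX₁, ← hX₂, ← hY₁, ← hY₂, map_add, map_smul, LinearMap.add_apply,
      LinearMap.smul_apply, smul_eq_mul, h.inner.orthProj_apply_of_mem mZ₁,
      h121 _ mX₁ _ mZ₁ _ mY₂, h211 _ mY₁ _ mZ₁ _ mX₂, (pa X₂ Y₂ _ mZ₁ _ mZ₂).2]
    ring
  have e2 : Q (lam Q 𝔭₁ 𝔭₂ (x₁ / x₂) X Y) Z₂ = (1 - x₁ / x₂ / 2) * Q ⁅X₁, Y₂⁆ Z₂ +
      x₁ / x₂ / 2 * Q ⁅X₂, Y₁⁆ Z₂ + 1 / 2 * Q ⁅X₂, Y₂⁆ Z₂ := by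
    simp only [lam, ← hX₁, ← hX₂, ← hY₁, ← hY₂, map_add, map_smul, LinearMap.add_apply,
      LinearMap.smul_apply, smul_eq_mul, h.inner.orthProj_apply_of_mem mZ₂,
      (pa X₁ Y₁ _ mZ₁ _ mZ₂).1, (pa X₂ Y₂ _ mZ₁ _ mZ₂).1]
    ring
  rw [e1, e2]
  rw [← h.proj_add_proj h𝔭 X, ← h.proj_add_proj h𝔭 Y, ← h.proj_add_proj h𝔭 Z, ← hX₁, ← hX₂,
    ← hY₁, ← hY₂, ← hZ₁, ← hZ₂]
  simp only [add_lie, lie_add, map_add, LinearMap.add_apply,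
    h112 _ mX₁ _ mY₁ _ mZ₂, h112 _ mY₁ _ mZ₁ _ mX₂, h112 _ mZ₁ _ mX₁ _ mY₂,
    h121 _ mX₁ _ mZ₁ _ mY₂, h211 _ mY₁ _ mZ₁ _ mX₂, h121 _ mY₁ _ mX₁ _ mZ₂,
    h211 _ mZ₁ _ mX₁ _ mY₂, h121 _ mZ₁ _ mY₁ _ mX₂, h211 _ mX₁ _ mY₁ _ mZ₂]
  -- bring the remaining terms into the form `Q([X, Y], Z)`, up to cyclic permutations
  rw [← h.lie_apply_cyc X₁ Y₁ Z₁, h.lie_apply_cyc Z₁ X₁ Y₁, ← h.lie_apply_cyc X₂ Y₂ Z₂,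
    h.lie_apply_cyc Z₂ X₂ Y₂, ← h.lie_apply_cyc X₁ Y₂ Z₂, h.lie_apply_cyc Z₂ X₁ Y₂,
    ← h.lie_apply_cyc X₂ Y₁ Z₂, h.lie_apply_cyc Z₂ X₂ Y₁, ← h.lie_apply_cyc X₂ Y₂ Z₁,
    h.lie_apply_cyc Z₁ X₂ Y₂]
  field_simp
  ring

/-- The curvature operator, written in terms of the connection `lam`. -/
def curv (Q : LinearMap.BilinForm ℝ 𝔤) (𝔨 𝔭₁ 𝔭₂ : Submodule ℝ 𝔤) (u : ℝ) (X Y Z : 𝔤) : 𝔤 :=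
  lam Q 𝔭₁ 𝔭₂ u X (lam Q 𝔭₁ 𝔭₂ u Y Z) - lam Q 𝔭₁ 𝔭₂ u Y (lam Q 𝔭₁ 𝔭₂ u X Z) -
    lam Q 𝔭₁ 𝔭₂ u (orthProj Q 𝔭₁ ⁅X, Y⁆ + orthProj Q 𝔭₂ ⁅X, Y⁆) Z - ⁅orthProj Q 𝔨 ⁅X, Y⁆, Z⁆

/-- The curvature operator of `x₁ Q|𝔭₁ + x₂ Q|𝔭₂` is `curv` with parameter `x₁ / x₂`. -/
lemma coe_curvature (h : IsTwoSummand Q 𝔨 𝔭₁ 𝔭₂) (h𝔭 : 𝔭₁ ⊔ 𝔭₂ = 𝔭) {x₁ x₂ : ℝ}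
    (hx₁ : 0 < x₁) (hx₂ : 0 < x₂) (X Y Z : 𝔭) :
    (curvature 𝔨 𝔭 (diagMetric Q 𝔭₁ 𝔭₂ 𝔭 x₁ x₂) X Y Z : 𝔤) =
      curv Q 𝔨 𝔭₁ 𝔭₂ (x₁ / x₂) X Y Z := by
  have e : ⁅(X : 𝔤), (Y : 𝔤)⁆ - (proj 𝔨 𝔭 ⁅(X : 𝔤), (Y : 𝔤)⁆ : 𝔤) =
      orthProj Q 𝔨 ⁅(X : 𝔤), (Y : 𝔤)⁆ := by
    rw [h.coe_proj h𝔭, sub_eq_of_eq_add (h.sum_proj _).symm]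
  have hm : ⁅orthProj Q 𝔨 ⁅(X : 𝔤), (Y : 𝔤)⁆, (Z : 𝔤)⁆ ∈ 𝔭 := by
    rw [← h.proj_add_proj h𝔭 Z, lie_add]
    exact h𝔭.le (Submodule.add_mem_sup (h.lie₀₁ _ (orthProj_mem _ _) _ (orthProj_mem _ _))
      (h.lie₀₂ _ (orthProj_mem _ _) _ (orthProj_mem _ _)))
  have e' := coe_proj_of_mem (X := ⁅orthProj Q 𝔨 ⁅(X : 𝔤), (Y : 𝔤)⁆, (Z : 𝔤)⁆) (h.isCompl h𝔭) hm
    (by rw [sub_self]; exact zero_mem _)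
  simp only [curvature, Submodule.coe_sub, h.coe_leviCivita h𝔭 hx₁ hx₂, e, curv]
  rw [e', h.coe_proj h𝔭]

end IsTwoSummand

end TwoSummands

/-! ### Curvature components entering the Ricci tensor -/

section PointwiseCurvature

set_option linter.unusedSectionVars false

variable {𝔤 : Type*} [LieRing 𝔤] [LieAlgebra ℝ 𝔤] {Q : LinearMap.BilinForm ℝ 𝔤}
  {𝔨 𝔭₁ 𝔭₂ : Submodule ℝ 𝔤}

lemma lam_add_left (u : ℝ) (X X' Y : 𝔤) :
    lam Q 𝔭₁ 𝔭₂ u (X + X') Y = lam Q 𝔭₁ 𝔭₂ u X Y + lam Q 𝔭₁ 𝔭₂ u X' Y := by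
  simp only [lam, map_add, add_lie, smul_add]
  abel

lemma lam_add_right (u : ℝ) (X Y Y' : 𝔤) :
    lam Q 𝔭₁ 𝔭₂ u X (Y + Y') = lam Q 𝔭₁ 𝔭₂ u X Y + lam Q 𝔭₁ 𝔭₂ u X Y' := by
  simp only [lam, map_add, lie_add, smul_add]
  abel

lemma lam_smul_right (u c : ℝ) (X Y : 𝔤) :
    lam Q 𝔭₁ 𝔭₂ u X (c • Y) = c • lam Q 𝔭₁ 𝔭₂ u X Y := by
  simp only [lam, map_smul, lie_smul, smul_add, smul_comm c]

namespace IsTwoSummand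

variable [FiniteDimensional ℝ 𝔤]

lemma lam₁₁ (h : IsTwoSummand Q 𝔨 𝔭₁ 𝔭₂) (u : ℝ) {X Y : 𝔤} (hX : X ∈ 𝔭₁) (hY : Y ∈ 𝔭₁) :
    lam Q 𝔭₁ 𝔭₂ u X Y = (1 / 2 : ℝ) • orthProj Q 𝔭₁ ⁅X, Y⁆ := by
  simp only [lam, h.proj₁_of_mem₁ hX, h.proj₁_of_mem₁ hY, h.proj₂_of_mem₁ hX, h.proj₂_of_mem₁ hY,
    lie_zero, zero_lie, map_zero, smul_zero, add_zero]

lemma lam₁₂ (h : IsTwoSummand Q 𝔨 𝔭₁ 𝔭₂) (u : ℝ) {X Y : 𝔤} (hX : X ∈ 𝔭₁) (hY : Y ∈ 𝔭₂) :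
    lam Q 𝔭₁ 𝔭₂ u X Y = (1 - u / 2) • ⁅X, Y⁆ := by
  simp only [lam, h.proj₁_of_mem₁ hX, h.proj₁_of_mem₂ hY, h.proj₂_of_mem₁ hX, h.proj₂_of_mem₂ hY,
    lie_zero, zero_lie, map_zero, smul_zero, add_zero, zero_add]

lemma lam₂₁ (h : IsTwoSummand Q 𝔨 𝔭₁ 𝔭₂) (u : ℝ) {X Y : 𝔤} (hX : X ∈ 𝔭₂) (hY : Y ∈ 𝔭₁) :
    lam Q 𝔭₁ 𝔭₂ u X Y = (u / 2) • ⁅X, Y⁆ := by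
  simp only [lam, h.proj₁_of_mem₂ hX, h.proj₁_of_mem₁ hY, h.proj₂_of_mem₂ hX, h.proj₂_of_mem₁ hY,
    lie_zero, zero_lie, map_zero, smul_zero, add_zero, zero_add]

lemma lam₂₂ (h : IsTwoSummand Q 𝔨 𝔭₁ 𝔭₂) (u : ℝ) {X Y : 𝔤} (hX : X ∈ 𝔭₂) (hY : Y ∈ 𝔭₂) :
    lam Q 𝔭₁ 𝔭₂ u X Y = (1 / 2 : ℝ) • (orthProj Q 𝔭₁ ⁅X, Y⁆ + orthProj Q 𝔭₂ ⁅X, Y⁆) := by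
  simp only [lam, h.proj₁_of_mem₂ hX, h.proj₁_of_mem₂ hY, h.proj₂_of_mem₂ hX, h.proj₂_of_mem₂ hY,
    lie_zero, zero_lie, map_zero, smul_zero, zero_add]

lemma apply_lie_proj_lie (h : IsTwoSummand Q 𝔨 𝔭₁ 𝔭₂) (W : Submodule ℝ 𝔤) (e Y Z : 𝔤) :
    Q ⁅Y, orthProj Q W ⁅e, Z⁆⁆ e = Q (orthProj Q W ⁅e, Y⁆) (orthProj Q W ⁅e, Z⁆) := by
  rw [h.lie_apply_cyc, h.lie_apply_cyc, h.inner.symm, h.inner.orthProj_apply, h.inner.symm]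

lemma apply_proj_lie_lie (h : IsTwoSummand Q 𝔨 𝔭₁ 𝔭₂) (W : Submodule ℝ 𝔤) (e Y Z : 𝔤) :
    Q ⁅orthProj Q W ⁅e, Y⁆, Z⁆ e = - Q (orthProj Q W ⁅e, Y⁆) (orthProj Q W ⁅e, Z⁆) := by
  rw [h.lie_apply_cyc, ← lie_skew, map_neg, LinearMap.neg_apply, h.inner.symm,
    h.inner.orthProj_apply]

/-- The contribution of a vector `e` of an orthonormal basis to the Ricci curvature, for `e` and the
arguments in `𝔭₁`; the following lemmas treat the other positions of `e` (first index) and of the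
arguments (second index). -/
lemma curv_apply₁₁ (h : IsTwoSummand Q 𝔨 𝔭₁ 𝔭₂) (u : ℝ) {e Y Z : 𝔤} (he : e ∈ 𝔭₁)
    (hY : Y ∈ 𝔭₁) (hZ : Z ∈ 𝔭₁) :
    Q (curv Q 𝔨 𝔭₁ 𝔭₂ u e Y Z) e =
      1 / 4 * Q (orthProj Q 𝔭₁ ⁅e, Y⁆) (orthProj Q 𝔭₁ ⁅e, Z⁆) +
        Q (orthProj Q 𝔨 ⁅e, Y⁆) (orthProj Q 𝔨 ⁅e, Z⁆) := by
  rw [curv, h.lam₁₁ u hY hZ, h.lam₁₁ u he hZ, lam_smul_right, lam_smul_right,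
    h.lam₁₁ u he (orthProj_mem _ _), h.lam₁₁ u hY (orthProj_mem _ _), h.proj₂_lie₁₁ he hY,
    add_zero, h.lam₁₁ u (orthProj_mem _ _) hZ]
  simp only [map_sub, map_smul, LinearMap.sub_apply, LinearMap.smul_apply, smul_eq_mul,
    h.inner.orthProj_apply_of_mem he, h.lie_apply_self, h.apply_lie_proj_lie, h.apply_proj_lie_lie]
  ring

lemma curv_apply₂₁ (h : IsTwoSummand Q 𝔨 𝔭₁ 𝔭₂) (u : ℝ) {e Y Z : 𝔤} (he : e ∈ 𝔭₂)
    (hY : Y ∈ 𝔭₁) (hZ : Z ∈ 𝔭₁) :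
    Q (curv Q 𝔨 𝔭₁ 𝔭₂ u e Y Z) e = u ^ 2 / 4 * Q ⁅e, Y⁆ ⁅e, Z⁆ := by
  have h1 := h.lie₂₁ he hY
  have h2 := h.lie₂₁ he hZ
  have e1 := h.apply_lie_proj_lie 𝔭₂ e Y Z
  have e2 := h.apply_proj_lie_lie 𝔭₂ e Y Z
  rw [h.proj₂_of_mem₂ h1, h.proj₂_of_mem₂ h2] at e1 e2
  rw [curv, h.lam₁₁ u hY hZ, h.lam₂₁ u he hZ, lam_smul_right, lam_smul_right,
    h.lam₂₁ u he (orthProj_mem _ _), h.lam₁₂ u hY h2, h.proj₁_of_mem₂ h1, h.proj₂_of_mem₂ h1,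
    zero_add, h.lam₂₁ u h1 hZ, h.proj₀_of_mem₂ h1, zero_lie]
  simp only [map_sub, map_smul, LinearMap.sub_apply, LinearMap.smul_apply, smul_eq_mul,
    h.lie_apply_self, e1, e2, map_zero, LinearMap.zero_apply]
  ring

lemma curv_apply₁₂ (h : IsTwoSummand Q 𝔨 𝔭₁ 𝔭₂) (u : ℝ) {e Y Z : 𝔤} (he : e ∈ 𝔭₁)
    (hY : Y ∈ 𝔭₂) (hZ : Z ∈ 𝔭₂) :
    Q (curv Q 𝔨 𝔭₁ 𝔭₂ u e Y Z) e = u / 4 * Q ⁅e, Y⁆ ⁅e, Z⁆ := by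
  have h1 := h.lie₁₂ he hY
  have h2 := h.lie₁₂ he hZ
  have e1 := h.apply_lie_proj_lie 𝔭₂ e Y Z
  have e2 := h.apply_proj_lie_lie 𝔭₂ e Y Z
  rw [h.proj₂_of_mem₂ h1, h.proj₂_of_mem₂ h2] at e1 e2
  have e3 : ∀ A, Q (orthProj Q 𝔭₂ A) e = 0 := fun A => by
    rw [h.inner.symm, h.orth₁₂ e he _ (orthProj_mem _ _)]
  rw [curv, h.lam₂₂ u hY hZ, h.lam₁₂ u he hZ, lam_smul_right, lam_smul_right, lam_add_right,
    h.lam₁₁ u he (orthProj_mem _ _), h.lam₁₂ u he (orthProj_mem _ _), h.lam₂₂ u hY h2,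
    h.proj₁_of_mem₂ h1, h.proj₂_of_mem₂ h1,
    zero_add, h.lam₂₂ u h1 hZ, h.proj₀_of_mem₂ h1, zero_lie]
  simp only [map_sub, map_add, map_smul, LinearMap.sub_apply, LinearMap.add_apply,
    LinearMap.smul_apply, smul_eq_mul, h.inner.orthProj_apply_of_mem he,
    h.lie_apply_self, e1, e2, e3, map_zero, LinearMap.zero_apply]
  ring

lemma curv_apply₂₂ (h : IsTwoSummand Q 𝔨 𝔭₁ 𝔭₂) (u : ℝ) {e Y Z : 𝔤} (he : e ∈ 𝔭₂)
    (hY : Y ∈ 𝔭₂) (hZ : Z ∈ 𝔭₂) :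
    Q (curv Q 𝔨 𝔭₁ 𝔭₂ u e Y Z) e =
      (1 - 3 * u / 4) * Q (orthProj Q 𝔭₁ ⁅e, Y⁆) (orthProj Q 𝔭₁ ⁅e, Z⁆) +
        1 / 4 * Q (orthProj Q 𝔭₂ ⁅e, Y⁆) (orthProj Q 𝔭₂ ⁅e, Z⁆) +
        Q (orthProj Q 𝔨 ⁅e, Y⁆) (orthProj Q 𝔨 ⁅e, Z⁆) := by
  have e3 : ∀ A, Q (orthProj Q 𝔭₁ A) e = 0 := fun A => h.orth₁₂ _ (orthProj_mem _ _) e he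
  rw [curv, h.lam₂₂ u hY hZ, h.lam₂₂ u he hZ, lam_smul_right, lam_smul_right, lam_add_right,
    lam_add_right, lam_add_left, h.lam₂₁ u he (orthProj_mem _ _), h.lam₂₂ u he (orthProj_mem _ _),
    h.lam₂₁ u hY (orthProj_mem _ _), h.lam₂₂ u hY (orthProj_mem _ _),
    h.lam₁₂ u (orthProj_mem _ _) hZ, h.lam₂₂ u (orthProj_mem _ _) hZ]
  simp only [map_sub, map_add, map_smul, LinearMap.sub_apply, LinearMap.add_apply,
    LinearMap.smul_apply, smul_eq_mul, h.inner.orthProj_apply_of_mem he,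
    h.lie_apply_self, e3, h.apply_lie_proj_lie, h.apply_proj_lie_lie]
  ring

end IsTwoSummand
end PointwiseCurvature

/-! ### Orthonormal bases -/

section Orthonormal

variable {V ι : Type*} [AddCommGroup V] [Module ℝ V] [Fintype ι] {g : LinearMap.BilinForm ℝ V}

lemma IsOrthonormal.repr_apply {b : Module.Basis ι ℝ V} (hb : IsOrthonormal g b) (X : V) (i : ι) :
    b.repr X i = g X (b i) := by
  classical
  conv_rhs => rw [← b.sum_repr X]
  rw [map_sum, LinearMap.sum_apply, Finset.sum_eq_single i]
  · rw [map_smul, LinearMap.smul_apply, hb.1, smul_eq_mul, mul_one]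
  · intro j _ hj
    rw [map_smul, LinearMap.smul_apply, hb.2 j i hj, smul_zero]
  · simp

lemma IsOrthonormal.sum_apply_smul {b : Module.Basis ι ℝ V} (hb : IsOrthonormal g b) (X : V) :
    ∑ i, g X (b i) • b i = X := by
  simp only [← hb.repr_apply, b.sum_repr]

lemma IsOrthonormal.trace_eq {b : Module.Basis ι ℝ V} (hb : IsOrthonormal g b) (F : V →ₗ[ℝ] V) :
    LinearMap.trace ℝ V F = ∑ i, g (F (b i)) (b i) := by
  classical
  rw [LinearMap.trace_eq_matrix_trace ℝ b, Matrix.trace]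
  exact Finset.sum_congr rfl fun i _ => by
    rw [Matrix.diag_apply, LinearMap.toMatrix_apply, hb.repr_apply]

lemma IsOrthonormal.sum_apply_mul_apply {b : Module.Basis ι ℝ V} (hb : IsOrthonormal g b)
    (X Y : V) : ∑ i, g X (b i) * g Y (b i) = g Y X := by
  conv_rhs => rw [← hb.sum_apply_smul X, map_sum]
  exact Finset.sum_congr rfl fun i _ => by rw [map_smul, smul_eq_mul]

/-- Parseval's identity for the orthogonal projection onto a subspace. -/
lemma IsInner.sum_apply_mul_apply [FiniteDimensional ℝ V] {Q : LinearMap.BilinForm ℝ V}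
    (hQ : IsInner Q) {W : Submodule ℝ V} {b : Module.Basis ι ℝ W}
    (hb : IsOrthonormal Q fun i => (b i : V)) (X Y : V) :
    ∑ i, Q X (b i) * Q Y (b i) = Q (orthProj Q W X) (orthProj Q W Y) := by
  have hb' : IsOrthonormal (Q.restrict W) b := hb
  have := hb'.sum_apply_mul_apply ⟨orthProj Q W Y, orthProj_mem W Y⟩
    ⟨orthProj Q W X, orthProj_mem W X⟩
  refine Eq.trans (Finset.sum_congr rfl fun i _ => ?_) this
  change _ = Q (orthProj Q W Y) (b i) * Q (orthProj Q W X) (b i)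
  rw [hQ.orthProj_apply_of_mem (b i).2, hQ.orthProj_apply_of_mem (b i).2, mul_comm]

/-- Bases of two complementary subspaces of `W` form a basis of `W`. -/
lemma exists_basis_sup {V ι κ : Type*} [AddCommGroup V] [Module ℝ V] {W₁ W₂ W : Submodule ℝ V}
    (hW : W₁ ⊔ W₂ = W)
    (hd : Disjoint W₁ W₂) (b₁ : Module.Basis ι ℝ W₁) (b₂ : Module.Basis κ ℝ W₂) :
    ∃ b : Module.Basis (ι ⊕ κ) ℝ W, (∀ i, (b (Sum.inl i) : V) = b₁ i) ∧
      ∀ i, (b (Sum.inr i) : V) = b₂ i := by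
  subst hW
  let f : W₁ × W₂ →ₗ[ℝ] ↥(W₁ ⊔ W₂) :=
    (Submodule.inclusion le_sup_left).coprod (Submodule.inclusion le_sup_right)
  have hf : ∀ p, (f p : V) = p.1 + p.2 := fun p => rfl
  have hinj : Function.Injective f := by
    rw [injective_iff_map_eq_zero]
    rintro ⟨A, B⟩ h
    have h0 : (A : V) + B = 0 := congrArg Subtype.val h
    have hA : (A : V) = 0 := Submodule.disjoint_def.1 hd A A.2
      (by rw [eq_neg_of_add_eq_zero_left h0]; exact neg_mem B.2)
    have hB : (B : V) = 0 := by rwa [hA, zero_add] at h0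
    exact Prod.ext (Subtype.ext hA) (Subtype.ext hB)
  have hsurj : Function.Surjective f := by
    rintro ⟨X, hX⟩
    obtain ⟨A, hA, B, hB, rfl⟩ := Submodule.mem_sup.1 hX
    exact ⟨(⟨A, hA⟩, ⟨B, hB⟩), rfl⟩
  have hbij : Function.Bijective f := ⟨hinj, hsurj⟩
  refine ⟨(b₁.prod b₂).map (LinearEquiv.ofBijective f hbij), fun i => ?_, fun i => ?_⟩
  · rw [Module.Basis.map_apply, LinearEquiv.ofBijective_apply, hf]
    simp
  · rw [Module.Basis.map_apply, LinearEquiv.ofBijective_apply, hf]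
    simp

end Orthonormal

/-! ### The Ricci tensor and the structure constants -/

section Ricci

set_option linter.unusedSectionVars false

variable {𝔤 : Type*} [LieRing 𝔤] [LieAlgebra ℝ 𝔤] {Q : LinearMap.BilinForm ℝ 𝔤}
  {𝔨 𝔭₁ 𝔭₂ 𝔭 : Submodule ℝ 𝔤}

lemma curvature_add₂ (g : LinearMap.BilinForm ℝ 𝔭) (X Y Y' Z : 𝔭) :
    curvature 𝔨 𝔭 g X (Y + Y') Z = curvature 𝔨 𝔭 g X Y Z + curvature 𝔨 𝔭 g X Y' Z := by
  simp only [curvature, map_add, LinearMap.add_apply, Submodule.coe_add, lie_add, add_lie, sub_lie,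
    map_sub]
  abel

lemma curvature_smul₂ (g : LinearMap.BilinForm ℝ 𝔭) (c : ℝ) (X Y Z : 𝔭) :
    curvature 𝔨 𝔭 g X (c • Y) Z = c • curvature 𝔨 𝔭 g X Y Z := by
  simp only [curvature, map_smul, LinearMap.smul_apply, Submodule.coe_smul, lie_smul, smul_lie,
    sub_lie, map_sub, smul_sub]

lemma curvature_add₃ (g : LinearMap.BilinForm ℝ 𝔭) (X Y Z Z' : 𝔭) :
    curvature 𝔨 𝔭 g X Y (Z + Z') = curvature 𝔨 𝔭 g X Y Z + curvature 𝔨 𝔭 g X Y Z' := by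
  simp only [curvature, map_add, Submodule.coe_add, lie_add]
  abel

lemma curvature_smul₃ (g : LinearMap.BilinForm ℝ 𝔭) (c : ℝ) (X Y Z : 𝔭) :
    curvature 𝔨 𝔭 g X Y (c • Z) = c • curvature 𝔨 𝔭 g X Y Z := by
  simp only [curvature, map_smul, Submodule.coe_smul, lie_smul, smul_sub]

/-- The Ricci tensor as a bilinear form. -/
def ricciForm (𝔨 𝔭 : Submodule ℝ 𝔤) (g : LinearMap.BilinForm ℝ 𝔭) : LinearMap.BilinForm ℝ 𝔭 :=
  LinearMap.mk₂ ℝ (ricci 𝔨 𝔭 g)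
    (fun Y Y' Z => by
      simp only [ricci, ← map_add]
      congr 1
      ext1 X
      exact curvature_add₂ g X Y Y' Z)
    (fun c Y Z => by
      simp only [ricci, ← map_smul]
      congr 1
      ext1 X
      exact curvature_smul₂ g c X Y Z)
    (fun Y Z Z' => by
      simp only [ricci, ← map_add]
      congr 1
      ext1 X
      exact curvature_add₃ g X Y Z Z')
    (fun c Y Z => by
      simp only [ricci, ← map_smul]
      congr 1
      ext1 X
      exact curvature_smul₃ g c X Y Z)

lemma ricciForm_apply (g : LinearMap.BilinForm ℝ 𝔭) (Y Z : 𝔭) :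
    ricciForm 𝔨 𝔭 g Y Z = ricci 𝔨 𝔭 g Y Z := rfl

lemma ricci_eq_sum {ι : Type*} [Fintype ι] {g₀ : LinearMap.BilinForm ℝ 𝔭}
    {b : Module.Basis ι ℝ 𝔭} (hb : IsOrthonormal g₀ b) (g : LinearMap.BilinForm ℝ 𝔭) (Y Z : 𝔭) :
    ricci 𝔨 𝔭 g Y Z = ∑ i, g₀ (curvature 𝔨 𝔭 g (b i) Y Z) (b i) := by
  rw [ricci, hb.trace_eq]
  rfl

namespace IsTwoSummand

variable [FiniteDimensional ℝ 𝔤] {x₁ x₂ : ℝ}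

lemma ricci_eq_sum_curv (h : IsTwoSummand Q 𝔨 𝔭₁ 𝔭₂) (h𝔭 : 𝔭₁ ⊔ 𝔭₂ = 𝔭)
    (hx₁ : 0 < x₁) (hx₂ : 0 < x₂) {ι : Type*} [Fintype ι]
    {b : Module.Basis ι ℝ 𝔭} (hb : IsOrthonormal Q fun i => (b i : 𝔤)) (Y Z : 𝔭) :
    ricci 𝔨 𝔭 (diagMetric Q 𝔭₁ 𝔭₂ 𝔭 x₁ x₂) Y Z =
      ∑ i, Q (curv Q 𝔨 𝔭₁ 𝔭₂ (x₁ / x₂) (b i) Y Z) (b i) := by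
  rw [ricci_eq_sum (g₀ := Q.restrict 𝔭) hb]
  refine Finset.sum_congr rfl fun i _ => ?_
  rw [← h.coe_curvature h𝔭 hx₁ hx₂]
  rfl

lemma exists_orthonormal_basis (h : IsTwoSummand Q 𝔨 𝔭₁ 𝔭₂) (h𝔭 : 𝔭₁ ⊔ 𝔭₂ = 𝔭) {d₁ d₂ : ℕ}
    {e₁ : Module.Basis (Fin d₁) ℝ 𝔭₁} {e₂ : Module.Basis (Fin d₂) ℝ 𝔭₂}
    (he₁ : IsOrthonormal Q fun i => (e₁ i : 𝔤)) (he₂ : IsOrthonormal Q fun i => (e₂ i : 𝔤)) :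
    ∃ b : Module.Basis (Fin d₁ ⊕ Fin d₂) ℝ 𝔭, IsOrthonormal Q (fun i => (b i : 𝔤)) ∧
      (∀ i, (b (Sum.inl i) : 𝔤) = e₁ i) ∧ ∀ i, (b (Sum.inr i) : 𝔤) = e₂ i := by
  obtain ⟨b, hb₁, hb₂⟩ := exists_basis_sup h𝔭 (Submodule.disjoint_def.2 fun X hX hX' =>
    h.inner.eq_zero (h.orth₁₂ X hX X hX')) e₁ e₂
  refine ⟨b, ⟨?_, ?_⟩, hb₁, hb₂⟩
  · rintro (i | i)
    · simpa only [hb₁] using he₁.1 i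
    · simpa only [hb₂] using he₂.1 i
  · rintro (i | i) (j | j) hij
    · simpa only [hb₁] using he₁.2 i j (fun e => hij (by rw [e]))
    · simpa only [hb₁, hb₂] using h.orth₁₂ _ (e₁ i).2 _ (e₂ j).2
    · simpa only [hb₁, hb₂, h.inner.symm (e₂ i : 𝔤)] using h.orth₁₂ _ (e₁ j).2 _ (e₂ i).2
    · simpa only [hb₂] using he₂.2 i j (fun e => hij (by rw [e]))

section Sums

variable {d₁ d₂ : ℕ} {e₁ : Module.Basis (Fin d₁) ℝ 𝔭₁} {e₂ : Module.Basis (Fin d₂) ℝ 𝔭₂}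

/-- The Ricci tensor of the diagonal metrics on `𝔭₁`, as a sum over a `Q`-orthonormal basis. -/
lemma ricci_eq₁ (h : IsTwoSummand Q 𝔨 𝔭₁ 𝔭₂) (h𝔭 : 𝔭₁ ⊔ 𝔭₂ = 𝔭) (hx₁ : 0 < x₁) (hx₂ : 0 < x₂)
    (he₁ : IsOrthonormal Q fun i => (e₁ i : 𝔤)) (he₂ : IsOrthonormal Q fun i => (e₂ i : 𝔤))
    {Y Z : 𝔭} (hY : (Y : 𝔤) ∈ 𝔭₁) (hZ : (Z : 𝔤) ∈ 𝔭₁) :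
    ricci 𝔨 𝔭 (diagMetric Q 𝔭₁ 𝔭₂ 𝔭 x₁ x₂) Y Z =
      ∑ i, (1 / 4 * Q (orthProj Q 𝔭₁ ⁅(e₁ i : 𝔤), (Y : 𝔤)⁆) (orthProj Q 𝔭₁ ⁅(e₁ i : 𝔤), (Z : 𝔤)⁆) +
        Q (orthProj Q 𝔨 ⁅(e₁ i : 𝔤), (Y : 𝔤)⁆) (orthProj Q 𝔨 ⁅(e₁ i : 𝔤), (Z : 𝔤)⁆)) +
      ∑ j, (x₁ / x₂) ^ 2 / 4 * Q ⁅(e₂ j : 𝔤), (Y : 𝔤)⁆ ⁅(e₂ j : 𝔤), (Z : 𝔤)⁆ := by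
  obtain ⟨b, hb, hb₁, hb₂⟩ := h.exists_orthonormal_basis h𝔭 he₁ he₂
  rw [h.ricci_eq_sum_curv h𝔭 hx₁ hx₂ hb, Fintype.sum_sum_type]
  simp only [hb₁, hb₂, h.curv_apply₁₁ _ (e₁ _).2 hY hZ, h.curv_apply₂₁ _ (e₂ _).2 hY hZ]

/-- The Ricci tensor of the diagonal metrics on `𝔭₂`, as a sum over a `Q`-orthonormal basis. -/
lemma ricci_eq₂ (h : IsTwoSummand Q 𝔨 𝔭₁ 𝔭₂) (h𝔭 : 𝔭₁ ⊔ 𝔭₂ = 𝔭) (hx₁ : 0 < x₁) (hx₂ : 0 < x₂)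
    (he₁ : IsOrthonormal Q fun i => (e₁ i : 𝔤)) (he₂ : IsOrthonormal Q fun i => (e₂ i : 𝔤))
    {Y Z : 𝔭} (hY : (Y : 𝔤) ∈ 𝔭₂) (hZ : (Z : 𝔤) ∈ 𝔭₂) :
    ricci 𝔨 𝔭 (diagMetric Q 𝔭₁ 𝔭₂ 𝔭 x₁ x₂) Y Z =
      ∑ i, x₁ / x₂ / 4 * Q ⁅(e₁ i : 𝔤), (Y : 𝔤)⁆ ⁅(e₁ i : 𝔤), (Z : 𝔤)⁆ +
      ∑ j, ((1 - 3 * (x₁ / x₂) / 4) *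
          Q (orthProj Q 𝔭₁ ⁅(e₂ j : 𝔤), (Y : 𝔤)⁆) (orthProj Q 𝔭₁ ⁅(e₂ j : 𝔤), (Z : 𝔤)⁆) +
        1 / 4 * Q (orthProj Q 𝔭₂ ⁅(e₂ j : 𝔤), (Y : 𝔤)⁆) (orthProj Q 𝔭₂ ⁅(e₂ j : 𝔤), (Z : 𝔤)⁆) +
        Q (orthProj Q 𝔨 ⁅(e₂ j : 𝔤), (Y : 𝔤)⁆) (orthProj Q 𝔨 ⁅(e₂ j : 𝔤), (Z : 𝔤)⁆)) := by
  obtain ⟨b, hb, hb₁, hb₂⟩ := h.exists_orthonormal_basis h𝔭 he₁ he₂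
  rw [h.ricci_eq_sum_curv h𝔭 hx₁ hx₂ hb, Fintype.sum_sum_type]
  simp only [hb₁, hb₂, h.curv_apply₁₂ _ (e₁ _).2 hY hZ, h.curv_apply₂₂ _ (e₂ _).2 hY hZ]

lemma structConst₁₁₁ (h : IsTwoSummand Q 𝔨 𝔭₁ 𝔭₂)
    (he₁ : IsOrthonormal Q fun i => (e₁ i : 𝔤)) :
    structConst Q (fun i => (e₁ i : 𝔤)) (fun i => (e₁ i : 𝔤)) (fun i => (e₁ i : 𝔤)) =
      ∑ k, ∑ i, Q (orthProj Q 𝔭₁ ⁅(e₁ i : 𝔤), (e₁ k : 𝔤)⁆)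
        (orthProj Q 𝔭₁ ⁅(e₁ i : 𝔤), (e₁ k : 𝔤)⁆) := by
  rw [structConst, Finset.sum_comm]
  simp only [← h.inner.sum_apply_mul_apply he₁, sq]

lemma structConst₁₂₂ (h : IsTwoSummand Q 𝔨 𝔭₁ 𝔭₂)
    (he₂ : IsOrthonormal Q fun i => (e₂ i : 𝔤)) :
    structConst Q (fun i => (e₁ i : 𝔤)) (fun i => (e₂ i : 𝔤)) (fun i => (e₂ i : 𝔤)) =
      ∑ i, ∑ j, Q ⁅(e₁ i : 𝔤), (e₂ j : 𝔤)⁆ ⁅(e₁ i : 𝔤), (e₂ j : 𝔤)⁆ := by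
  rw [structConst]
  refine Finset.sum_congr rfl fun i _ => Finset.sum_congr rfl fun j _ => ?_
  have := h.inner.sum_apply_mul_apply he₂ ⁅(e₁ i : 𝔤), (e₂ j : 𝔤)⁆ ⁅(e₁ i : 𝔤), (e₂ j : 𝔤)⁆
  rw [h.proj₂_of_mem₂ (h.lie₁₂ (e₁ i).2 (e₂ j).2)] at this
  simpa only [sq] using this

/-- The constant `[122]`, written as `[221]`: the structure constants are symmetric. -/
lemma structConst₁₂₂' (h : IsTwoSummand Q 𝔨 𝔭₁ 𝔭₂)
    (he₁ : IsOrthonormal Q fun i => (e₁ i : 𝔤)) :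
    structConst Q (fun i => (e₁ i : 𝔤)) (fun i => (e₂ i : 𝔤)) (fun i => (e₂ i : 𝔤)) =
      ∑ k, ∑ j, Q (orthProj Q 𝔭₁ ⁅(e₂ j : 𝔤), (e₂ k : 𝔤)⁆)
        (orthProj Q 𝔭₁ ⁅(e₂ j : 𝔤), (e₂ k : 𝔤)⁆) := by
  have e : ∀ i j k, Q ⁅(e₁ i : 𝔤), (e₂ j : 𝔤)⁆ (e₂ k) = Q ⁅(e₂ j : 𝔤), (e₂ k : 𝔤)⁆ (e₁ i) :=
    fun i j k => h.lie_apply_cyc _ _ _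
  simp only [structConst, ← h.inner.sum_apply_mul_apply he₁, e, sq]
  rw [Finset.sum_comm]
  conv_rhs => rw [Finset.sum_comm]
  exact Finset.sum_congr rfl fun j _ => Finset.sum_comm

end Sums
end IsTwoSummand
end Ricci

/-! ### The Killing form and the traces of the Ricci tensor -/

section RicciScalars

set_option linter.unusedSectionVars false

variable {𝔤 : Type*} [LieRing 𝔤] [LieAlgebra ℝ 𝔤] {Q : LinearMap.BilinForm ℝ 𝔤}
  {𝔨 𝔭₁ 𝔭₂ 𝔭 : Submodule ℝ 𝔤}

lemma apply_lie_skew (X Y : 𝔤) : Q ⁅X, Y⁆ ⁅X, Y⁆ = Q ⁅Y, X⁆ ⁅Y, X⁆ := by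
  rw [← lie_skew X Y]
  simp only [map_neg, LinearMap.neg_apply, neg_neg]

namespace IsTwoSummand

variable [FiniteDimensional ℝ 𝔤] {x₁ x₂ : ℝ}
  {d₁ d₂ : ℕ} {e₁ : Module.Basis (Fin d₁) ℝ 𝔭₁} {e₂ : Module.Basis (Fin d₂) ℝ 𝔭₂}

lemma apply_eq_sum_proj (h : IsTwoSummand Q 𝔨 𝔭₁ 𝔭₂) (X : 𝔤) : Q X X =
    Q (orthProj Q 𝔨 X) (orthProj Q 𝔨 X) + (Q (orthProj Q 𝔭₁ X) (orthProj Q 𝔭₁ X) +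
      Q (orthProj Q 𝔭₂ X) (orthProj Q 𝔭₂ X)) := by
  conv_lhs => rw [← h.sum_proj X]
  simp only [map_add, LinearMap.add_apply, h.orth₀₁ _ (orthProj_mem _ _) _ (orthProj_mem _ _),
    h.orth₀₂ _ (orthProj_mem _ _) _ (orthProj_mem _ _),
    h.orth₁₂ _ (orthProj_mem _ _) _ (orthProj_mem _ _),
    h.inner.symm (orthProj Q 𝔭₁ X) (orthProj Q 𝔨 X),
    h.inner.symm (orthProj Q 𝔭₂ X) (orthProj Q 𝔨 X),
    h.inner.symm (orthProj Q 𝔭₂ X) (orthProj Q 𝔭₁ X)]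
  ring

/-- The Killing form on `𝔭₁`, evaluated on an orthonormal basis adapted to `𝔨 ⊕ 𝔭₁ ⊕ 𝔭₂`. -/
lemma neg_killingForm_eq (h : IsTwoSummand Q 𝔨 𝔭₁ 𝔭₂)
    (he₁ : IsOrthonormal Q fun i => (e₁ i : 𝔤)) (he₂ : IsOrthonormal Q fun i => (e₂ i : 𝔤))
    {X : 𝔤} (hX : X ∈ 𝔭₁) :
    -killingForm ℝ 𝔤 X X =
      ∑ i, (2 * Q (orthProj Q 𝔨 ⁅(e₁ i : 𝔤), X⁆) (orthProj Q 𝔨 ⁅(e₁ i : 𝔤), X⁆) +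
        Q (orthProj Q 𝔭₁ ⁅(e₁ i : 𝔤), X⁆) (orthProj Q 𝔭₁ ⁅(e₁ i : 𝔤), X⁆)) +
      ∑ j, Q ⁅(e₂ j : 𝔤), X⁆ ⁅(e₂ j : 𝔤), X⁆ := by
  obtain ⟨f, hf⟩ := HomogeneousRicci.exists_orthonormal_basis (h.inner.restrict 𝔨)
  have hf' : IsOrthonormal Q fun i => (f i : 𝔤) := hf
  obtain ⟨b, hb, hb₁, hb₂⟩ := h.exists_orthonormal_basis rfl he₁ he₂
  obtain ⟨c, hc₁, hc₂⟩ := exists_basis_sup h.span (h.isCompl rfl).disjoint.symm f b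
  have horth : ∀ i j, Q (f i : 𝔤) (b j) = 0 := by
    rintro i (j | j)
    · rw [hb₁, h.orth₀₁ _ (f i).2 _ (e₁ j).2]
    · rw [hb₂, h.orth₀₂ _ (f i).2 _ (e₂ j).2]
  have hc : IsOrthonormal Q (c.map Submodule.topEquiv) := by
    constructor
    · rintro (i | i)
      · simpa [hc₁] using hf'.1 i
      · simpa [hc₂] using hb.1 i
    · rintro (i | i) (j | j) hij
      · simpa [hc₁] using hf'.2 i j (fun e => hij (by rw [e]))
      · simpa [hc₁, hc₂] using horth i j
      · simpa [hc₁, hc₂, h.inner.symm (b i : 𝔤)] using horth j i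
      · simpa [hc₂] using hb.2 i j (fun e => hij (by rw [e]))
  -- minus the Killing form is the sum of the squared lengths of `[Z, X]` over the basis
  have hterm : ∀ Z : 𝔤, Q ⁅X, ⁅X, Z⁆⁆ Z = - Q ⁅Z, X⁆ ⁅Z, X⁆ := fun Z => by
    rw [h.lie_apply_eq, apply_lie_skew]
  -- by cyclic symmetry, the part of the sum over `𝔨` equals the `𝔨`-part of the sum over `𝔭₁`
  have hK : ∑ i, Q ⁅(f i : 𝔤), X⁆ ⁅(f i : 𝔤), X⁆ =
      ∑ i, Q (orthProj Q 𝔨 ⁅(e₁ i : 𝔤), X⁆) (orthProj Q 𝔨 ⁅(e₁ i : 𝔤), X⁆) := by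
    simp only [← h.inner.sum_apply_mul_apply hf']
    rw [Finset.sum_comm]
    refine Finset.sum_congr rfl fun i _ => ?_
    have h1 := h.inner.sum_apply_mul_apply he₁ ⁅(f i : 𝔤), X⁆ ⁅(f i : 𝔤), X⁆
    rw [h.proj₁_of_mem₁ (h.lie₀₁ _ (f i).2 _ hX)] at h1
    rw [← h1]
    refine Finset.sum_congr rfl fun j _ => ?_
    have : Q ⁅(f i : 𝔤), X⁆ (e₁ j) = - Q ⁅(e₁ j : 𝔤), X⁆ (f i) := by
      rw [h.lie_apply_cyc, ← lie_skew, map_neg, LinearMap.neg_apply]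
    rw [this]
    ring
  have hL : killingForm ℝ 𝔤 X X = ∑ i, Q ⁅X, ⁅X, c.map Submodule.topEquiv i⁆⁆
      (c.map Submodule.topEquiv i) := by
    rw [killingForm, LieModule.traceForm_apply_apply, hc.trace_eq]
    rfl
  have h11 : ∀ i, Q ⁅(e₁ i : 𝔤), X⁆ ⁅(e₁ i : 𝔤), X⁆ =
      Q (orthProj Q 𝔨 ⁅(e₁ i : 𝔤), X⁆) (orthProj Q 𝔨 ⁅(e₁ i : 𝔤), X⁆) +
        Q (orthProj Q 𝔭₁ ⁅(e₁ i : 𝔤), X⁆) (orthProj Q 𝔭₁ ⁅(e₁ i : 𝔤), X⁆) := fun i => by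
    rw [h.apply_eq_sum_proj, h.proj₂_lie₁₁ (e₁ i).2 hX, map_zero, add_zero]
  rw [hL]
  simp only [hterm, Finset.sum_neg_distrib, neg_neg, Fintype.sum_sum_type, Module.Basis.map_apply,
    Submodule.topEquiv_apply, hc₁, hc₂, hb₁, hb₂, hK, h11, Finset.sum_add_distrib,
    ← Finset.mul_sum]
  ring

/-- If the Ricci curvature is a multiple of `Q` on `𝔭₁`, the factor is found by taking the trace. -/
lemma ricci_factor₁ (h : IsTwoSummand Q 𝔨 𝔭₁ 𝔭₂) (h𝔭 : 𝔭₁ ⊔ 𝔭₂ = 𝔭) (hx₁ : 0 < x₁) (hx₂ : 0 < x₂)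
    (he₁ : IsOrthonormal Q fun i => (e₁ i : 𝔤)) (he₂ : IsOrthonormal Q fun i => (e₂ i : 𝔤))
    (hd₁ : 0 < d₁) {b₁ : ℝ} (hb₁ : ∀ X ∈ 𝔭₁, -killingForm ℝ 𝔤 X X = b₁ * Q X X) {c : ℝ}
    (hc : ∀ X : 𝔭, (X : 𝔤) ∈ 𝔭₁ →
      ricci 𝔨 𝔭 (diagMetric Q 𝔭₁ 𝔭₂ 𝔭 x₁ x₂) X X = c * Q (X : 𝔤) X) :
    2 * c = (b₁ - structConst Q (fun i => (e₁ i : 𝔤)) (fun i => (e₁ i : 𝔤))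
        (fun i => (e₁ i : 𝔤)) / (2 * d₁) -
      structConst Q (fun i => (e₁ i : 𝔤)) (fun i => (e₂ i : 𝔤)) (fun i => (e₂ i : 𝔤)) / d₁) +
      structConst Q (fun i => (e₁ i : 𝔤)) (fun i => (e₂ i : 𝔤)) (fun i => (e₂ i : 𝔤)) /
        (2 * d₁) * (x₁ / x₂) ^ 2 := by
  have hmem : ∀ k, (e₁ k : 𝔤) ∈ 𝔭 := fun k => h𝔭.le (Submodule.mem_sup_left (e₁ k).2)
  -- the Killing form replaces the contribution of `𝔨`, which is not a structure constant of `𝔭`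
  have hk : ∀ k, c = 1 / 2 * b₁ -
      1 / 4 * ∑ i, Q (orthProj Q 𝔭₁ ⁅(e₁ i : 𝔤), (e₁ k : 𝔤)⁆)
        (orthProj Q 𝔭₁ ⁅(e₁ i : 𝔤), (e₁ k : 𝔤)⁆) +
      ((x₁ / x₂) ^ 2 / 4 - 1 / 2) * ∑ j, Q ⁅(e₁ k : 𝔤), (e₂ j : 𝔤)⁆ ⁅(e₁ k : 𝔤), (e₂ j : 𝔤)⁆ := by
    intro k
    have h1 := hc ⟨e₁ k, hmem k⟩ (e₁ k).2
    rw [h.ricci_eq₁ h𝔭 hx₁ hx₂ he₁ he₂ (Y := ⟨e₁ k, hmem k⟩) (Z := ⟨e₁ k, hmem k⟩) (e₁ k).2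
      (e₁ k).2] at h1
    have h2 := hb₁ _ (e₁ k).2
    rw [h.neg_killingForm_eq he₁ he₂ (e₁ k).2] at h2
    rw [he₁.1 k] at h1 h2
    simp only [apply_lie_skew (Q := Q) (e₁ k : 𝔤)]
    simp only [Finset.sum_add_distrib, ← Finset.mul_sum] at h1 h2
    linarith
  rw [h.structConst₁₁₁ he₁, h.structConst₁₂₂ he₂]
  -- summation over the basis of `𝔭₁` replaces the remaining sums by `[111]` and `[122]`
  have hsum := Finset.sum_congr (rfl : (Finset.univ : Finset (Fin d₁)) = _) fun k _ => hk k
  simp only [Finset.sum_add_distrib, Finset.sum_sub_distrib, ← Finset.mul_sum, Finset.sum_const,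
    Finset.card_univ, Fintype.card_fin, nsmul_eq_mul] at hsum
  have hd : (d₁ : ℝ) ≠ 0 := by positivity
  field_simp at hsum ⊢
  linarith

/-- If the Ricci curvature is a multiple of `Q` on `𝔭₂`, the factor is found by taking the trace;
only its dependence on the ratio `x₁ / x₂` matters. -/
lemma exists_ricci_factor₂ (h : IsTwoSummand Q 𝔨 𝔭₁ 𝔭₂) (h𝔭 : 𝔭₁ ⊔ 𝔭₂ = 𝔭)
    (he₁ : IsOrthonormal Q fun i => (e₁ i : 𝔤)) (he₂ : IsOrthonormal Q fun i => (e₂ i : 𝔤))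
    (hd₂ : 0 < d₂) :
    ∃ β : ℝ, ∀ x₁ x₂ c : ℝ, 0 < x₁ → 0 < x₂ →
      (∀ X : 𝔭, (X : 𝔤) ∈ 𝔭₂ →
        ricci 𝔨 𝔭 (diagMetric Q 𝔭₁ 𝔭₂ 𝔭 x₁ x₂) X X = c * Q (X : 𝔤) X) →
      2 * c = β - structConst Q (fun i => (e₁ i : 𝔤)) (fun i => (e₂ i : 𝔤))
        (fun i => (e₂ i : 𝔤)) / d₂ * (x₁ / x₂) := by
  set s := structConst Q (fun i => (e₁ i : 𝔤)) (fun i => (e₂ i : 𝔤)) (fun i => (e₂ i : 𝔤)) with hs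
  set t := ∑ k, ∑ j, (1 / 4 * Q (orthProj Q 𝔭₂ ⁅(e₂ j : 𝔤), (e₂ k : 𝔤)⁆)
    (orthProj Q 𝔭₂ ⁅(e₂ j : 𝔤), (e₂ k : 𝔤)⁆) + Q (orthProj Q 𝔨 ⁅(e₂ j : 𝔤), (e₂ k : 𝔤)⁆)
    (orthProj Q 𝔨 ⁅(e₂ j : 𝔤), (e₂ k : 𝔤)⁆)) with ht
  refine ⟨2 * (s + t) / d₂, fun x₁ x₂ c hx₁ hx₂ hc => ?_⟩
  have hmem : ∀ k, (e₂ k : 𝔤) ∈ 𝔭 := fun k => h𝔭.le (Submodule.mem_sup_right (e₂ k).2)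
  have hk : ∀ k, c = x₁ / x₂ / 4 * ∑ i, Q ⁅(e₁ i : 𝔤), (e₂ k : 𝔤)⁆ ⁅(e₁ i : 𝔤), (e₂ k : 𝔤)⁆ +
      (1 - 3 * (x₁ / x₂) / 4) * ∑ j, Q (orthProj Q 𝔭₁ ⁅(e₂ j : 𝔤), (e₂ k : 𝔤)⁆)
        (orthProj Q 𝔭₁ ⁅(e₂ j : 𝔤), (e₂ k : 𝔤)⁆) +
      ∑ j, (1 / 4 * Q (orthProj Q 𝔭₂ ⁅(e₂ j : 𝔤), (e₂ k : 𝔤)⁆)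
        (orthProj Q 𝔭₂ ⁅(e₂ j : 𝔤), (e₂ k : 𝔤)⁆) + Q (orthProj Q 𝔨 ⁅(e₂ j : 𝔤), (e₂ k : 𝔤)⁆)
        (orthProj Q 𝔨 ⁅(e₂ j : 𝔤), (e₂ k : 𝔤)⁆)) := by
    intro k
    have h1 := hc ⟨e₂ k, hmem k⟩ (e₂ k).2
    rw [h.ricci_eq₂ h𝔭 hx₁ hx₂ he₁ he₂ (Y := ⟨e₂ k, hmem k⟩) (Z := ⟨e₂ k, hmem k⟩) (e₂ k).2
      (e₂ k).2] at h1
    rw [he₂.1 k] at h1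
    simp only [Finset.sum_add_distrib, ← Finset.mul_sum] at h1 ⊢
    linarith
  have hsum := Finset.sum_congr (rfl : (Finset.univ : Finset (Fin d₂)) = _) fun k _ => hk k
  -- In the trace over `𝔭₂`, the sum `s = [122]` occurs with the factors `u / 4` and `1 - 3 u / 4`,
  -- where `u = x₁ / x₂`, and `t` does not depend on the metric.
  have hs1 : ∑ k, ∑ i, Q ⁅(e₁ i : 𝔤), (e₂ k : 𝔤)⁆ ⁅(e₁ i : 𝔤), (e₂ k : 𝔤)⁆ = s := by
    rw [hs, h.structConst₁₂₂ he₂, Finset.sum_comm]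
  have hs2 := h.structConst₁₂₂' (e₂ := e₂) he₁
  rw [← hs] at hs2
  rw [Finset.sum_add_distrib, Finset.sum_add_distrib, ← Finset.mul_sum, ← Finset.mul_sum, hs1,
    ← hs2, ← ht] at hsum
  simp only [Finset.sum_const, Finset.card_univ, Fintype.card_fin, nsmul_eq_mul] at hsum
  have hd : (d₂ : ℝ) ≠ 0 := by positivity
  field_simp at hsum ⊢
  linarith

end IsTwoSummand

/-! ### Symmetries of the decomposition -/

/-- `σ` is an isometric homomorphism which preserves the three summands. -/
structure IsSummandSymmetry (Q : LinearMap.BilinForm ℝ 𝔤) (𝔨 𝔭₁ 𝔭₂ : Submodule ℝ 𝔤)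
    (σ : 𝔤 →ₗ[ℝ] 𝔤) : Prop where
  isometry : ∀ X Y, Q (σ X) (σ Y) = Q X Y
  map_lie : ∀ X Y, σ ⁅X, Y⁆ = ⁅σ X, σ Y⁆
  map₀ : ∀ X ∈ 𝔨, σ X ∈ 𝔨
  map₁ : ∀ X ∈ 𝔭₁, σ X ∈ 𝔭₁
  map₂ : ∀ X ∈ 𝔭₂, σ X ∈ 𝔭₂

namespace IsSummandSymmetry

variable [FiniteDimensional ℝ 𝔤] {x₁ x₂ : ℝ} {σ : 𝔤 →ₗ[ℝ] 𝔤}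

lemma proj (hσ : IsSummandSymmetry Q 𝔨 𝔭₁ 𝔭₂ σ) (h : IsTwoSummand Q 𝔨 𝔭₁ 𝔭₂) (X : 𝔤) :
    orthProj Q 𝔨 (σ X) = σ (orthProj Q 𝔨 X) ∧ orthProj Q 𝔭₁ (σ X) = σ (orthProj Q 𝔭₁ X) ∧
      orthProj Q 𝔭₂ (σ X) = σ (orthProj Q 𝔭₂ X) := by
  have m₀ := hσ.map₀ _ (orthProj_mem (Q := Q) 𝔨 X)
  have m₁ := hσ.map₁ _ (orthProj_mem (Q := Q) 𝔭₁ X)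
  have m₂ := hσ.map₂ _ (orthProj_mem (Q := Q) 𝔭₂ X)
  have e : σ X = σ (orthProj Q 𝔨 X) + (σ (orthProj Q 𝔭₁ X) + σ (orthProj Q 𝔭₂ X)) := by
    rw [← map_add, ← map_add, h.sum_proj]
  rw [e]
  simp only [map_add, h.proj₀_of_mem₀ m₀, h.proj₀_of_mem₁ m₁, h.proj₀_of_mem₂ m₂,
    h.proj₁_of_mem₀ m₀, h.proj₁_of_mem₁ m₁, h.proj₁_of_mem₂ m₂,
    h.proj₂_of_mem₀ m₀, h.proj₂_of_mem₁ m₁, h.proj₂_of_mem₂ m₂, add_zero, zero_add, and_self]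

/-- The Levi-Civita connection is invariant under the symmetries of the decomposition. -/
lemma lam (hσ : IsSummandSymmetry Q 𝔨 𝔭₁ 𝔭₂ σ) (h : IsTwoSummand Q 𝔨 𝔭₁ 𝔭₂) (u : ℝ) (X Y : 𝔤) :
    lam Q 𝔭₁ 𝔭₂ u (σ X) (σ Y) = σ (lam Q 𝔭₁ 𝔭₂ u X Y) := by
  simp only [HomogeneousRicci.lam, (hσ.proj h _).2.1, (hσ.proj h _).2.2, ← hσ.map_lie, map_add,
    map_smul]

lemma curv (hσ : IsSummandSymmetry Q 𝔨 𝔭₁ 𝔭₂ σ) (h : IsTwoSummand Q 𝔨 𝔭₁ 𝔭₂) (u : ℝ)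
    (X Y Z : 𝔤) : IsTwoSummand.curv Q 𝔨 𝔭₁ 𝔭₂ u (σ X) (σ Y) (σ Z) =
      σ (IsTwoSummand.curv Q 𝔨 𝔭₁ 𝔭₂ u X Y Z) := by
  simp only [IsTwoSummand.curv, hσ.lam h, ← hσ.map_lie, (hσ.proj h _).1, (hσ.proj h _).2.1,
    (hσ.proj h _).2.2, ← map_add, map_sub]

lemma injective (hσ : IsSummandSymmetry Q 𝔨 𝔭₁ 𝔭₂ σ) (h : IsTwoSummand Q 𝔨 𝔭₁ 𝔭₂) :
    Function.Injective σ := by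
  rw [injective_iff_map_eq_zero]
  intro X hX
  refine h.inner.eq_zero ?_
  rw [← hσ.isometry, hX, map_zero]

/-- The Ricci tensor is invariant under the symmetries of the structure. -/
lemma ricci (hσ : IsSummandSymmetry Q 𝔨 𝔭₁ 𝔭₂ σ) (h : IsTwoSummand Q 𝔨 𝔭₁ 𝔭₂)
    (h𝔭 : 𝔭₁ ⊔ 𝔭₂ = 𝔭) (hx₁ : 0 < x₁) (hx₂ : 0 < x₂) {Y Z Y' Z' : 𝔭} (hY : (Y' : 𝔤) = σ Y)
    (hZ : (Z' : 𝔤) = σ Z) :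
    ricci 𝔨 𝔭 (diagMetric Q 𝔭₁ 𝔭₂ 𝔭 x₁ x₂) Y' Z' =
      ricci 𝔨 𝔭 (diagMetric Q 𝔭₁ 𝔭₂ 𝔭 x₁ x₂) Y Z := by
  -- compute the trace in an orthonormal basis and in its image under `σ`
  obtain ⟨b, hb⟩ := HomogeneousRicci.exists_orthonormal_basis (h.inner.restrict 𝔭)
  have hb' : IsOrthonormal Q fun i => (b i : 𝔤) := hb
  have hmem : ∀ X ∈ 𝔭, σ X ∈ 𝔭 := fun X hX => by
    obtain ⟨A, hA, B, hB, rfl⟩ := Submodule.mem_sup.1 (h𝔭.ge hX)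
    rw [map_add]
    exact h𝔭.le (Submodule.add_mem_sup (hσ.map₁ A hA) (hσ.map₂ B hB))
  have hinj : Function.Injective (σ.restrict hmem) := fun X X' e =>
    Subtype.ext (hσ.injective h (congrArg Subtype.val e))
  set τ := LinearEquiv.ofInjectiveEndo (σ.restrict hmem) hinj
  have hτ : ∀ X, (τ X : 𝔤) = σ X := fun X => rfl
  have hc : IsOrthonormal Q fun i => (b.map τ i : 𝔤) := by
    constructor
    · intro i
      simpa only [Module.Basis.map_apply, hτ, hσ.isometry] using hb'.1 i
    · intro i j hij
      simpa only [Module.Basis.map_apply, hτ, hσ.isometry] using hb'.2 i j hij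
  rw [h.ricci_eq_sum_curv h𝔭 hx₁ hx₂ hc, h.ricci_eq_sum_curv h𝔭 hx₁ hx₂ hb']
  simp only [Module.Basis.map_apply, hτ, hY, hZ, hσ.curv h, hσ.isometry]

end IsSummandSymmetry

end RicciScalars

/-! ### Bounds for the curvature tensor -/

section CurvatureBounds

set_option linter.unusedSectionVars false

section General

variable {V : Type*} [AddCommGroup V] [Module ℝ V] {g : LinearMap.BilinForm ℝ V}

lemma IsInner.apply_add_le (hg : IsInner g) (X Y : V) :
    g (X + Y) (X + Y) ≤ 2 * g X X + 2 * g Y Y := by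
  have h := hg.nonneg (X - Y)
  simp only [map_add, map_sub, LinearMap.add_apply, LinearMap.sub_apply] at h ⊢
  linarith

lemma IsInner.apply_sub_le (hg : IsInner g) (X Y : V) :
    g (X - Y) (X - Y) ≤ 2 * g X X + 2 * g Y Y := by
  have h := hg.nonneg (X + Y)
  simp only [map_add, map_sub, LinearMap.add_apply, LinearMap.sub_apply] at h ⊢
  linarith

lemma apply_smul_smul (c : ℝ) (X : V) : g (c • X) (c • X) = c ^ 2 * g X X := by
  simp only [map_smul, LinearMap.smul_apply, smul_eq_mul]
  ring

lemma IsInner.orthProj_apply_self_le [FiniteDimensional ℝ V] (hg : IsInner g)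
    (W : Submodule ℝ V) (X : V) : g (orthProj g W X) (orthProj g W X) ≤ g X X := by
  have h := hg.nonneg (X - orthProj g W X)
  have h1 := hg.apply_orthProj_of_mem (orthProj_mem (Q := g) W X) X
  have h2 := hg.symm X (orthProj g W X)
  simp only [map_sub, LinearMap.sub_apply] at h
  linarith

end General

variable {𝔤 : Type*} [LieRing 𝔤] [LieAlgebra ℝ 𝔤]

/-- The bracket is bounded. -/
lemma IsInner.exists_lie_bound [FiniteDimensional ℝ 𝔤] {Q : LinearMap.BilinForm ℝ 𝔤}
    (hQ : IsInner Q) : ∃ κ > 0, ∀ X Y : 𝔤, Q ⁅X, Y⁆ ⁅X, Y⁆ ≤ κ * Q X X * Q Y Y := by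
  let c : InnerProductSpace.Core ℝ 𝔤 :=
    { inner := fun x y => Q x y
      conj_inner_symm := fun x y => by simpa using hQ.symm y x
      re_inner_nonneg := fun x => by simpa using hQ.nonneg x
      add_left := fun x y z => by simp
      smul_left := fun x y r => by simp
      definite := fun x hx => hQ.eq_zero hx }
  let _ := c.toNormedAddCommGroup
  let _ := InnerProductSpace.ofCore c.toCore
  have hn : ∀ x : 𝔤, Q x x = ‖x‖ ^ 2 := fun x => real_inner_self_eq_norm_sq x
  let B : 𝔤 →ₗ[ℝ] 𝔤 →ₗ[ℝ] 𝔤 := LinearMap.mk₂ ℝ (fun x y => ⁅x, y⁆) add_lie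
    (fun c x y => smul_lie c x y) lie_add (fun c x y => lie_smul c x y)
  refine ⟨‖B.toContinuousBilinearMap‖ ^ 2 + 1, by positivity, fun x y => ?_⟩
  have h : ‖⁅x, y⁆‖ ≤ ‖B.toContinuousBilinearMap‖ * ‖x‖ * ‖y‖ :=
    B.toContinuousBilinearMap.le_opNorm₂ x y
  rw [hn, hn, hn]
  calc ‖⁅x, y⁆‖ ^ 2 ≤ (‖B.toContinuousBilinearMap‖ * ‖x‖ * ‖y‖) ^ 2 := by gcongr
    _ = ‖B.toContinuousBilinearMap‖ ^ 2 * ‖x‖ ^ 2 * ‖y‖ ^ 2 := by ring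
    _ ≤ _ := by gcongr; linarith

variable {𝔨 𝔭 : Submodule ℝ 𝔤} [FiniteDimensional ℝ 𝔭] {g : LinearMap.BilinForm ℝ 𝔭}

/-- Unfolds the norm of the curvature tensor for an inner product. -/
lemma exists_curvatureNorm_eq (hg : IsInner g) :
    ∃ b : Module.Basis (Fin (Module.finrank ℝ 𝔭)) ℝ 𝔭, IsOrthonormal g b ∧
      curvatureNorm 𝔨 𝔭 g =
        √(∑ i, ∑ j, ∑ k, ∑ l, g (curvature 𝔨 𝔭 g (b i) (b j) (b k)) (b l) ^ 2) := by
  have h := exists_orthonormal_basis hg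
  exact ⟨h.choose, h.choose_spec, by rw [curvatureNorm, dif_pos h]⟩

/-- Bounds for the connection and for the isotropy part of the curvature operator bound the norm
of the curvature tensor. -/
lemma curvatureNorm_le (hg : IsInner g) {N : ℝ} (hN : 0 ≤ N)
    (hΛ : ∀ X Y, g (leviCivita 𝔨 𝔭 g X Y) (leviCivita 𝔨 𝔭 g X Y) ≤ N * g X X * g Y Y)
    (h𝔨 : ∀ X Y Z : 𝔭,
      g (proj 𝔨 𝔭 ⁅⁅(X : 𝔤), (Y : 𝔤)⁆ - (proj 𝔨 𝔭 ⁅(X : 𝔤), (Y : 𝔤)⁆ : 𝔤), (Z : 𝔤)⁆)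
        (proj 𝔨 𝔭 ⁅⁅(X : 𝔤), (Y : 𝔤)⁆ - (proj 𝔨 𝔭 ⁅(X : 𝔤), (Y : 𝔤)⁆ : 𝔤), (Z : 𝔤)⁆) ≤
        N ^ 2 * g X X * g Y Y * g Z Z) :
    curvatureNorm 𝔨 𝔭 g ≤ √(28 * (Module.finrank ℝ 𝔭 : ℝ) ^ 3) * N := by
  have hlc : IsLeviCivita 𝔨 𝔭 g (leviCivita 𝔨 𝔭 g) := by
    have hex := (existsUnique_isLeviCivita 𝔨 𝔭 hg).exists
    rw [leviCivita, dif_pos hex]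
    exact hex.choose_spec
  have hn := hg.nonneg
  -- The four terms of the curvature operator are bounded by `N²`, `N²`, `4 N²` and `N²`, and the
  -- square of the length of a sum of four vectors is at most four times the sum of the squares:
  -- `4 · 7 = 28`.
  have hR : ∀ X Y Z : 𝔭, g (curvature 𝔨 𝔭 g X Y Z) (curvature 𝔨 𝔭 g X Y Z) ≤
      28 * N ^ 2 * g X X * g Y Y * g Z Z := by
    intro X Y Z
    have hΛΛ : ∀ X Y Z : 𝔭, g (leviCivita 𝔨 𝔭 g X (leviCivita 𝔨 𝔭 g Y Z))
        (leviCivita 𝔨 𝔭 g X (leviCivita 𝔨 𝔭 g Y Z)) ≤ N ^ 2 * g X X * g Y Y * g Z Z := by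
      intro X Y Z
      refine (hΛ _ _).trans ?_
      calc N * g X X * g (leviCivita 𝔨 𝔭 g Y Z) (leviCivita 𝔨 𝔭 g Y Z)
          ≤ N * g X X * (N * g Y Y * g Z Z) :=
            mul_le_mul_of_nonneg_left (hΛ Y Z) (mul_nonneg hN (hn X))
        _ = _ := by ring
    -- the `𝔭`-part of the bracket is a difference of two values of the connection
    have hbr : g (proj 𝔨 𝔭 ⁅(X : 𝔤), (Y : 𝔤)⁆) (proj 𝔨 𝔭 ⁅(X : 𝔤), (Y : 𝔤)⁆) ≤
        4 * N * g X X * g Y Y := by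
      rw [← hlc.torsion_free]
      refine (hg.apply_sub_le _ _).trans ?_
      linarith [hΛ X Y, hΛ Y X]
    have h1 := hΛΛ X Y Z
    have h2 := hΛΛ Y X Z
    have h3 : g (leviCivita 𝔨 𝔭 g (proj 𝔨 𝔭 ⁅(X : 𝔤), (Y : 𝔤)⁆) Z)
        (leviCivita 𝔨 𝔭 g (proj 𝔨 𝔭 ⁅(X : 𝔤), (Y : 𝔤)⁆) Z) ≤
        4 * N ^ 2 * g X X * g Y Y * g Z Z := by
      refine (hΛ _ _).trans ?_
      calc N * g (proj 𝔨 𝔭 ⁅(X : 𝔤), (Y : 𝔤)⁆) (proj 𝔨 𝔭 ⁅(X : 𝔤), (Y : 𝔤)⁆) * g Z Z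
          ≤ N * (4 * N * g X X * g Y Y) * g Z Z :=
            mul_le_mul_of_nonneg_right (mul_le_mul_of_nonneg_left hbr hN) (hn Z)
        _ = _ := by ring
    have h4 := h𝔨 X Y Z
    have e : ∀ A B D F : 𝔭, g (A - B - D - F) (A - B - D - F) ≤
        4 * (g A A + g B B + g D D + g F F) := by
      intro A B D F
      have e1 : A - B - D - F = (A - B) - (D + F) := by abel
      rw [e1]
      refine (hg.apply_sub_le _ _).trans ?_
      linarith [hg.apply_sub_le A B, hg.apply_add_le D F]
    refine (e _ _ _ _).trans ?_
    linarith
  obtain ⟨b, hb, hbn⟩ := exists_curvatureNorm_eq (𝔨 := 𝔨) hg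
  rw [hbn]
  refine Real.sqrt_le_iff.2 ⟨by positivity, ?_⟩
  rw [mul_pow, Real.sq_sqrt (by positivity)]
  calc ∑ i, ∑ j, ∑ k, ∑ l, g (curvature 𝔨 𝔭 g (b i) (b j) (b k)) (b l) ^ 2
      ≤ ∑ _i : Fin (Module.finrank ℝ 𝔭), ∑ _j : Fin (Module.finrank ℝ 𝔭),
          ∑ _k : Fin (Module.finrank ℝ 𝔭), 28 * N ^ 2 := by
        refine Finset.sum_le_sum fun i _ => Finset.sum_le_sum fun j _ =>
          Finset.sum_le_sum fun k _ => ?_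
        simp only [sq (g _ _), hb.sum_apply_mul_apply]
        simpa only [hb.1, mul_one] using hR (b i) (b j) (b k)
    _ = 28 * (Module.finrank ℝ 𝔭 : ℝ) ^ 3 * N ^ 2 := by
        simp only [Finset.sum_const, Finset.card_univ, Fintype.card_fin, nsmul_eq_mul]
        ring

/-- The Ricci curvature is controlled by the curvature tensor. -/
lemma ricci_le_curvatureNorm (hg : IsInner g) (Y : 𝔭) :
    ricci 𝔨 𝔭 g Y Y ≤ (Module.finrank ℝ 𝔭 : ℝ) ^ 3 * (g Y Y * curvatureNorm 𝔨 𝔭 g) := by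
  obtain ⟨b, hb, hbn⟩ := exists_curvatureNorm_eq (𝔨 := 𝔨) hg
  -- each component of the curvature tensor is at most its norm
  have hcomp : ∀ i j k l, |g (curvature 𝔨 𝔭 g (b i) (b j) (b k)) (b l)| ≤
      curvatureNorm 𝔨 𝔭 g := by
    intro i j k l
    rw [hbn]
    refine Real.abs_le_sqrt ?_
    refine le_trans ?_ (Finset.single_le_sum (f := fun i => ∑ j, ∑ k, ∑ l,
      g (curvature 𝔨 𝔭 g (b i) (b j) (b k)) (b l) ^ 2) (fun _ _ => by positivity)
      (Finset.mem_univ i))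
    refine le_trans ?_ (Finset.single_le_sum (f := fun j => ∑ k, ∑ l,
      g (curvature 𝔨 𝔭 g (b i) (b j) (b k)) (b l) ^ 2) (fun _ _ => by positivity)
      (Finset.mem_univ j))
    refine le_trans ?_ (Finset.single_le_sum (f := fun k => ∑ l,
      g (curvature 𝔨 𝔭 g (b i) (b j) (b k)) (b l) ^ 2) (fun _ _ => by positivity)
      (Finset.mem_univ k))
    exact Finset.single_le_sum (f := fun l =>
      g (curvature 𝔨 𝔭 g (b i) (b j) (b k)) (b l) ^ 2) (fun _ _ => by positivity)
      (Finset.mem_univ l)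
  have hy : ∀ k, g Y (b k) ^ 2 ≤ g Y Y := fun k => by
    rw [← hb.sum_apply_mul_apply Y Y, sq]
    exact Finset.single_le_sum (f := fun k => g Y (b k) * g Y (b k))
      (fun _ _ => mul_self_nonneg _) (Finset.mem_univ k)
  -- expand both arguments of the Ricci tensor in the orthonormal basis
  have hR : ∀ i, g (curvature 𝔨 𝔭 g (b i) Y Y) (b i) = ∑ k, ∑ l, g Y (b k) * g Y (b l) *
      g (curvature 𝔨 𝔭 g (b i) (b k) (b l)) (b i) := by
    intro i
    let R : 𝔭 →ₗ[ℝ] 𝔭 →ₗ[ℝ] ℝ := LinearMap.mk₂ ℝ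
      (fun Y Z => g (curvature 𝔨 𝔭 g (b i) Y Z) (b i))
      (fun Y Y' Z => by rw [curvature_add₂, map_add, LinearMap.add_apply])
      (fun c Y Z => by rw [curvature_smul₂, map_smul, LinearMap.smul_apply])
      (fun Y Z Z' => by rw [curvature_add₃, map_add, LinearMap.add_apply])
      (fun c Y Z => by rw [curvature_smul₃, map_smul, LinearMap.smul_apply])
    change R Y Y = ∑ k, ∑ l, g Y (b k) * g Y (b l) * R (b k) (b l)
    conv_lhs => rw [← hb.sum_apply_smul Y]
    simp only [map_sum, map_smul, LinearMap.sum_apply, LinearMap.smul_apply, smul_eq_mul]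
    rw [Finset.sum_comm]
    refine Finset.sum_congr rfl fun k _ => ?_
    rw [Finset.mul_sum]
    exact Finset.sum_congr rfl fun l _ => by ring
  rw [ricci_eq_sum hb]
  simp only [hR]
  have hnn : 0 ≤ curvatureNorm 𝔨 𝔭 g := by
    rw [hbn]
    exact Real.sqrt_nonneg _
  calc ∑ i, ∑ k, ∑ l, g Y (b k) * g Y (b l) * g (curvature 𝔨 𝔭 g (b i) (b k) (b l)) (b i)
      ≤ ∑ _i : Fin (Module.finrank ℝ 𝔭), ∑ _k : Fin (Module.finrank ℝ 𝔭),
          ∑ _l : Fin (Module.finrank ℝ 𝔭), g Y Y * curvatureNorm 𝔨 𝔭 g := by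
        refine Finset.sum_le_sum fun i _ => Finset.sum_le_sum fun k _ =>
          Finset.sum_le_sum fun l _ => ?_
        refine (le_abs_self _).trans ?_
        rw [abs_mul]
        refine mul_le_mul ?_ (hcomp _ _ _ _) (abs_nonneg _) (hg.nonneg Y)
        rw [abs_le]
        constructor <;> nlinarith [hy k, hy l, sq_nonneg (g Y (b k) + g Y (b l)),
          sq_nonneg (g Y (b k) - g Y (b l))]
    _ = _ := by
        simp only [Finset.sum_const, Finset.card_univ, Fintype.card_fin, nsmul_eq_mul]
        ring

end CurvatureBounds

/-! ### The curvature of the diagonal metrics -/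

section TwoSummandBounds

set_option linter.unusedSectionVars false

variable {𝔤 : Type*} [LieRing 𝔤] [LieAlgebra ℝ 𝔤] [FiniteDimensional ℝ 𝔤]
  {Q : LinearMap.BilinForm ℝ 𝔤} {𝔨 𝔭₁ 𝔭₂ 𝔭 : Submodule ℝ 𝔤}

namespace IsTwoSummand

/-- The elementary inequality behind the bound of the connection: all mixed terms are at most of
the order of `1 / x₁`, because `x₁ ≤ U x₂`. -/
lemma metric_connection_mul_le {x₁ x₂ u U κ a b a' b' p q : ℝ} (hx₁ : 0 < x₁) (hx₂ : 0 < x₂)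
    (hxu : x₁ = u * x₂) (hu0 : 0 < u) (hU : u ≤ U) (hκ : 0 < κ) (ha : 0 ≤ a) (hb : 0 ≤ b)
    (ha' : 0 ≤ a') (hb' : 0 ≤ b') (hp : p ≤ κ * (a * a' + b * b'))
    (hq : q ≤ κ * ((4 + U ^ 2) * (a * b') + U ^ 2 * (b * a') + b * b')) :
    (x₁ * p + x₂ * q) * x₁ ≤
      κ * (5 + 3 * U + 5 * U ^ 2) * (x₁ * a + x₂ * b) * (x₁ * a' + x₂ * b') := by
  calc (x₁ * p + x₂ * q) * x₁
      ≤ (x₁ * (κ * (a * a' + b * b')) +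
          x₂ * (κ * ((4 + U ^ 2) * (a * b') + U ^ 2 * (b * a') + b * b'))) * x₁ := by
        gcongr
    _ = κ * ((x₁ * a) * (x₁ * a') + u ^ 2 * ((x₂ * b) * (x₂ * b')) +
          (4 + U ^ 2) * ((x₁ * a) * (x₂ * b')) + U ^ 2 * ((x₂ * b) * (x₁ * a')) +
          u * ((x₂ * b) * (x₂ * b'))) := by
        rw [hxu]
        ring
    _ ≤ κ * ((5 + 3 * U + 5 * U ^ 2) * ((x₁ * a) * (x₁ * a')) +
          (5 + 3 * U + 5 * U ^ 2) * ((x₂ * b) * (x₂ * b')) +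
          (5 + 3 * U + 5 * U ^ 2) * ((x₁ * a) * (x₂ * b')) +
          (5 + 3 * U + 5 * U ^ 2) * ((x₂ * b) * (x₁ * a'))) := by
        have j1 : 0 ≤ (x₁ * a) * (x₁ * a') := by positivity
        have j2 : 0 ≤ (x₂ * b) * (x₂ * b') := by positivity
        have j3 : 0 ≤ (x₁ * a) * (x₂ * b') := by positivity
        have j4 : 0 ≤ (x₂ * b) * (x₁ * a') := by positivity
        have k1 : 1 ≤ 5 + 3 * U + 5 * U ^ 2 := by nlinarith
        have k2 : u ^ 2 + u ≤ 5 + 3 * U + 5 * U ^ 2 := by nlinarith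
        have k3 : 4 + U ^ 2 ≤ 5 + 3 * U + 5 * U ^ 2 := by nlinarith
        have k4 : U ^ 2 ≤ 5 + 3 * U + 5 * U ^ 2 := by nlinarith
        refine mul_le_mul_of_nonneg_left ?_ hκ.le
        linarith [mul_le_mul_of_nonneg_right k1 j1, mul_le_mul_of_nonneg_right k2 j2,
          mul_le_mul_of_nonneg_right k3 j3, mul_le_mul_of_nonneg_right k4 j4]
    _ = κ * (5 + 3 * U + 5 * U ^ 2) * (x₁ * a + x₂ * b) * (x₁ * a' + x₂ * b') := by ring

/-- The connection of the diagonal metrics is at most of the order of `1 / √x₁`, as long as the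
ratio `x₁ / x₂` stays bounded. -/
lemma leviCivita_apply_self_le (h : IsTwoSummand Q 𝔨 𝔭₁ 𝔭₂) (h𝔭 : 𝔭₁ ⊔ 𝔭₂ = 𝔭) {κ U x₁ x₂ : ℝ}
    (hκ : 0 < κ) (hlie : ∀ X Y : 𝔤, Q ⁅X, Y⁆ ⁅X, Y⁆ ≤ κ * Q X X * Q Y Y) (hx₁ : 0 < x₁)
    (hx₂ : 0 < x₂) (hU : x₁ / x₂ ≤ U) (X Y : 𝔭) :
    diagMetric Q 𝔭₁ 𝔭₂ 𝔭 x₁ x₂ (leviCivita 𝔨 𝔭 (diagMetric Q 𝔭₁ 𝔭₂ 𝔭 x₁ x₂) X Y)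
      (leviCivita 𝔨 𝔭 (diagMetric Q 𝔭₁ 𝔭₂ 𝔭 x₁ x₂) X Y) ≤
      κ * (5 + 3 * U + 5 * U ^ 2) / x₁ * diagMetric Q 𝔭₁ 𝔭₂ 𝔭 x₁ x₂ X X *
        diagMetric Q 𝔭₁ 𝔭₂ 𝔭 x₁ x₂ Y Y := by
  set g := diagMetric Q 𝔭₁ 𝔭₂ 𝔭 x₁ x₂
  have hg : IsInner g := h.isInner_diagMetric h𝔭 hx₁ hx₂
  set u := x₁ / x₂ with hu
  have hu0 : 0 < u := div_pos hx₁ hx₂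
  have hU0 : 0 < U := hu0.trans_le hU
  have hxu : x₁ = u * x₂ := by rw [hu]; field_simp
  have hgX : ∀ X : 𝔭, g X X = x₁ * Q (orthProj Q 𝔭₁ X) (orthProj Q 𝔭₁ X) +
      x₂ * Q (orthProj Q 𝔭₂ X) (orthProj Q 𝔭₂ X) := fun X => rfl
  have hn := h.inner.nonneg
  have hle := h.inner.orthProj_apply_self_le
  have hN : 0 ≤ κ * (5 + 3 * U + 5 * U ^ 2) / x₁ := by positivity
  set X₁ := orthProj Q 𝔭₁ X with hX₁
  set X₂ := orthProj Q 𝔭₂ X with hX₂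
  set Y₁ := orthProj Q 𝔭₁ Y with hY₁
  set Y₂ := orthProj Q 𝔭₂ Y with hY₂
  have mX₁ : X₁ ∈ 𝔭₁ := orthProj_mem _ _
  have mX₂ : X₂ ∈ 𝔭₂ := orthProj_mem _ _
  have mY₁ : Y₁ ∈ 𝔭₁ := orthProj_mem _ _
  have mY₂ : Y₂ ∈ 𝔭₂ := orthProj_mem _ _
  have p₁ : ∀ Z, orthProj Q 𝔭₁ (orthProj Q 𝔭₁ Z) = orthProj Q 𝔭₁ Z :=
    fun Z => h.proj₁_of_mem₁ (orthProj_mem _ _)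
  have p₁' : ∀ Z, orthProj Q 𝔭₁ (orthProj Q 𝔭₂ Z) = 0 :=
    fun Z => h.proj₁_of_mem₂ (orthProj_mem _ _)
  have p₂ : ∀ Z, orthProj Q 𝔭₂ (orthProj Q 𝔭₂ Z) = orthProj Q 𝔭₂ Z :=
    fun Z => h.proj₂_of_mem₂ (orthProj_mem _ _)
  have p₂' : ∀ Z, orthProj Q 𝔭₂ (orthProj Q 𝔭₁ Z) = 0 :=
    fun Z => h.proj₂_of_mem₁ (orthProj_mem _ _)
  have e₁ : orthProj Q 𝔭₁ (lam Q 𝔭₁ 𝔭₂ u X Y) =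
      (1 / 2 : ℝ) • orthProj Q 𝔭₁ ⁅X₁, Y₁⁆ + (1 / 2 : ℝ) • orthProj Q 𝔭₁ ⁅X₂, Y₂⁆ := by
    simp only [lam, map_add, map_smul, p₁, p₁', ← hX₁, ← hX₂, ← hY₁, ← hY₂,
      h.proj₁_of_mem₂ (h.lie₁₂ mX₁ mY₂), h.proj₁_of_mem₂ (h.lie₂₁ mX₂ mY₁), smul_zero, add_zero]
  have e₂ : orthProj Q 𝔭₂ (lam Q 𝔭₁ 𝔭₂ u X Y) =
      ((1 - u / 2) • ⁅X₁, Y₂⁆ + (u / 2) • ⁅X₂, Y₁⁆) +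
        (1 / 2 : ℝ) • orthProj Q 𝔭₂ ⁅X₂, Y₂⁆ := by
    simp only [lam, map_add, map_smul, p₂, p₂', ← hX₁, ← hX₂, ← hY₁, ← hY₂,
      h.proj₂_of_mem₂ (h.lie₁₂ mX₁ mY₂), h.proj₂_of_mem₂ (h.lie₂₁ mX₂ mY₁), smul_zero, zero_add]
  have f₁ := h.inner.apply_add_le ((1 / 2 : ℝ) • orthProj Q 𝔭₁ ⁅X₁, Y₁⁆)
    ((1 / 2 : ℝ) • orthProj Q 𝔭₁ ⁅X₂, Y₂⁆)
  have f₂ := h.inner.apply_add_le ((1 - u / 2) • ⁅X₁, Y₂⁆ + (u / 2) • ⁅X₂, Y₁⁆)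
    ((1 / 2 : ℝ) • orthProj Q 𝔭₂ ⁅X₂, Y₂⁆)
  have f₃ := h.inner.apply_add_le ((1 - u / 2) • ⁅X₁, Y₂⁆) ((u / 2) • ⁅X₂, Y₁⁆)
  rw [apply_smul_smul, apply_smul_smul] at f₁ f₃
  rw [apply_smul_smul] at f₂
  rw [hgX, hgX, hgX, h.coe_leviCivita h𝔭 hx₁ hx₂, ← hu, e₁, e₂, ← hX₁, ← hX₂, ← hY₁, ← hY₂]
  rw [div_mul_eq_mul_div, div_mul_eq_mul_div, le_div_iff₀ hx₁]
  have l₁₁ := (hle 𝔭₁ _).trans (hlie X₁ Y₁)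
  have l₂₂ := (hle 𝔭₁ _).trans (hlie X₂ Y₂)
  have l₂₂' := (hle 𝔭₂ _).trans (hlie X₂ Y₂)
  have l₁₂ := hlie X₁ Y₂
  have l₂₁ := hlie X₂ Y₁
  have hu2 : (1 - u / 2) ^ 2 ≤ 1 + U ^ 2 / 4 := by nlinarith
  have hu3 : u ^ 2 ≤ U ^ 2 := by nlinarith
  set a := Q X₁ X₁
  set b := Q X₂ X₂
  set a' := Q Y₁ Y₁
  set b' := Q Y₂ Y₂
  have ha : 0 ≤ a := hn X₁
  have hb : 0 ≤ b := hn X₂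
  have ha' : 0 ≤ a' := hn Y₁
  have hb' : 0 ≤ b' := hn Y₂
  have g₁ : Q ((1 / 2 : ℝ) • orthProj Q 𝔭₁ ⁅X₁, Y₁⁆ + (1 / 2 : ℝ) • orthProj Q 𝔭₁ ⁅X₂, Y₂⁆)
      ((1 / 2 : ℝ) • orthProj Q 𝔭₁ ⁅X₁, Y₁⁆ + (1 / 2 : ℝ) • orthProj Q 𝔭₁ ⁅X₂, Y₂⁆) ≤
      κ * (a * a' + b * b') := by
    have := mul_nonneg hκ.le (mul_nonneg ha ha')
    have := mul_nonneg hκ.le (mul_nonneg hb hb')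
    linarith
  have g₂ : Q (((1 - u / 2) • ⁅X₁, Y₂⁆ + (u / 2) • ⁅X₂, Y₁⁆) +
      (1 / 2 : ℝ) • orthProj Q 𝔭₂ ⁅X₂, Y₂⁆) (((1 - u / 2) • ⁅X₁, Y₂⁆ + (u / 2) • ⁅X₂, Y₁⁆) +
      (1 / 2 : ℝ) • orthProj Q 𝔭₂ ⁅X₂, Y₂⁆) ≤
      κ * ((4 + U ^ 2) * (a * b') + U ^ 2 * (b * a') + b * b') := by
    have i1 : (1 - u / 2) ^ 2 * Q ⁅X₁, Y₂⁆ ⁅X₁, Y₂⁆ ≤ (1 + U ^ 2 / 4) * (κ * a * b') :=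
      mul_le_mul hu2 l₁₂ (hn _) (by positivity)
    have i2 : (u / 2) ^ 2 * Q ⁅X₂, Y₁⁆ ⁅X₂, Y₁⁆ ≤ (U ^ 2 / 4) * (κ * b * a') :=
      mul_le_mul (by linarith) l₂₁ (hn _) (by positivity)
    have := mul_nonneg hκ.le (mul_nonneg hb hb')
    linarith
  exact metric_connection_mul_le hx₁ hx₂ hxu hu0 hU hκ ha hb ha' hb' g₁ g₂

/-- The part of the curvature operator coming from the isotropy algebra is at most of the order of
`1 / x₁`, as long as the ratio `x₁ / x₂` stays bounded. -/
lemma isotropy_apply_self_le (h : IsTwoSummand Q 𝔨 𝔭₁ 𝔭₂) (h𝔭 : 𝔭₁ ⊔ 𝔭₂ = 𝔭) {κ U x₁ x₂ : ℝ}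
    (hκ : 0 < κ) (hlie : ∀ X Y : 𝔤, Q ⁅X, Y⁆ ⁅X, Y⁆ ≤ κ * Q X X * Q Y Y) (hx₁ : 0 < x₁)
    (hx₂ : 0 < x₂) (hU : x₁ / x₂ ≤ U) (X Y Z : 𝔭) :
    diagMetric Q 𝔭₁ 𝔭₂ 𝔭 x₁ x₂
      (proj 𝔨 𝔭 ⁅⁅(X : 𝔤), (Y : 𝔤)⁆ - (proj 𝔨 𝔭 ⁅(X : 𝔤), (Y : 𝔤)⁆ : 𝔤), (Z : 𝔤)⁆)
      (proj 𝔨 𝔭 ⁅⁅(X : 𝔤), (Y : 𝔤)⁆ - (proj 𝔨 𝔭 ⁅(X : 𝔤), (Y : 𝔤)⁆ : 𝔤), (Z : 𝔤)⁆) ≤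
      (κ * (5 + 3 * U + 5 * U ^ 2) / x₁) ^ 2 * diagMetric Q 𝔭₁ 𝔭₂ 𝔭 x₁ x₂ X X *
        diagMetric Q 𝔭₁ 𝔭₂ 𝔭 x₁ x₂ Y Y * diagMetric Q 𝔭₁ 𝔭₂ 𝔭 x₁ x₂ Z Z := by
  set g := diagMetric Q 𝔭₁ 𝔭₂ 𝔭 x₁ x₂
  have hg : IsInner g := h.isInner_diagMetric h𝔭 hx₁ hx₂
  set u := x₁ / x₂ with hu
  have hu0 : 0 < u := div_pos hx₁ hx₂
  have hU0 : 0 < U := hu0.trans_le hU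
  have hxu : x₁ = u * x₂ := by rw [hu]; field_simp
  have hgX : ∀ X : 𝔭, g X X = x₁ * Q (orthProj Q 𝔭₁ X) (orthProj Q 𝔭₁ X) +
      x₂ * Q (orthProj Q 𝔭₂ X) (orthProj Q 𝔭₂ X) := fun X => rfl
  have hn := h.inner.nonneg
  have hle := h.inner.orthProj_apply_self_le
  have hN : 0 ≤ κ * (5 + 3 * U + 5 * U ^ 2) / x₁ := by positivity
  have e : ⁅(X : 𝔤), (Y : 𝔤)⁆ - (proj 𝔨 𝔭 ⁅(X : 𝔤), (Y : 𝔤)⁆ : 𝔤) =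
      orthProj Q 𝔨 ⁅(X : 𝔤), (Y : 𝔤)⁆ := by
    rw [h.coe_proj h𝔭, sub_eq_of_eq_add (h.sum_proj _).symm]
  rw [e]
  set W := orthProj Q 𝔨 ⁅(X : 𝔤), (Y : 𝔤)⁆
  have hW : W ∈ 𝔨 := orthProj_mem _ _
  have mZ₁ : orthProj Q 𝔭₁ (Z : 𝔤) ∈ 𝔭₁ := orthProj_mem _ _
  have mZ₂ : orthProj Q 𝔭₂ (Z : 𝔤) ∈ 𝔭₂ := orthProj_mem _ _
  have eZ : ⁅W, (Z : 𝔤)⁆ = ⁅W, orthProj Q 𝔭₁ (Z : 𝔤)⁆ + ⁅W, orthProj Q 𝔭₂ (Z : 𝔤)⁆ := by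
    rw [← lie_add, h.proj_add_proj h𝔭 Z]
  have q₁ : orthProj Q 𝔭₁ ⁅W, (Z : 𝔤)⁆ = ⁅W, orthProj Q 𝔭₁ (Z : 𝔤)⁆ := by
    rw [eZ, map_add, h.proj₁_of_mem₁ (h.lie₀₁ _ hW _ mZ₁), h.proj₁_of_mem₂ (h.lie₀₂ _ hW _ mZ₂),
      add_zero]
  have q₂ : orthProj Q 𝔭₂ ⁅W, (Z : 𝔤)⁆ = ⁅W, orthProj Q 𝔭₂ (Z : 𝔤)⁆ := by
    rw [eZ, map_add, h.proj₂_of_mem₁ (h.lie₀₁ _ hW _ mZ₁), h.proj₂_of_mem₂ (h.lie₀₂ _ hW _ mZ₂),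
      zero_add]
  have hWle : Q W W ≤ κ * Q (X : 𝔤) X * Q (Y : 𝔤) Y := (hle 𝔨 _).trans (hlie _ _)
  -- `x₁ Q` is dominated by the metric, since `x₁ ≤ U x₂`
  have hG : ∀ X : 𝔭, x₁ * Q (X : 𝔤) X ≤ (1 + U) * g X X := by
    intro X
    have h0 : orthProj Q 𝔨 (X : 𝔤) = 0 := by
      rw [← h.proj_add_proj h𝔭 X, map_add, h.proj₀_of_mem₁ (orthProj_mem _ _),
        h.proj₀_of_mem₂ (orthProj_mem _ _), add_zero]
    rw [h.apply_eq_sum_proj, h0, map_zero, zero_add, hgX]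
    have i1 := mul_nonneg hx₁.le (hn (orthProj Q 𝔭₁ (X : 𝔤)))
    have i2 := mul_nonneg hx₂.le (hn (orthProj Q 𝔭₂ (X : 𝔤)))
    have i3 : x₁ ≤ U * x₂ := by rwa [div_le_iff₀ hx₂] at hU
    have i4 := mul_le_mul_of_nonneg_right i3 (hn (orthProj Q 𝔭₂ (X : 𝔤)))
    have i5 := mul_nonneg hU0.le i1
    linarith
  rw [hgX, h.proj₁_coe_proj h𝔭, h.proj₂_coe_proj h𝔭, q₁, q₂]
  have hWG : x₁ * Q ⁅W, orthProj Q 𝔭₁ (Z : 𝔤)⁆ ⁅W, orthProj Q 𝔭₁ (Z : 𝔤)⁆ +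
      x₂ * Q ⁅W, orthProj Q 𝔭₂ (Z : 𝔤)⁆ ⁅W, orthProj Q 𝔭₂ (Z : 𝔤)⁆ ≤ κ * Q W W * g Z Z := by
    rw [hgX]
    linarith [mul_le_mul_of_nonneg_left (hlie W (orthProj Q 𝔭₁ (Z : 𝔤))) hx₁.le,
      mul_le_mul_of_nonneg_left (hlie W (orthProj Q 𝔭₂ (Z : 𝔤))) hx₂.le]
  refine hWG.trans ?_
  have hgn := hg.nonneg
  rw [div_pow, div_mul_eq_mul_div, div_mul_eq_mul_div, div_mul_eq_mul_div,
    le_div_iff₀ (by positivity)]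
  calc κ * Q W W * g Z Z * x₁ ^ 2 ≤ κ * (κ * Q (X : 𝔤) X * Q (Y : 𝔤) Y) * g Z Z * x₁ ^ 2 := by
        have := hgn Z
        gcongr
    _ = κ ^ 2 * (x₁ * Q (X : 𝔤) X) * (x₁ * Q (Y : 𝔤) Y) * g Z Z := by ring
    _ ≤ κ ^ 2 * ((1 + U) * g X X) * ((1 + U) * g Y Y) * g Z Z := by
        have i1 := hgn Z
        have i2 := hG X
        have i3 := hG Y
        have i4 := hn (X : 𝔤)
        have i5 := hn (Y : 𝔤)
        have i6 := hgn X
        gcongr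
    _ = (1 + U) ^ 2 * (κ ^ 2 * g X X * g Y Y * g Z Z) := by ring
    _ ≤ (5 + 3 * U + 5 * U ^ 2) ^ 2 * (κ ^ 2 * g X X * g Y Y * g Z Z) := by
        have i1 := hgn Z
        have i6 := hgn X
        have i7 := hgn Y
        have : 1 + U ≤ 5 + 3 * U + 5 * U ^ 2 := by nlinarith
        gcongr
    _ = _ := by ring

/-- As long as `x₁ / x₂` stays bounded, the curvature is at most of the order of `1 / x₁`. -/
lemma exists_curvatureNorm_le (h : IsTwoSummand Q 𝔨 𝔭₁ 𝔭₂) (h𝔭 : 𝔭₁ ⊔ 𝔭₂ = 𝔭) (U : ℝ) :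
    ∃ M, ∀ x₁ x₂ : ℝ, 0 < x₁ → 0 < x₂ → x₁ / x₂ ≤ U →
      curvatureNorm 𝔨 𝔭 (diagMetric Q 𝔭₁ 𝔭₂ 𝔭 x₁ x₂) ≤ M / x₁ := by
  obtain ⟨κ, hκ, hlie⟩ := h.inner.exists_lie_bound
  refine ⟨√(28 * (Module.finrank ℝ 𝔭 : ℝ) ^ 3) * (κ * (5 + 3 * U + 5 * U ^ 2)),
    fun x₁ x₂ hx₁ hx₂ hU => ?_⟩
  have hU0 : 0 < U := (div_pos hx₁ hx₂).trans_le hU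
  have hN : 0 ≤ κ * (5 + 3 * U + 5 * U ^ 2) / x₁ := by positivity
  rw [mul_div_assoc]
  exact curvatureNorm_le (h.isInner_diagMetric h𝔭 hx₁ hx₂) hN
    (h.leviCivita_apply_self_le h𝔭 hκ hlie hx₁ hx₂ hU)
    (h.isotropy_apply_self_le h𝔭 hκ hlie hx₁ hx₂ hU)

end IsTwoSummand

end TwoSummandBounds

/-! ### Schur's lemma for invariant bilinear forms -/

section Schur

variable {V : Type*} [AddCommGroup V] [Module ℝ V] [FiniteDimensional ℝ V]
  {Q : LinearMap.BilinForm ℝ V}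

/-- Riesz representation: an inner product turns a bilinear form into a linear map. -/
lemma IsInner.exists_riesz {U : Type*} [AddCommGroup U] [Module ℝ U] (hQ : IsInner Q)
    (B : U →ₗ[ℝ] V →ₗ[ℝ] ℝ) : ∃ A : U →ₗ[ℝ] V, ∀ X Y, Q (A X) Y = B X Y := by
  have hinj : Function.Injective (Q : V →ₗ[ℝ] Module.Dual ℝ V) := by
    rw [injective_iff_map_eq_zero]
    exact fun x hx => hQ.eq_zero (by rw [hx]; rfl)
  let φ : V ≃ₗ[ℝ] Module.Dual ℝ V :=
    LinearMap.linearEquivOfInjective Q hinj Subspace.dual_finrank_eq.symm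
  refine ⟨φ.symm.toLinearMap ∘ₗ B, fun X Y => ?_⟩
  have e : Q (φ.symm (B X)) = B X := φ.apply_symm_apply (B X)
  exact congrArg (fun f : V →ₗ[ℝ] ℝ => f Y) e

/-- A symmetric bilinear form has an eigenvector with respect to an inner product. -/
lemma IsInner.exists_eigenvector [Nontrivial V] (hQ : IsInner Q) {B : LinearMap.BilinForm ℝ V}
    (hB : ∀ X Y, B X Y = B Y X) : ∃ c : ℝ, ∃ X ≠ 0, ∀ Y, B X Y = c * Q X Y := by
  obtain ⟨A, hA⟩ := hQ.exists_riesz B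
  let c : InnerProductSpace.Core ℝ V :=
    { inner := fun x y => Q x y
      conj_inner_symm := fun x y => by simpa using hQ.symm y x
      re_inner_nonneg := fun x => by simpa using hQ.nonneg x
      add_left := fun x y z => by simp
      smul_left := fun x y r => by simp
      definite := fun x hx => hQ.eq_zero hx }
  let _ := c.toNormedAddCommGroup
  let _ := InnerProductSpace.ofCore c.toCore
  have hs : A.IsSymmetric := fun X Y => by
    change Q (A X) Y = Q X (A Y)
    rw [hQ.symm X, hA, hA, hB]
  obtain ⟨c, hc⟩ : ∃ c : ℝ, Module.End.HasEigenvalue A c :=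
    ⟨_, hs.hasEigenvalue_iSup_of_finiteDimensional⟩
  obtain ⟨X, hX⟩ := hc.exists_hasEigenvector
  refine ⟨c, X, hX.2, fun Y => ?_⟩
  rw [← hA, hX.apply_eq_smul, map_smul]
  rfl

variable {ι : Type*} {σ : ι → V →ₗ[ℝ] V} {W W₁ W₂ : Submodule ℝ V}

/-- An isometry that preserves a subspace maps it onto itself. -/
lemma IsInner.exists_preimage_mem (hQ : IsInner Q) {τ : V →ₗ[ℝ] V}
    (hτ : ∀ X Y, Q (τ X) (τ Y) = Q X Y) (hW : ∀ X ∈ W, τ X ∈ W) {Y : V} (hY : Y ∈ W) :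
    ∃ X ∈ W, τ X = Y := by
  have hinj : Function.Injective (τ.restrict hW) := by
    rw [injective_iff_map_eq_zero]
    intro X hX
    have e : τ (X : V) = 0 := congrArg Subtype.val hX
    refine Subtype.ext (hQ.eq_zero (X := (X : V)) ?_)
    rw [← hτ, e, map_zero]
  obtain ⟨X, hX⟩ := (LinearMap.injective_iff_surjective.1 hinj) ⟨Y, hY⟩
  exact ⟨X, X.2, congrArg Subtype.val hX⟩

/-- Schur's lemma: on an irreducible summand every invariant symmetric bilinear form is a multiple
of the given inner product. -/
lemma IsInner.exists_eq_mul_of_irreducible (hQ : IsInner Q)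
    (hσ : ∀ i X Y, Q (σ i X) (σ i Y) = Q X Y) (hW : ∀ i, ∀ X ∈ W, σ i X ∈ W) (hne : W ≠ ⊥)
    (hirr : ∀ U ≤ W, (∀ i, ∀ X ∈ U, σ i X ∈ U) → U = ⊥ ∨ U = W) {B : LinearMap.BilinForm ℝ V}
    (hB : ∀ X ∈ W, ∀ Y ∈ W, B X Y = B Y X)
    (hinv : ∀ i, ∀ X ∈ W, ∀ Y ∈ W, B (σ i X) (σ i Y) = B X Y) :
    ∃ c : ℝ, ∀ X ∈ W, ∀ Y ∈ W, B X Y = c * Q X Y := by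
  have : Nontrivial W := Submodule.nontrivial_iff_ne_bot.2 hne
  let B' : LinearMap.BilinForm ℝ W := B.restrict W
  have hB' : ∀ X Y, B' X Y = B' Y X := fun X Y => hB X X.2 Y Y.2
  have hQW : IsInner (Q.restrict W) := hQ.restrict W
  obtain ⟨c, X₀, hX₀, h⟩ := hQW.exists_eigenvector hB'
  let U : Submodule ℝ V :=
    { carrier := {X | X ∈ W ∧ ∀ Y ∈ W, B X Y = c * Q X Y}
      add_mem' := fun {X X'} hX hX' => ⟨W.add_mem hX.1 hX'.1, fun Y hY => by
        rw [map_add, map_add, LinearMap.add_apply, LinearMap.add_apply, hX.2 Y hY, hX'.2 Y hY,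
          mul_add]⟩
      zero_mem' := ⟨W.zero_mem, fun Y _ => by simp⟩
      smul_mem' := fun r X hX => ⟨W.smul_mem r hX.1, fun Y hY => by
        rw [map_smul, map_smul, LinearMap.smul_apply, LinearMap.smul_apply, hX.2 Y hY, smul_eq_mul,
          smul_eq_mul, mul_left_comm]⟩ }
  rcases hirr U (fun X hX => hX.1) (fun i X hX => ⟨hW i X hX.1, fun Y hY => by
    obtain ⟨Z, hZ, rfl⟩ := hQ.exists_preimage_mem (hσ i) (hW i) hY
    rw [hinv i X hX.1 Z hZ, hσ, hX.2 Z hZ]⟩) with h0 | h1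
  · have hm : (X₀ : V) ∈ U := ⟨X₀.2, fun Y hY => h ⟨Y, hY⟩⟩
    rw [h0, Submodule.mem_bot] at hm
    exact absurd (Subtype.ext hm) hX₀
  · exact ⟨c, fun X hX Y hY => (h1.ge hX).2 Y hY⟩

/-- Schur's lemma: two irreducible summands which are not equivalent are orthogonal for every
invariant bilinear form. -/
lemma IsInner.eq_zero_of_not_equivalent (hQ : IsInner Q)
    (hσ : ∀ i X Y, Q (σ i X) (σ i Y) = Q X Y) (hW₁ : ∀ i, ∀ X ∈ W₁, σ i X ∈ W₁)
    (hW₂ : ∀ i, ∀ X ∈ W₂, σ i X ∈ W₂)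
    (hirr₁ : ∀ U ≤ W₁, (∀ i, ∀ X ∈ U, σ i X ∈ U) → U = ⊥ ∨ U = W₁)
    (hirr₂ : ∀ U ≤ W₂, (∀ i, ∀ X ∈ U, σ i X ∈ U) → U = ⊥ ∨ U = W₂)
    (hne : ¬ ∃ f : W₁ ≃ₗ[ℝ] W₂, ∀ i, ∀ X Y : W₁, (Y : V) = σ i X → (f Y : V) = σ i (f X))
    {B : LinearMap.BilinForm ℝ V} (hinv : ∀ i, ∀ X ∈ W₁, ∀ Y ∈ W₂, B (σ i X) (σ i Y) = B X Y) :
    ∀ X ∈ W₁, ∀ Y ∈ W₂, B X Y = 0 := by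
  let U₁ : Submodule ℝ V :=
    { carrier := {X | X ∈ W₁ ∧ ∀ Y ∈ W₂, B X Y = 0}
      add_mem' := fun {X X'} hX hX' => ⟨W₁.add_mem hX.1 hX'.1, fun Y hY => by
        rw [map_add, LinearMap.add_apply, hX.2 Y hY, hX'.2 Y hY, add_zero]⟩
      zero_mem' := ⟨W₁.zero_mem, fun Y _ => by simp⟩
      smul_mem' := fun r X hX => ⟨W₁.smul_mem r hX.1, fun Y hY => by
        rw [map_smul, LinearMap.smul_apply, hX.2 Y hY, smul_zero]⟩ }
  let U₂ : Submodule ℝ V :=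
    { carrier := {Y | Y ∈ W₂ ∧ ∀ X ∈ W₁, B X Y = 0}
      add_mem' := fun {Y Y'} hY hY' => ⟨W₂.add_mem hY.1 hY'.1, fun X hX => by
        rw [map_add, hY.2 X hX, hY'.2 X hX, add_zero]⟩
      zero_mem' := ⟨W₂.zero_mem, fun X _ => by simp⟩
      smul_mem' := fun r Y hY => ⟨W₂.smul_mem r hY.1, fun X hX => by
        rw [map_smul, hY.2 X hX, smul_zero]⟩ }
  rcases hirr₁ U₁ (fun X hX => hX.1) (fun i X hX => ⟨hW₁ i X hX.1, fun Y hY => by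
    obtain ⟨Z, hZ, rfl⟩ := hQ.exists_preimage_mem (hσ i) (hW₂ i) hY
    rw [hinv i X hX.1 Z hZ, hX.2 Z hZ]⟩) with h₁ | h₁
  swap
  · exact fun X hX Y hY => (h₁.ge hX).2 Y hY
  rcases hirr₂ U₂ (fun X hX => hX.1) (fun i Y hY => ⟨hW₂ i Y hY.1, fun X hX => by
    obtain ⟨Z, hZ, rfl⟩ := hQ.exists_preimage_mem (hσ i) (hW₁ i) hX
    rw [hinv i Z hZ Y hY.1, hY.2 Z hZ]⟩) with h₂ | h₂
  swap
  · exact fun X hX Y hY => (h₂.ge hY).2 X hX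
  -- both kernels vanish, and `B` is an equivalence
  refine absurd ?_ hne
  let B₁ : W₁ →ₗ[ℝ] W₂ →ₗ[ℝ] ℝ := B.compl₁₂ W₁.subtype W₂.subtype
  let B₂ : W₂ →ₗ[ℝ] W₁ →ₗ[ℝ] ℝ := B.flip.compl₁₂ W₂.subtype W₁.subtype
  have hQ₁ : IsInner (Q.restrict W₁) := hQ.restrict W₁
  have hQ₂ : IsInner (Q.restrict W₂) := hQ.restrict W₂
  obtain ⟨A, hA⟩ := hQ₂.exists_riesz B₁
  obtain ⟨A', hA'⟩ := hQ₁.exists_riesz B₂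
  have hA : ∀ (X : W₁) (Y : W₂), Q (A X : V) Y = B X Y := hA
  have hA' : ∀ (X : W₁) (Y : W₂), Q (A' Y : V) X = B X Y := fun X Y => hA' Y X
  have hinj : Function.Injective A := by
    rw [injective_iff_map_eq_zero]
    intro X hX
    have hm : (X : V) ∈ U₁ := ⟨X.2, fun Y hY => by
      rw [← hA X ⟨Y, hY⟩, hX, Submodule.coe_zero, map_zero, LinearMap.zero_apply]⟩
    rw [h₁, Submodule.mem_bot] at hm
    exact Subtype.ext hm
  have hinj' : Function.Injective A' := by
    rw [injective_iff_map_eq_zero]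
    intro Y hY
    have hm : (Y : V) ∈ U₂ := ⟨Y.2, fun X hX => by
      rw [← hA' ⟨X, hX⟩ Y, hY, Submodule.coe_zero, map_zero, LinearMap.zero_apply]⟩
    rw [h₂, Submodule.mem_bot] at hm
    exact Subtype.ext hm
  refine ⟨LinearMap.linearEquivOfInjective A hinj (le_antisymm
    (LinearMap.finrank_le_finrank_of_injective hinj)
    (LinearMap.finrank_le_finrank_of_injective hinj')), fun i X Y hXY => ?_⟩
  change (A Y : V) = σ i (A X)
  rw [← sub_eq_zero]
  refine hQ.eq_zero ?_
  obtain ⟨Z, hZ, e⟩ := hQ.exists_preimage_mem (hσ i) (hW₂ i)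
    (W₂.sub_mem (A Y).2 (hW₂ i _ (A X).2))
  have key : Q ((A Y : V) - σ i (A X)) (σ i Z) = 0 := by
    rw [map_sub, LinearMap.sub_apply, hσ, hA X ⟨Z, hZ⟩, hA Y ⟨_, hW₂ i Z hZ⟩, hXY]
    exact sub_eq_zero.2 (hinv i X X.2 Z hZ)
  rwa [e] at key

end Schur

/-! ### Invariant forms and the Ricci tensor on two inequivalent summands -/

section IrreducibleTwoSummand

/-- Two orthogonal summands that are irreducible and inequivalent under a family `σ` of symmetries
(in the application, the adjoint action of the isotropy group). -/
structure IsIrreducibleTwoSummand {𝔤 : Type*} [LieRing 𝔤] [LieAlgebra ℝ 𝔤]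
    (Q : LinearMap.BilinForm ℝ 𝔤) (𝔨 𝔭₁ 𝔭₂ : Submodule ℝ 𝔤) {ι : Type*} (σ : ι → 𝔤 →ₗ[ℝ] 𝔤) :
    Prop extends IsTwoSummand Q 𝔨 𝔭₁ 𝔭₂ where
  symmetry : ∀ i, IsSummandSymmetry Q 𝔨 𝔭₁ 𝔭₂ (σ i)
  ne_bot₁ : 𝔭₁ ≠ ⊥
  ne_bot₂ : 𝔭₂ ≠ ⊥
  irreducible₁ : ∀ U ≤ 𝔭₁, (∀ i, ∀ X ∈ U, σ i X ∈ U) → U = ⊥ ∨ U = 𝔭₁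
  irreducible₂ : ∀ U ≤ 𝔭₂, (∀ i, ∀ X ∈ U, σ i X ∈ U) → U = ⊥ ∨ U = 𝔭₂
  inequivalent : ¬ ∃ f : 𝔭₁ ≃ₗ[ℝ] 𝔭₂, ∀ i, ∀ X Y : 𝔭₁, (Y : 𝔤) = σ i X → (f Y : 𝔤) = σ i (f X)

namespace IsIrreducibleTwoSummand

variable {𝔤 : Type*} [LieRing 𝔤] [LieAlgebra ℝ 𝔤] [FiniteDimensional ℝ 𝔤]
  {Q : LinearMap.BilinForm ℝ 𝔤} {𝔨 𝔭₁ 𝔭₂ 𝔭 : Submodule ℝ 𝔤} {ι : Type*} {σ : ι → 𝔤 →ₗ[ℝ] 𝔤}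

/-- The invariant bilinear forms are the forms `c₁ Q|𝔭₁ + c₂ Q|𝔭₂`. -/
lemma exists_eq_diagMetric (h : IsIrreducibleTwoSummand Q 𝔨 𝔭₁ 𝔭₂ σ) (h𝔭 : 𝔭₁ ⊔ 𝔭₂ = 𝔭)
    {B : LinearMap.BilinForm ℝ 𝔭}
    (hB₁ : ∀ X Y : 𝔭, (X : 𝔤) ∈ 𝔭₁ → (Y : 𝔤) ∈ 𝔭₁ → B X Y = B Y X)
    (hB₂ : ∀ X Y : 𝔭, (X : 𝔤) ∈ 𝔭₂ → (Y : 𝔤) ∈ 𝔭₂ → B X Y = B Y X)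
    (hinv : ∀ i, ∀ X Y X' Y' : 𝔭, (X' : 𝔤) = σ i X → (Y' : 𝔤) = σ i Y → B X' Y' = B X Y) :
    ∃ c₁ c₂ : ℝ, B = diagMetric Q 𝔭₁ 𝔭₂ 𝔭 c₁ c₂ := by
  have hc := h.isCompl h𝔭
  have hm₁ : ∀ X ∈ 𝔭₁, X ∈ 𝔭 := fun X hX => h𝔭.le (Submodule.mem_sup_left hX)
  have hm₂ : ∀ X ∈ 𝔭₂, X ∈ 𝔭 := fun X hX => h𝔭.le (Submodule.mem_sup_right hX)
  let B' : LinearMap.BilinForm ℝ 𝔤 := B.compl₁₂ (proj 𝔨 𝔭) (proj 𝔨 𝔭)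
  have hB' : ∀ X Y : 𝔭, B' X Y = B X Y := fun X Y => by
    have e : ∀ Z : 𝔭, proj 𝔨 𝔭 Z = Z := fun Z =>
      Subtype.ext (coe_proj_of_mem hc Z.2 (by rw [sub_self]; exact 𝔨.zero_mem))
    change B (proj 𝔨 𝔭 X) (proj 𝔨 𝔭 Y) = B X Y
    rw [e, e]
  have hσm : ∀ i, ∀ X ∈ 𝔭, σ i X ∈ 𝔭 := fun i X hX => by
    obtain ⟨A, hA, D, hD, rfl⟩ := Submodule.mem_sup.1 (h𝔭.ge hX)
    rw [map_add]
    exact h𝔭.le (Submodule.add_mem_sup ((h.symmetry i).map₁ A hA) ((h.symmetry i).map₂ D hD))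
  have hinv' : ∀ i, ∀ X ∈ 𝔭, ∀ Y ∈ 𝔭, B' (σ i X) (σ i Y) = B' X Y := fun i X hX Y hY => by
    rw [hB' ⟨_, hσm i X hX⟩ ⟨_, hσm i Y hY⟩, hB' ⟨X, hX⟩ ⟨Y, hY⟩]
    exact hinv i ⟨X, hX⟩ ⟨Y, hY⟩ _ _ rfl rfl
  have hQ := h.inner
  have hiso := fun i => (h.symmetry i).isometry
  obtain ⟨c₁, h₁⟩ := hQ.exists_eq_mul_of_irreducible hiso (fun i => (h.symmetry i).map₁) h.ne_bot₁
    h.irreducible₁ (B := B')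
    (fun X hX Y hY => by
      rw [hB' ⟨X, hm₁ X hX⟩ ⟨Y, hm₁ Y hY⟩, hB' ⟨Y, hm₁ Y hY⟩ ⟨X, hm₁ X hX⟩, hB₁ _ _ hX hY])
    fun i X hX Y hY => hinv' i X (hm₁ X hX) Y (hm₁ Y hY)
  obtain ⟨c₂, h₂⟩ := hQ.exists_eq_mul_of_irreducible hiso (fun i => (h.symmetry i).map₂) h.ne_bot₂
    h.irreducible₂ (B := B')
    (fun X hX Y hY => by
      rw [hB' ⟨X, hm₂ X hX⟩ ⟨Y, hm₂ Y hY⟩, hB' ⟨Y, hm₂ Y hY⟩ ⟨X, hm₂ X hX⟩, hB₂ _ _ hX hY])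
    fun i X hX Y hY => hinv' i X (hm₂ X hX) Y (hm₂ Y hY)
  have h₁₂ := hQ.eq_zero_of_not_equivalent hiso (fun i => (h.symmetry i).map₁)
    (fun i => (h.symmetry i).map₂) h.irreducible₁ h.irreducible₂ h.inequivalent (B := B')
    fun i X hX Y hY => hinv' i X (hm₁ X hX) Y (hm₂ Y hY)
  have h₂₁ := hQ.eq_zero_of_not_equivalent hiso (fun i => (h.symmetry i).map₁)
    (fun i => (h.symmetry i).map₂) h.irreducible₁ h.irreducible₂ h.inequivalent (B := B'.flip)
    fun i X hX Y hY => hinv' i Y (hm₂ Y hY) X (hm₁ X hX)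
  have h₂₁ : ∀ X ∈ 𝔭₁, ∀ Y ∈ 𝔭₂, B' Y X = 0 := h₂₁
  refine ⟨c₁, c₂, ?_⟩
  ext X Y
  rw [diagMetric_apply, ← hB' X Y]
  conv_lhs => rw [← h.proj_add_proj h𝔭 X, ← h.proj_add_proj h𝔭 Y]
  simp only [map_add, LinearMap.add_apply, h₁ _ (orthProj_mem 𝔭₁ _) _ (orthProj_mem 𝔭₁ _),
    h₂ _ (orthProj_mem 𝔭₂ _) _ (orthProj_mem 𝔭₂ _),
    h₁₂ _ (orthProj_mem 𝔭₁ _) _ (orthProj_mem 𝔭₂ _),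
    h₂₁ _ (orthProj_mem 𝔭₁ _) _ (orthProj_mem 𝔭₂ _), add_zero, zero_add]

lemma diagMetric_of_mem₁ (h : IsTwoSummand Q 𝔨 𝔭₁ 𝔭₂) (x₁ x₂ : ℝ) {X Y : 𝔭} (hX : (X : 𝔤) ∈ 𝔭₁)
    (hY : (Y : 𝔤) ∈ 𝔭₁) : diagMetric Q 𝔭₁ 𝔭₂ 𝔭 x₁ x₂ X Y = x₁ * Q (X : 𝔤) Y := by
  rw [diagMetric_apply, h.proj₁_of_mem₁ hX, h.proj₁_of_mem₁ hY, h.proj₂_of_mem₁ hX, map_zero,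
    LinearMap.zero_apply, mul_zero, add_zero]

lemma diagMetric_of_mem₂ (h : IsTwoSummand Q 𝔨 𝔭₁ 𝔭₂) (x₁ x₂ : ℝ) {X Y : 𝔭} (hX : (X : 𝔤) ∈ 𝔭₂)
    (hY : (Y : 𝔤) ∈ 𝔭₂) : diagMetric Q 𝔭₁ 𝔭₂ 𝔭 x₁ x₂ X Y = x₂ * Q (X : 𝔤) Y := by
  rw [diagMetric_apply, h.proj₂_of_mem₂ hX, h.proj₂_of_mem₂ hY, h.proj₁_of_mem₂ hX, map_zero,
    LinearMap.zero_apply, mul_zero, zero_add]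

lemma diagMetric_map (h : IsIrreducibleTwoSummand Q 𝔨 𝔭₁ 𝔭₂ σ) (x₁ x₂ : ℝ) (i : ι)
    {X Y X' Y' : 𝔭} (hX : (X' : 𝔤) = σ i X) (hY : (Y' : 𝔤) = σ i Y) :
    diagMetric Q 𝔭₁ 𝔭₂ 𝔭 x₁ x₂ X' Y' = diagMetric Q 𝔭₁ 𝔭₂ 𝔭 x₁ x₂ X Y := by
  have hp := fun Z => (h.symmetry i).proj h.toIsTwoSummand Z
  rw [diagMetric_apply, diagMetric_apply, hX, hY, (hp X).2.1, (hp Y).2.1, (hp X).2.2, (hp Y).2.2,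
    (h.symmetry i).isometry, (h.symmetry i).isometry]

/-- The invariant metrics are the diagonal metrics with positive factors. -/
lemma exists_pos_eq_diagMetric (h : IsIrreducibleTwoSummand Q 𝔨 𝔭₁ 𝔭₂ σ) (h𝔭 : 𝔭₁ ⊔ 𝔭₂ = 𝔭)
    {g : LinearMap.BilinForm ℝ 𝔭} (hg : IsInner g)
    (hinv : ∀ i, ∀ X Y X' Y' : 𝔭, (X' : 𝔤) = σ i X → (Y' : 𝔤) = σ i Y → g X' Y' = g X Y) :
    ∃ x₁ x₂ : ℝ, 0 < x₁ ∧ 0 < x₂ ∧ g = diagMetric Q 𝔭₁ 𝔭₂ 𝔭 x₁ x₂ := by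
  obtain ⟨x₁, x₂, e⟩ := h.exists_eq_diagMetric h𝔭 (fun X Y _ _ => hg.symm X Y)
    (fun X Y _ _ => hg.symm X Y) hinv
  obtain ⟨X₁, hX₁, hne₁⟩ := Submodule.exists_mem_ne_zero_of_ne_bot h.ne_bot₁
  obtain ⟨X₂, hX₂, hne₂⟩ := Submodule.exists_mem_ne_zero_of_ne_bot h.ne_bot₂
  have p₁ := hg.pos (⟨X₁, h𝔭.le (Submodule.mem_sup_left hX₁)⟩ : 𝔭)
    fun e => hne₁ (congrArg Subtype.val e)
  have p₂ := hg.pos (⟨X₂, h𝔭.le (Submodule.mem_sup_right hX₂)⟩ : 𝔭)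
    fun e => hne₂ (congrArg Subtype.val e)
  rw [e, diagMetric_of_mem₁ h.toIsTwoSummand _ _ hX₁ hX₁] at p₁
  rw [e, diagMetric_of_mem₂ h.toIsTwoSummand _ _ hX₂ hX₂] at p₂
  exact ⟨x₁, x₂, pos_of_mul_pos_left p₁ (h.inner.nonneg _),
    pos_of_mul_pos_left p₂ (h.inner.nonneg _), e⟩

variable {d₁ d₂ : ℕ} {e₁ : Module.Basis (Fin d₁) ℝ 𝔭₁} {e₂ : Module.Basis (Fin d₂) ℝ 𝔭₂}

/-- The Ricci tensor of the invariant metrics: by Schur's lemma it is determined by the two traces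
computed in `IsTwoSummand.ricci_factor₁` and `IsTwoSummand.exists_ricci_factor₂`. -/
lemma exists_ricciForm_eq (h : IsIrreducibleTwoSummand Q 𝔨 𝔭₁ 𝔭₂ σ) (h𝔭 : 𝔭₁ ⊔ 𝔭₂ = 𝔭)
    (he₁ : IsOrthonormal Q fun i => (e₁ i : 𝔤)) (he₂ : IsOrthonormal Q fun i => (e₂ i : 𝔤))
    (hd₁ : 0 < d₁) (hd₂ : 0 < d₂) {b₁ s₁₁₁ s₁₂₂ : ℝ}
    (hb₁ : ∀ X ∈ 𝔭₁, -killingForm ℝ 𝔤 X X = b₁ * Q X X)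
    (hs₁₁₁ : s₁₁₁ = structConst Q (fun i => (e₁ i : 𝔤)) (fun i => (e₁ i : 𝔤))
      (fun i => (e₁ i : 𝔤)))
    (hs₁₂₂ : s₁₂₂ = structConst Q (fun i => (e₁ i : 𝔤)) (fun i => (e₂ i : 𝔤))
      (fun i => (e₂ i : 𝔤))) :
    ∃ β : ℝ, ∀ x₁ x₂ : ℝ, 0 < x₁ → 0 < x₂ →
      ricciForm 𝔨 𝔭 (diagMetric Q 𝔭₁ 𝔭₂ 𝔭 x₁ x₂) = diagMetric Q 𝔭₁ 𝔭₂ 𝔭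
        (((b₁ - s₁₁₁ / (2 * d₁) - s₁₂₂ / d₁) + s₁₂₂ / (2 * d₁) * (x₁ / x₂) ^ 2) / 2)
        ((β - s₁₂₂ / d₂ * (x₁ / x₂)) / 2) := by
  have ht := h.toIsTwoSummand
  obtain ⟨β, hβ⟩ := ht.exists_ricci_factor₂ h𝔭 he₁ he₂ hd₂
  refine ⟨β, fun x₁ x₂ hx₁ hx₂ => ?_⟩
  obtain ⟨c₁, c₂, e⟩ := h.exists_eq_diagMetric h𝔭
    (B := ricciForm 𝔨 𝔭 (diagMetric Q 𝔭₁ 𝔭₂ 𝔭 x₁ x₂))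
    (fun X Y hX hY => by
      simp only [ricciForm_apply, ht.ricci_eq₁ h𝔭 hx₁ hx₂ he₁ he₂ hX hY,
        ht.ricci_eq₁ h𝔭 hx₁ hx₂ he₁ he₂ hY hX]
      congr 1 <;> refine Finset.sum_congr rfl fun i _ => ?_
      · rw [ht.inner.symm (orthProj Q 𝔭₁ _), ht.inner.symm (orthProj Q 𝔨 _)]
      · rw [ht.inner.symm])
    (fun X Y hX hY => by
      simp only [ricciForm_apply, ht.ricci_eq₂ h𝔭 hx₁ hx₂ he₁ he₂ hX hY,
        ht.ricci_eq₂ h𝔭 hx₁ hx₂ he₁ he₂ hY hX]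
      congr 1 <;> refine Finset.sum_congr rfl fun i _ => ?_
      · rw [ht.inner.symm]
      · rw [ht.inner.symm (orthProj Q 𝔭₁ _), ht.inner.symm (orthProj Q 𝔭₂ _),
          ht.inner.symm (orthProj Q 𝔨 _)])
    fun i X Y X' Y' hX hY => (h.symmetry i).ricci ht h𝔭 hx₁ hx₂ hX hY
  have f₁ := ht.ricci_factor₁ h𝔭 hx₁ hx₂ he₁ he₂ hd₁ hb₁ (c := c₁) fun X hX => by
    rw [← ricciForm_apply, e, diagMetric_of_mem₁ ht _ _ hX hX]
  have f₂ := hβ x₁ x₂ c₂ hx₁ hx₂ fun X hX => by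
    rw [← ricciForm_apply, e, diagMetric_of_mem₂ ht _ _ hX hX]
  rw [← hs₁₁₁, ← hs₁₂₂] at f₁
  rw [← hs₁₂₂] at f₂
  rw [e, ← f₁, ← f₂, mul_div_cancel_left₀ _ two_ne_zero, mul_div_cancel_left₀ _ two_ne_zero]

end IsIrreducibleTwoSummand

end IrreducibleTwoSummand

/-! ### The Ricci flow of the diagonal metrics -/

section Flow

set_option linter.unusedSectionVars false

open Set Filter

namespace IsIrreducibleTwoSummand

variable {𝔤 : Type*} [LieRing 𝔤] [LieAlgebra ℝ 𝔤] [FiniteDimensional ℝ 𝔤]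
  {Q : LinearMap.BilinForm ℝ 𝔤} {𝔨 𝔭₁ 𝔭₂ 𝔭 : Submodule ℝ 𝔤} {ι : Type*} {σ : ι → 𝔤 →ₗ[ℝ] 𝔤}
  {C a b β y₁ y₂ T : ℝ} {x₁ x₂ : ℝ → ℝ}

/-- A scaling flow gives a solution of the Ricci flow equation. -/
lemma hasDerivWithinAt_diagMetric
    (hRic : ∀ x₁ x₂ : ℝ, 0 < x₁ → 0 < x₂ → ricciForm 𝔨 𝔭 (diagMetric Q 𝔭₁ 𝔭₂ 𝔭 x₁ x₂) =
      diagMetric Q 𝔭₁ 𝔭₂ 𝔭 ((C + a * (x₁ / x₂) ^ 2) / 2) ((β - b * (x₁ / x₂)) / 2))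
    (hx : IsScalingFlow C a b β y₁ y₂ T x₁ x₂) {t : ℝ} (ht : t ∈ Ico 0 T) (X Y : 𝔭) :
    HasDerivWithinAt (fun s => diagMetric Q 𝔭₁ 𝔭₂ 𝔭 (x₁ s) (x₂ s) X Y)
      (-2 * ricci 𝔨 𝔭 (diagMetric Q 𝔭₁ 𝔭₂ 𝔭 (x₁ t) (x₂ t)) X Y) (Ico 0 T) t := by
  rw [← ricciForm_apply, hRic _ _ (hx.pos₁ t ht) (hx.pos₂ t ht)]
  simp only [diagMetric_apply]
  refine (((hx.deriv₁ t ht).mul_const _).add ((hx.deriv₂ t ht).mul_const _)).congr_deriv ?_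
  ring

/-- The coefficients of a Ricci flow of diagonal metrics are a scaling flow. They are read off
on unit vectors `v₁` and `v₂` of the two summands. -/
lemma isScalingFlow_of_hasDerivWithinAt (h : IsIrreducibleTwoSummand Q 𝔨 𝔭₁ 𝔭₂ σ)
    (hRic : ∀ x₁ x₂ : ℝ, 0 < x₁ → 0 < x₂ → ricciForm 𝔨 𝔭 (diagMetric Q 𝔭₁ 𝔭₂ 𝔭 x₁ x₂) =
      diagMetric Q 𝔭₁ 𝔭₂ 𝔭 ((C + a * (x₁ / x₂) ^ 2) / 2) ((β - b * (x₁ / x₂)) / 2))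
    {v₁ v₂ : 𝔭} (hv₁ : (v₁ : 𝔤) ∈ 𝔭₁) (hv₂ : (v₂ : 𝔤) ∈ 𝔭₂) (hn₁ : Q (v₁ : 𝔤) v₁ = 1)
    (hn₂ : Q (v₂ : 𝔤) v₂ = 1) {g : ℝ → LinearMap.BilinForm ℝ 𝔭}
    (h0 : g 0 = diagMetric Q 𝔭₁ 𝔭₂ 𝔭 y₁ y₂)
    (hg : ∀ t ∈ Ico 0 T, ∃ x₁ x₂ : ℝ, 0 < x₁ ∧ 0 < x₂ ∧ g t = diagMetric Q 𝔭₁ 𝔭₂ 𝔭 x₁ x₂)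
    (hflow : ∀ t ∈ Ico 0 T, ∀ X Y, HasDerivWithinAt (fun s => g s X Y)
      (-2 * ricci 𝔨 𝔭 (g t) X Y) (Ico 0 T) t) :
    IsScalingFlow C a b β y₁ y₂ T (fun t => g t v₁ v₁) (fun t => g t v₂ v₂) ∧
      ∀ t ∈ Ico 0 T, g t = diagMetric Q 𝔭₁ 𝔭₂ 𝔭 (g t v₁ v₁) (g t v₂ v₂) := by
  have ht := h.toIsTwoSummand
  have e₁ : ∀ x₁ x₂ : ℝ, diagMetric Q 𝔭₁ 𝔭₂ 𝔭 x₁ x₂ v₁ v₁ = x₁ := fun x₁ x₂ => by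
    rw [diagMetric_of_mem₁ ht _ _ hv₁ hv₁, hn₁, mul_one]
  have e₂ : ∀ x₁ x₂ : ℝ, diagMetric Q 𝔭₁ 𝔭₂ 𝔭 x₁ x₂ v₂ v₂ = x₂ := fun x₁ x₂ => by
    rw [diagMetric_of_mem₂ ht _ _ hv₂ hv₂, hn₂, mul_one]
  have hpos : ∀ t ∈ Ico 0 T, 0 < g t v₁ v₁ ∧ 0 < g t v₂ v₂ ∧
      g t = diagMetric Q 𝔭₁ 𝔭₂ 𝔭 (g t v₁ v₁) (g t v₂ v₂) := by
    intro t ht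
    obtain ⟨x₁, x₂, hx₁, hx₂, e⟩ := hg t ht
    rw [e, e₁, e₂]
    exact ⟨hx₁, hx₂, rfl⟩
  have hr : ∀ t ∈ Ico 0 T, ∀ X, ricci 𝔨 𝔭 (g t) X X = diagMetric Q 𝔭₁ 𝔭₂ 𝔭
      ((C + a * (g t v₁ v₁ / g t v₂ v₂) ^ 2) / 2) ((β - b * (g t v₁ v₁ / g t v₂ v₂)) / 2) X X := by
    intro t ht X
    obtain ⟨hx₁, hx₂, e⟩ := hpos t ht
    rw [← hRic _ _ hx₁ hx₂, ← e, ricciForm_apply]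
  exact ⟨{ init₁ := by simp only [h0, e₁]
           init₂ := by simp only [h0, e₂]
           pos₁ := fun t ht => (hpos t ht).1
           pos₂ := fun t ht => (hpos t ht).2.1
           deriv₁ := fun t ht => (hflow t ht v₁ v₁).congr_deriv (by rw [hr t ht, e₁]; ring)
           deriv₂ := fun t ht => (hflow t ht v₂ v₂).congr_deriv (by rw [hr t ht, e₂]; ring) },
    fun t ht => (hpos t ht).2.2⟩

/-- The curvature is unbounded once the first factor shrinks to zero: the Ricci curvature in the
direction of `𝔭₁` stays above a positive constant while the length of the vector tends to zero. -/
lemma not_bddAbove_curvatureNorm (h : IsIrreducibleTwoSummand Q 𝔨 𝔭₁ 𝔭₂ σ) (h𝔭 : 𝔭₁ ⊔ 𝔭₂ = 𝔭)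
    (hRic : ∀ x₁ x₂ : ℝ, 0 < x₁ → 0 < x₂ → ricciForm 𝔨 𝔭 (diagMetric Q 𝔭₁ 𝔭₂ 𝔭 x₁ x₂) =
      diagMetric Q 𝔭₁ 𝔭₂ 𝔭 ((C + a * (x₁ / x₂) ^ 2) / 2) ((β - b * (x₁ / x₂)) / 2))
    (ha : 0 ≤ a) (hC : 0 < C) {v₁ : 𝔭} (hv₁ : (v₁ : 𝔤) ∈ 𝔭₁) (hn₁ : Q (v₁ : 𝔤) v₁ = 1)
    (hT : 0 < T) (hx : IsScalingFlow C a b β y₁ y₂ T x₁ x₂) (hlim : Tendsto x₁ (𝓝[<] T) (𝓝 0)) :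
    ¬ BddAbove ((fun t => curvatureNorm 𝔨 𝔭 (diagMetric Q 𝔭₁ 𝔭₂ 𝔭 (x₁ t) (x₂ t))) '' Ico 0 T) := by
  rintro ⟨K, hK⟩
  set n : ℝ := (Module.finrank ℝ 𝔭 : ℝ) ^ 3
  have hn : 0 ≤ n := by positivity
  have key : ∀ t ∈ Ico 0 T, C / 2 ≤ n * (x₁ t * K) := by
    intro t ht
    have hp₁ := hx.pos₁ t ht
    have hp₂ := hx.pos₂ t ht
    have h1 := ricci_le_curvatureNorm (𝔨 := 𝔨)
      (h.isInner_diagMetric h𝔭 hp₁ hp₂) v₁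
    rw [← ricciForm_apply, hRic _ _ hp₁ hp₂,
      diagMetric_of_mem₁ h.toIsTwoSummand _ _ hv₁ hv₁,
      diagMetric_of_mem₁ h.toIsTwoSummand _ _ hv₁ hv₁, hn₁, mul_one, mul_one] at h1
    have h2 : 0 ≤ a * (x₁ t / x₂ t) ^ 2 := by positivity
    have h3 := hK (mem_image_of_mem _ ht)
    calc C / 2 ≤ (C + a * (x₁ t / x₂ t) ^ 2) / 2 := by linarith
      _ ≤ _ := h1
      _ ≤ n * (x₁ t * K) := by gcongr
  have hl : Tendsto (fun t => n * (x₁ t * K)) (𝓝[<] T) (𝓝 (n * (0 * K))) :=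
    (hlim.mul_const K).const_mul n
  have := ge_of_tendsto hl (by
    filter_upwards [Ico_mem_nhdsLT hT] with t ht using key t ht)
  rw [zero_mul, mul_zero] at this
  linarith

/-- The curvature is at most `M / x₁`, and `x₁ ≥ C (T - t)`: the singularity is of type I. -/
lemma bddAbove_mul_curvatureNorm (h : IsTwoSummand Q 𝔨 𝔭₁ 𝔭₂) (h𝔭 : 𝔭₁ ⊔ 𝔭₂ = 𝔭)
    (ha : 0 < a) (hb : 0 < b) (hC : 0 < C) (hx : IsScalingFlow C a b β y₁ y₂ T x₁ x₂) :
    BddAbove ((fun t => (T - t) *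
      curvatureNorm 𝔨 𝔭 (diagMetric Q 𝔭₁ 𝔭₂ 𝔭 (x₁ t) (x₂ t))) '' Ico 0 T) := by
  obtain ⟨U, hU, hUx⟩ := hx.exists_ratio_bound (by linarith) hC
  obtain ⟨M, hM⟩ := h.exists_curvatureNorm_le h𝔭 U
  refine ⟨max M 0 / C, ?_⟩
  rintro _ ⟨t, ht, rfl⟩
  have hp₁ := hx.pos₁ t ht
  have h1 := hM _ _ hp₁ (hx.pos₂ t ht) (hUx t ht)
  have h2 := hx.mul_sub_le ha.le ht
  have h3 : 0 < T - t := sub_pos.2 ht.2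
  rw [le_div_iff₀ hC]
  calc (T - t) * curvatureNorm 𝔨 𝔭 (diagMetric Q 𝔭₁ 𝔭₂ 𝔭 (x₁ t) (x₂ t)) * C
      ≤ (T - t) * (max M 0 / x₁ t) * C := by
        gcongr
        exact h1.trans (by gcongr; exact le_max_left _ _)
    _ = max M 0 * (C * (T - t) / x₁ t) := by ring
    _ ≤ max M 0 * 1 := by
        gcongr
        rwa [div_le_one hp₁]
    _ = max M 0 := mul_one _

/-- A positive root of the quadratic equation for the ratio of the two factors gives an
Einstein metric. -/
lemma ricci_eq_of_root
    (hRic : ∀ x₁ x₂ : ℝ, 0 < x₁ → 0 < x₂ → ricciForm 𝔨 𝔭 (diagMetric Q 𝔭₁ 𝔭₂ 𝔭 x₁ x₂) =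
      diagMetric Q 𝔭₁ 𝔭₂ 𝔭 ((C + a * (x₁ / x₂) ^ 2) / 2) ((β - b * (x₁ / x₂)) / 2))
    {u : ℝ} (hu : 0 < u) (hroot : (a + b) * u ^ 2 - β * u + C = 0) (X Y : 𝔭) :
    ricci 𝔨 𝔭 (diagMetric Q 𝔭₁ 𝔭₂ 𝔭 u 1) X Y =
      (β - b * u) / 2 * diagMetric Q 𝔭₁ 𝔭₂ 𝔭 u 1 X Y := by
  rw [← ricciForm_apply, hRic u 1 hu one_pos, div_one]
  simp only [diagMetric_apply]
  linear_combination (Q (orthProj Q 𝔭₁ (X : 𝔤)) (orthProj Q 𝔭₁ (Y : 𝔤)) / 2) * hroot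

end IsIrreducibleTwoSummand

end Flow

/-! ### The isotropy representation of the homogeneous space -/

section Isotropy

open Set Filter

variable {E : Type*} [NormedAddCommGroup E] [NormedSpace ℝ E] [FiniteDimensional ℝ E]
  {M : Type*} [TopologicalSpace M] {I : ModelWithCorners ℝ E M}
  {E' : Type*} [NormedAddCommGroup E'] [NormedSpace ℝ E'] {M' : Type*} [TopologicalSpace M']
  {I' : ModelWithCorners ℝ E' M'}
  {E'' : Type*} [NormedAddCommGroup E''] [NormedSpace ℝ E''] {M'' : Type*} [TopologicalSpace M'']
  {I'' : ModelWithCorners ℝ E'' M''}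
  {G : Type*} [TopologicalSpace G] [ChartedSpace M G] [Group G]

instance instFiniteDimensionalGroupLieAlgebra : FiniteDimensional ℝ (GroupLieAlgebra I G) :=
  inferInstanceAs (FiniteDimensional ℝ E)

variable [CompleteSpace E] [I.Boundaryless] [LieGroup I ∞ G] {K H : Subgroup G}
  [ChartedSpace M' K] [LieGroup I' ∞ K] [ChartedSpace M'' H] [LieGroup I'' ∞ H]
  {Q : LinearMap.BilinForm ℝ (GroupLieAlgebra I G)} {𝔭₁ 𝔭₂ : Submodule ℝ (GroupLieAlgebra I G)}

/-- The tower `K < H < G` has the algebraic structure used above. The two summands are orthogonal by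
Schur's lemma, because they are inequivalent. -/
lemma isIrreducibleTwoSummand (hK : ContMDiff I' I ∞ (Subtype.val : K → G))
    (hH : ContMDiff I'' I ∞ (Subtype.val : H → G)) (hQ : IsAdInvariantInner I Q)
    (h𝔭₁ : IsIrreducibleSummand I K 𝔭₁) (h𝔭₂ : IsIrreducibleSummand I K 𝔭₂)
    (h𝔭 : 𝔭₁ ⊔ 𝔭₂ = isotropySpace I I' Q K) (hineq : ¬ AreEquivalent I K 𝔭₁ 𝔭₂)
    (h𝔥 : lieAlgebra I I'' H = lieAlgebra I I' K ⊔ 𝔭₁) :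
    IsIrreducibleTwoSummand Q (lieAlgebra I I' K) 𝔭₁ 𝔭₂ (fun a : K => Ad I (a : G)) := by
  have hm₁ : 𝔭₁ ≤ isotropySpace I I' Q K := h𝔭 ▸ le_sup_left
  have hm₂ : 𝔭₂ ≤ isotropySpace I I' Q K := h𝔭 ▸ le_sup_right
  have irr₁ : ∀ U ≤ 𝔭₁, (∀ a : K, ∀ X ∈ U, Ad I (a : G) X ∈ U) → U = ⊥ ∨ U = 𝔭₁ :=
    fun U hU h => h𝔭₁.irreducible U hU fun a ha => h ⟨a, ha⟩
  have irr₂ : ∀ U ≤ 𝔭₂, (∀ a : K, ∀ X ∈ U, Ad I (a : G) X ∈ U) → U = ⊥ ∨ U = 𝔭₂ :=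
    fun U hU h => h𝔭₂.irreducible U hU fun a ha => h ⟨a, ha⟩
  have hne : ¬ ∃ f : 𝔭₁ ≃ₗ[ℝ] 𝔭₂, ∀ a : K, ∀ X Y : 𝔭₁,
      (Y : GroupLieAlgebra I G) = Ad I (a : G) X →
        (f Y : GroupLieAlgebra I G) = Ad I (a : G) (f X) :=
    fun ⟨f, hf⟩ => hineq ⟨f, fun a ha => hf ⟨a, ha⟩⟩
  exact
  { inner := hQ.toIsInner
    ad := ad_invariant_of_Ad_invariant hQ.invariant
    orth₀₁ := fun X hX Y hY => hm₁ hY X hX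
    orth₀₂ := fun X hX Y hY => hm₂ hY X hX
    orth₁₂ := hQ.toIsInner.eq_zero_of_not_equivalent (σ := fun a : K => Ad I (a : G))
      (fun a => hQ.invariant a) (fun a => h𝔭₁.invariant a a.2) (fun a => h𝔭₂.invariant a a.2)
      irr₁ irr₂ hne fun a X _ Y _ => hQ.invariant a X Y
    span := by rw [h𝔭]; exact (hQ.toIsInner.isCompl_orthogonal _).sup_eq_top
    lie₀₀ := fun X hX Y hY => lie_mem_lieAlgebra K hK hX hY
    lie₀₁ := fun X hX Y hY => lie_mem_of_Ad_mem K hK 𝔭₁ h𝔭₁.invariant hX hY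
    lie₀₂ := fun X hX Y hY => lie_mem_of_Ad_mem K hK 𝔭₂ h𝔭₂.invariant hX hY
    lie₁₁ := fun X hX Y hY => h𝔥 ▸ lie_mem_lieAlgebra H hH (h𝔥.ge (Submodule.mem_sup_right hX))
      (h𝔥.ge (Submodule.mem_sup_right hY))
    symmetry := fun a =>
      { isometry := hQ.invariant a
        map_lie := Ad_lie (a : G)
        map₀ := fun X hX => Ad_mem_lieAlgebra K hK a.2 hX
        map₁ := h𝔭₁.invariant a a.2
        map₂ := h𝔭₂.invariant a a.2 }
    ne_bot₁ := h𝔭₁.ne_bot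
    ne_bot₂ := h𝔭₂.ne_bot
    irreducible₁ := irr₁
    irreducible₂ := irr₂
    inequivalent := hne }

end Isotropy

/-! ### Distances of the diagonal metrics -/

section Distances

open Set Filter

set_option linter.unusedSectionVars false

lemma isHomogeneous_sqrt {V W : Type*} [AddCommGroup V] [Module ℝ V] [AddCommGroup W] [Module ℝ W]
    (B : LinearMap.BilinForm ℝ W) (f : V →ₗ[ℝ] W) : IsHomogeneous fun X => √(B (f X) (f X)) := by
  intro c X
  change √(B (f (c • X)) (f (c • X))) = |c| * √(B (f X) (f X))
  rw [map_smul, apply_smul_smul, Real.sqrt_mul (sq_nonneg c), Real.sqrt_sq_eq_abs]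

section Algebra

variable {𝔤 : Type*} [LieRing 𝔤] [LieAlgebra ℝ 𝔤] [FiniteDimensional ℝ 𝔤]
  {Q : LinearMap.BilinForm ℝ 𝔤} {𝔨 𝔭₁ 𝔭₂ 𝔭 : Submodule ℝ 𝔤}

lemma diagMetric_proj (h : IsTwoSummand Q 𝔨 𝔭₁ 𝔭₂) (h𝔭 : 𝔭₁ ⊔ 𝔭₂ = 𝔭) (x₁ x₂ : ℝ) (X Y : 𝔤) :
    diagMetric Q 𝔭₁ 𝔭₂ 𝔭 x₁ x₂ (proj 𝔨 𝔭 X) (proj 𝔨 𝔭 Y) =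
      x₁ * Q (orthProj Q 𝔭₁ X) (orthProj Q 𝔭₁ Y) + x₂ * Q (orthProj Q 𝔭₂ X) (orthProj Q 𝔭₂ Y) := by
  rw [diagMetric_apply, h.proj₁_coe_proj h𝔭, h.proj₁_coe_proj h𝔭, h.proj₂_coe_proj h𝔭,
    h.proj₂_coe_proj h𝔭]

/-- The upper bound which makes the length functions converge when the first factor tends to
zero. -/
lemma sqrt_diagMetric_proj_le (h : IsTwoSummand Q 𝔨 𝔭₁ 𝔭₂) (h𝔭 : 𝔭₁ ⊔ 𝔭₂ = 𝔭) {x₁ x₂ : ℝ}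
    (hx₁ : 0 ≤ x₁) (hx₂ : 0 ≤ x₂) (X : 𝔤) :
    √(diagMetric Q 𝔭₁ 𝔭₂ 𝔭 x₁ x₂ (proj 𝔨 𝔭 X) (proj 𝔨 𝔭 X)) ≤
      √x₁ * √(Q X X) + √x₂ * √(Q (orthProj Q 𝔭₂ X) (orthProj Q 𝔭₂ X)) := by
  rw [diagMetric_proj h h𝔭, ← Real.sqrt_mul hx₁, ← Real.sqrt_mul hx₂]
  refine (Real.sqrt_le_sqrt (add_le_add_left (mul_le_mul_of_nonneg_left
    (h.inner.orthProj_apply_self_le 𝔭₁ X) hx₁) _)).trans ?_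
  rw [Real.sqrt_le_left (by positivity), add_sq, Real.sq_sqrt (mul_nonneg hx₁ (h.inner.nonneg _)),
    Real.sq_sqrt (mul_nonneg hx₂ (h.inner.nonneg _))]
  have := mul_nonneg (Real.sqrt_nonneg (x₁ * Q X X))
    (Real.sqrt_nonneg (x₂ * Q (orthProj Q 𝔭₂ X) (orthProj Q 𝔭₂ X)))
  linarith

lemma sqrt_mul_sqrt_le_sqrt_diagMetric_proj (h : IsTwoSummand Q 𝔨 𝔭₁ 𝔭₂) (h𝔭 : 𝔭₁ ⊔ 𝔭₂ = 𝔭)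
    {x₁ x₂ : ℝ} (hx₁ : 0 ≤ x₁) (hx₂ : 0 ≤ x₂) (X : 𝔤) :
    √x₂ * √(Q (orthProj Q 𝔭₂ X) (orthProj Q 𝔭₂ X)) ≤
      √(diagMetric Q 𝔭₁ 𝔭₂ 𝔭 x₁ x₂ (proj 𝔨 𝔭 X) (proj 𝔨 𝔭 X)) := by
  rw [diagMetric_proj h h𝔭, ← Real.sqrt_mul hx₂]
  exact Real.sqrt_le_sqrt (le_add_of_nonneg_left (mul_nonneg hx₁ (h.inner.nonneg _)))

/-- On `𝔨 ⊕ 𝔭₁` the diagonal metrics only depend on the first factor. -/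
lemma sqrt_diagMetric_proj_le_of_mem_sup (h : IsTwoSummand Q 𝔨 𝔭₁ 𝔭₂) (h𝔭 : 𝔭₁ ⊔ 𝔭₂ = 𝔭)
    {x₁ x₂ : ℝ} (hx₁ : 0 ≤ x₁) {X : 𝔤} (hX : X ∈ 𝔨 ⊔ 𝔭₁) :
    √(diagMetric Q 𝔭₁ 𝔭₂ 𝔭 x₁ x₂ (proj 𝔨 𝔭 X) (proj 𝔨 𝔭 X)) ≤ √x₁ * √(Q X X) := by
  rw [diagMetric_proj h h𝔭, ← Real.sqrt_mul hx₁, h.inner.orthProj_eq_zero (W := 𝔭₂) fun Z hZ => by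
    rw [h.inner.symm, h.orth_sup hX hZ], map_zero, mul_zero, add_zero]
  exact Real.sqrt_le_sqrt (mul_le_mul_of_nonneg_left (h.inner.orthProj_apply_self_le 𝔭₁ X) hx₁)

lemma orthogonal_sup_eq (h : IsTwoSummand Q 𝔨 𝔭₁ 𝔭₂) : Q.orthogonal (𝔨 ⊔ 𝔭₁) = 𝔭₂ := by
  ext X
  refine ⟨fun hX => h.mem₂_of_orth (fun Z hZ => ?_) fun Z hZ => ?_, fun hX Z hZ => h.orth_sup hZ hX⟩
  · exact hX Z (Submodule.mem_sup_left hZ)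
  · exact hX Z (Submodule.mem_sup_right hZ)

/-- The projection along `𝔨 ⊕ 𝔭₁` is the orthogonal projection onto `𝔭₂`. -/
lemma coe_proj_sup (h : IsTwoSummand Q 𝔨 𝔭₁ 𝔭₂) (X : 𝔤) :
    (proj (𝔨 ⊔ 𝔭₁) (Q.orthogonal (𝔨 ⊔ 𝔭₁)) X : 𝔤) = orthProj Q 𝔭₂ X := by
  refine coe_proj_of_mem (h.inner.isCompl_orthogonal _).symm
    ((orthogonal_sup_eq h).ge (orthProj_mem _ _)) ?_
  have e : X - orthProj Q 𝔭₂ X = orthProj Q 𝔨 X + orthProj Q 𝔭₁ X := by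
    conv_lhs => rw [← h.sum_proj X]
    rw [map_add, map_add, h.proj₂_of_mem₀ (orthProj_mem _ _), h.proj₂_of_mem₁ (orthProj_mem _ _),
      h.proj₂_of_mem₂ (orthProj_mem _ _)]
    abel
  rw [e]
  exact Submodule.add_mem_sup (orthProj_mem _ _) (orthProj_mem _ _)

end Algebra

variable {E : Type*} [NormedAddCommGroup E] [NormedSpace ℝ E] [FiniteDimensional ℝ E]
  {M : Type*} [TopologicalSpace M] {I : ModelWithCorners ℝ E M}
  {E' : Type*} [NormedAddCommGroup E'] [NormedSpace ℝ E'] {M' : Type*} [TopologicalSpace M']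
  {I' : ModelWithCorners ℝ E' M'}
  {E'' : Type*} [NormedAddCommGroup E''] [NormedSpace ℝ E''] [FiniteDimensional ℝ E'']
  {M'' : Type*} [TopologicalSpace M''] {I'' : ModelWithCorners ℝ E'' M''}
  {G : Type*} [TopologicalSpace G] [ChartedSpace M G] [Group G]

/-- A bilinear form on the Lie algebra is bounded with respect to the norm of the model space. -/
lemma exists_sqrt_le_modelNorm (B : LinearMap.BilinForm ℝ (GroupLieAlgebra I G)) :
    ∃ c > 0, ∀ X, √(B X X) ≤ c * modelNorm X := by
  let B₀ : E →ₗ[ℝ] E →ₗ[ℝ] ℝ := B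
  let Bc : E →L[ℝ] E →L[ℝ] ℝ := LinearMap.toContinuousLinearMap
    (LinearMap.toContinuousLinearMap.toLinearMap ∘ₗ B₀)
  refine ⟨√‖Bc‖ + 1, by positivity, fun X => ?_⟩
  have h1 : B X X ≤ ‖Bc‖ * modelNorm X * modelNorm X := (le_abs_self _).trans (Bc.le_opNorm₂ X X)
  have h2 : 0 ≤ modelNorm X := norm_nonneg (E := E) X
  calc √(B X X) ≤ √(‖Bc‖ * modelNorm X * modelNorm X) := Real.sqrt_le_sqrt h1
    _ = √‖Bc‖ * modelNorm X := by
      rw [mul_assoc, Real.sqrt_mul (norm_nonneg Bc), Real.sqrt_mul_self h2]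
    _ ≤ (√‖Bc‖ + 1) * modelNorm X := by linarith

variable [CompleteSpace E] [I.Boundaryless] [LieGroup I ∞ G] {K H : Subgroup G}
  [ChartedSpace M' K] [LieGroup I' ∞ K] [ChartedSpace M'' H] [LieGroup I'' ∞ H]
  {Q : LinearMap.BilinForm ℝ (GroupLieAlgebra I G)} {𝔭₁ 𝔭₂ : Submodule ℝ (GroupLieAlgebra I G)}

/-- The isotropy group acts on the isotropy representation, and the projection is equivariant. -/
lemma coe_isotropyProj_Ad (hK : ContMDiff I' I ∞ (Subtype.val : K → G))
    (hQ : IsAdInvariantInner I Q) {a : G} (ha : a ∈ K) (X : GroupLieAlgebra I G) :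
    (isotropyProj I I' Q K (Ad I a X) : GroupLieAlgebra I G) =
      Ad I a (isotropyProj I I' Q K X) := by
  have hc : IsCompl (isotropySpace I I' Q K) (lieAlgebra I I' K) :=
    (hQ.toIsInner.isCompl_orthogonal _).symm
  refine coe_proj_of_mem hc (fun Z hZ => ?_) ?_
  · have h1 := hQ.invariant a (Ad I a⁻¹ Z) (isotropyProj I I' Q K X)
    rw [Ad_Ad_inv] at h1
    exact h1.trans ((isotropyProj I I' Q K X).2 _ (Ad_mem_lieAlgebra K hK (inv_mem ha) hZ))
  · rw [← map_sub]
    refine Ad_mem_lieAlgebra K hK ha ?_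
    obtain ⟨A, hA, D, hD, e⟩ := Submodule.mem_sup.1 (hc.sup_eq_top.ge (Submodule.mem_top (x := X)))
    have h2 : (isotropyProj I I' Q K X : GroupLieAlgebra I G) = A := by
      refine coe_proj_of_mem hc hA ?_
      rwa [← e, add_sub_cancel_left]
    rwa [h2, ← e, add_sub_cancel_left]

lemma sqrt_isotropyProj_Ad (hK : ContMDiff I' I ∞ (Subtype.val : K → G))
    (hQ : IsAdInvariantInner I Q) {g : LinearMap.BilinForm ℝ (isotropySpace I I' Q K)}
    (hg : IsInvariantMetric I I' Q K g) {a : G} (ha : a ∈ K) (X : GroupLieAlgebra I G) :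
    √(g (isotropyProj I I' Q K (Ad I a X)) (isotropyProj I I' Q K (Ad I a X))) =
      √(g (isotropyProj I I' Q K X) (isotropyProj I I' Q K X)) :=
  congrArg Real.sqrt (hg.invariant a ha _ _ _ _ (coe_isotropyProj_Ad hK hQ ha X)
    (coe_isotropyProj_Ad hK hQ ha X))

/-- The inclusion of the fibre `H/K` into `G/K` does not increase distances. -/
lemma cosetEDist_inclusion_le (hH : ContMDiff I'' I ∞ (Subtype.val : H → G))
    {N : GroupLieAlgebra I G → ℝ} {N' : GroupLieAlgebra I'' H → ℝ} (hN : IsHomogeneous N)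
    (hN' : IsHomogeneous N') (h : ∀ X, N (lieInclusion I I'' H X) ≤ N' X) (a b : H) :
    cosetEDist I K N (a : G) (b : G) ≤ cosetEDist I'' (K.subgroupOf H) N' a b := by
  refine le_of_forall_gt fun r hr => ?_
  obtain ⟨a', b', ha, hb, hab⟩ := exists_pathEDist_lt_of_cosetEDist_lt hr
  have ha' : ((a' : G) : G ⧸ K) = (a : G) :=
    QuotientGroup.eq.2 (QuotientGroup.eq (s := K.subgroupOf H).1 ha)
  have hb' : ((b' : G) : G ⧸ K) = (b : G) :=
    QuotientGroup.eq.2 (QuotientGroup.eq (s := K.subgroupOf H).1 hb)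
  rw [← ha', ← hb']
  exact ((cosetEDist_le_pathEDist _ _).trans
    (pathEDist_inclusion_le H hH hN hN' h a' b')).trans_lt hab

lemma diameter_le {A : Type*} {d : A → A → ℝ≥0∞} {D : ℝ≥0∞} (h : ∀ x y, d x y ≤ D) :
    diameter d ≤ D := iSup_le fun x => iSup_le fun y => h x y

lemma tendsto_ofReal_sqrt_mul {ι : Type*} {l : Filter ι} {x : ι → ℝ} (hx : Tendsto x l (𝓝 0))
    (D : ℝ) : Tendsto (fun t => ENNReal.ofReal √(x t) * ENNReal.ofReal D) l (𝓝 0) := by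
  have h1 : Tendsto (fun t => √(x t)) l (𝓝 0) := by
    simpa [Function.comp_def] using (Real.continuous_sqrt.tendsto 0).comp hx
  have h2 := ENNReal.Tendsto.mul_const (b := ENNReal.ofReal D) (ENNReal.tendsto_ofReal h1)
    (Or.inr ENNReal.ofReal_ne_top)
  simpa using h2

variable [CompactSpace G]

/-- If both factors tend to zero, the diameter tends to zero. -/
lemma tendsto_diameter_metricEDist [ConnectedSpace (G ⧸ K)]
    (h : IsTwoSummand Q (lieAlgebra I I' K) 𝔭₁ 𝔭₂) (h𝔭 : 𝔭₁ ⊔ 𝔭₂ = isotropySpace I I' Q K)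
    {ι : Type*} {l : Filter ι} {x₁ x₂ : ι → ℝ} (hp : ∀ᶠ t in l, 0 < x₁ t ∧ 0 < x₂ t)
    (hx₁ : Tendsto x₁ l (𝓝 0)) (hx₂ : Tendsto x₂ l (𝓝 0)) :
    Tendsto (fun t => diameter (metricEDist I I' Q K (diagMetric Q 𝔭₁ 𝔭₂ _ (x₁ t) (x₂ t)))) l
      (𝓝 0) := by
  obtain ⟨c, -, hc⟩ := exists_sqrt_le_modelNorm Q
  have hQh : IsHomogeneous fun X : GroupLieAlgebra I G => √(Q X X) :=
    isHomogeneous_sqrt Q LinearMap.id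
  obtain ⟨D, -, hD⟩ := exists_bound_cosetEDist (S := K) hQh hc
  have hlim : Tendsto (fun t => ENNReal.ofReal √(x₁ t) * ENNReal.ofReal D +
      ENNReal.ofReal √(x₂ t) * ENNReal.ofReal D) l (𝓝 0) := by
    simpa using (tendsto_ofReal_sqrt_mul hx₁ D).add (tendsto_ofReal_sqrt_mul hx₂ D)
  refine tendsto_of_tendsto_of_tendsto_of_le_of_le' tendsto_const_nhds hlim
    (Eventually.of_forall fun _ => zero_le) ?_
  filter_upwards [hp] with t ht
  refine diameter_le fun x y => ?_
  obtain ⟨a, rfl⟩ := QuotientGroup.mk_surjective x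
  obtain ⟨b, rfl⟩ := QuotientGroup.mk_surjective y
  have h1 : 0 < √(x₁ t) + √(x₂ t) := add_pos (Real.sqrt_pos.2 ht.1) (Real.sqrt_pos.2 ht.2)
  -- the distances of `Q` are bounded, and the metric is at most `(√x₁ + √x₂)² Q`
  refine (cosetEDist_mono_mul (isHomogeneous_sqrt _ (isotropyProj I I' Q K)) hQh h1
    (fun X => ?_) le_rfl a b).trans ?_
  · refine (sqrt_diagMetric_proj_le h h𝔭 ht.1.le ht.2.le X).trans ?_
    rw [add_mul]
    gcongr
    exact h.inner.orthProj_apply_self_le _ _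
  · rw [← add_mul, ← ENNReal.ofReal_add (Real.sqrt_nonneg _) (Real.sqrt_nonneg _)]
    gcongr
    exact hD _ _

/-- The diameter of the fibre is at most a constant multiple of the square root of the first
factor. -/
lemma exists_fibreEDist_le (hHc : IsClosed (H : Set G)) [I''.Boundaryless]
    [ConnectedSpace (H ⧸ K.subgroupOf H)]
    (h : IsTwoSummand Q (lieAlgebra I I' K) 𝔭₁ 𝔭₂) (h𝔭 : 𝔭₁ ⊔ 𝔭₂ = isotropySpace I I' Q K)
    (h𝔥 : lieAlgebra I I'' H = lieAlgebra I I' K ⊔ 𝔭₁) :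
    ∃ D : ℝ, ∀ x₁ x₂ : ℝ, 0 < x₁ → ∀ x y,
      fibreEDist I I' I'' Q K H (diagMetric Q 𝔭₁ 𝔭₂ _ x₁ x₂) x y ≤
        ENNReal.ofReal √x₁ * ENNReal.ofReal D := by
  have : CompactSpace H := isCompact_iff_compactSpace.1 hHc.isCompact
  obtain ⟨c, -, hc⟩ := exists_sqrt_le_modelNorm (I := I'') (G := H)
    (Q.compl₁₂ (lieInclusion I I'' H) (lieInclusion I I'' H))
  have hQh : IsHomogeneous fun X : GroupLieAlgebra I'' H =>
      √(Q (lieInclusion I I'' H X) (lieInclusion I I'' H X)) :=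
    isHomogeneous_sqrt Q (lieInclusion I I'' H)
  obtain ⟨D, -, hD⟩ := exists_bound_cosetEDist (S := K.subgroupOf H) hQh hc
  refine ⟨D, fun x₁ x₂ hx₁ x y => ?_⟩
  obtain ⟨a, rfl⟩ := QuotientGroup.mk_surjective x
  obtain ⟨b, rfl⟩ := QuotientGroup.mk_surjective y
  refine (cosetEDist_mono_mul
    (isHomogeneous_sqrt _ (isotropyProj I I' Q K ∘ₗ lieInclusion I I'' H)) hQh
    (Real.sqrt_pos.2 hx₁) (fun X => ?_) le_rfl a b).trans ?_
  · exact sqrt_diagMetric_proj_le_of_mem_sup h h𝔭 hx₁.le (h𝔥 ▸ LinearMap.mem_range_self _ X)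
  · gcongr
    exact hD _ _

end Distances

/-! ### The two singular behaviours -/

section SingularBehaviour

open Set Filter

set_option linter.unusedSectionVars false

variable {E : Type*} [NormedAddCommGroup E] [NormedSpace ℝ E] [FiniteDimensional ℝ E]
  {M : Type*} [TopologicalSpace M] {I : ModelWithCorners ℝ E M}
  {E' : Type*} [NormedAddCommGroup E'] [NormedSpace ℝ E'] {M' : Type*} [TopologicalSpace M']
  {I' : ModelWithCorners ℝ E' M'}
  {E'' : Type*} [NormedAddCommGroup E''] [NormedSpace ℝ E''] [FiniteDimensional ℝ E'']
  {M'' : Type*} [TopologicalSpace M''] {I'' : ModelWithCorners ℝ E'' M''}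
  {G : Type*} [TopologicalSpace G] [ChartedSpace M G] [Group G]
  [CompleteSpace E] [I.Boundaryless] [LieGroup I ∞ G] {K H : Subgroup G}
  [ChartedSpace M' K] [LieGroup I' ∞ K] [ChartedSpace M'' H] [LieGroup I'' ∞ H]
  {Q : LinearMap.BilinForm ℝ (GroupLieAlgebra I G)} {𝔭₁ 𝔭₂ : Submodule ℝ (GroupLieAlgebra I G)}
  {T : ℝ} {x₁ x₂ : ℝ → ℝ}

lemma isInvariantMetric_diagMetric
    (h : IsIrreducibleTwoSummand Q (lieAlgebra I I' K) 𝔭₁ 𝔭₂ fun a : K => Ad I (a : G))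
    (h𝔭 : 𝔭₁ ⊔ 𝔭₂ = isotropySpace I I' Q K) {y₁ y₂ : ℝ} (hy₁ : 0 < y₁) (hy₂ : 0 < y₂) :
    IsInvariantMetric I I' Q K (diagMetric Q 𝔭₁ 𝔭₂ _ y₁ y₂) :=
  { h.isInner_diagMetric h𝔭 hy₁ hy₂ with
    invariant := fun a ha _ _ _ _ hX hY => h.diagMetric_map y₁ y₂ ⟨a, ha⟩ hX hY }

lemma isInvariantMetric_smul_restrict (hQ : IsAdInvariantInner I Q) {ℓ : ℝ} (hℓ : 0 < ℓ) :
    IsInvariantMetric I I'' Q H (ℓ • Q.restrict (isotropySpace I I'' Q H)) where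
  symm X Y := congrArg (ℓ * ·) (hQ.symm _ _)
  pos X hX := mul_pos hℓ (hQ.pos _ fun e => hX (Subtype.ext e))
  invariant a _ X Y X' Y' hX hY := by
    change ℓ * Q X' Y' = ℓ * Q X Y
    rw [hX, hY, hQ.invariant]

lemma coe_isotropyProj_of_eq_sup (h : IsTwoSummand Q (lieAlgebra I I' K) 𝔭₁ 𝔭₂)
    (h𝔥 : lieAlgebra I I'' H = lieAlgebra I I' K ⊔ 𝔭₁) (X : GroupLieAlgebra I G) :
    (isotropyProj I I'' Q H X : GroupLieAlgebra I G) = orthProj Q 𝔭₂ X := by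
  have := coe_proj_sup h X
  rw [← h𝔥] at this
  exact this

variable [CompactSpace G]

lemma shrinksToPoint_diagMetric [ConnectedSpace (G ⧸ K)]
    (h : IsTwoSummand Q (lieAlgebra I I' K) 𝔭₁ 𝔭₂) (h𝔭 : 𝔭₁ ⊔ 𝔭₂ = isotropySpace I I' Q K)
    (hp : ∀ᶠ t in 𝓝[<] T, 0 < x₁ t ∧ 0 < x₂ t)
    (hx₁ : Tendsto x₁ (𝓝[<] T) (𝓝 0)) (hx₂ : Tendsto x₂ (𝓝[<] T) (𝓝 0)) :
    ShrinksToPoint I I' Q K T fun t => diagMetric Q 𝔭₁ 𝔭₂ _ (x₁ t) (x₂ t) where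
  metric X := by
    simp only [diagMetric_apply]
    simpa using (hx₁.mul_const _).add (hx₂.mul_const _)
  diam := tendsto_diameter_metricEDist h h𝔭 hp hx₁ hx₂

lemma fibreShrinksToPoint_diagMetric (hHc : IsClosed (H : Set G)) [I''.Boundaryless]
    [ConnectedSpace (H ⧸ K.subgroupOf H)]
    (h : IsTwoSummand Q (lieAlgebra I I' K) 𝔭₁ 𝔭₂) (h𝔭 : 𝔭₁ ⊔ 𝔭₂ = isotropySpace I I' Q K)
    (h𝔥 : lieAlgebra I I'' H = lieAlgebra I I' K ⊔ 𝔭₁)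
    (hp : ∀ᶠ t in 𝓝[<] T, 0 < x₁ t ∧ 0 < x₂ t) (hx₁ : Tendsto x₁ (𝓝[<] T) (𝓝 0)) :
    FibreShrinksToPoint I I' I'' Q K H T fun t => diagMetric Q 𝔭₁ 𝔭₂ _ (x₁ t) (x₂ t) where
  metric X hX := by
    rw [h𝔥] at hX
    simp only [diagMetric_apply, h.inner.orthProj_eq_zero (W := 𝔭₂) fun Z hZ => by
      rw [h.inner.symm, h.orth_sup hX hZ], map_zero, mul_zero, add_zero]
    simpa using hx₁.mul_const _
  diam := by
    obtain ⟨D, hD⟩ := exists_fibreEDist_le hHc h h𝔭 h𝔥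
    refine tendsto_of_tendsto_of_tendsto_of_le_of_le' tendsto_const_nhds
      (tendsto_ofReal_sqrt_mul hx₁ D) (Eventually.of_forall fun _ => zero_le) ?_
    filter_upwards [hp] with t ht
    exact diameter_le fun x y => hD _ _ ht.1 x y

lemma eventually_sqrt_mul_le {ι : Type*} {l : Filter ι} {x : ι → ℝ} (hx : Tendsto x l (𝓝 0))
    (c : ℝ) {δ : ℝ} (hδ : 0 < δ) : ∀ᶠ t in l, √(x t) * c ≤ δ := by
  have h1 : Tendsto (fun t => √(x t) * c) l (𝓝 0) := by
    simpa [Function.comp_def] using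
      ((Real.continuous_sqrt.tendsto 0).comp hx).mul_const c
  filter_upwards [h1.eventually (Iic_mem_nhds hδ)] with t ht using ht

/-- The total space converges to the base when the first factor tends to zero and the second one
to a positive number. -/
lemma convergesToBase_diagMetric (hK : ContMDiff I' I ∞ (Subtype.val : K → G))
    (hH : ContMDiff I'' I ∞ (Subtype.val : H → G)) (hHc : IsClosed (H : Set G)) (hKH : K ≤ H)
    [I''.Boundaryless] [ConnectedSpace (G ⧸ K)] [ConnectedSpace (H ⧸ K.subgroupOf H)]
    (hQ : IsAdInvariantInner I Q)
    (h : IsIrreducibleTwoSummand Q (lieAlgebra I I' K) 𝔭₁ 𝔭₂ fun a : K => Ad I (a : G))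
    (h𝔭 : 𝔭₁ ⊔ 𝔭₂ = isotropySpace I I' Q K)
    (h𝔥 : lieAlgebra I I'' H = lieAlgebra I I' K ⊔ 𝔭₁)
    (hp : ∀ᶠ t in 𝓝[<] T, 0 < x₁ t ∧ 0 < x₂ t) (hx₁ : Tendsto x₁ (𝓝[<] T) (𝓝 0)) {ℓ : ℝ}
    (hℓ : 0 < ℓ) (hx₂ : Tendsto x₂ (𝓝[<] T) (𝓝 ℓ)) :
    ConvergesToBase I I' I'' Q K H T (fun t => diagMetric Q 𝔭₁ 𝔭₂ _ (x₁ t) (x₂ t))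
      (ℓ • Q.restrict (isotropySpace I I'' Q H)) := by
  have ht := h.toIsTwoSummand
  have hB : ∀ X Y, (ℓ • Q.restrict (isotropySpace I I'' Q H)) (isotropyProj I I'' Q H X)
      (isotropyProj I I'' Q H Y) = ℓ * Q (orthProj Q 𝔭₂ X) (orthProj Q 𝔭₂ Y) := by
    intro X Y
    change ℓ * Q (isotropyProj I I'' Q H X : GroupLieAlgebra I G)
      (isotropyProj I I'' Q H Y : GroupLieAlgebra I G) = _
    rw [coe_isotropyProj_of_eq_sup ht h𝔥, coe_isotropyProj_of_eq_sup ht h𝔥]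
  refine ⟨fun X Y => ?_, ?_⟩
  · rw [hB]
    have e : ∀ t, diagMetric Q 𝔭₁ 𝔭₂ (isotropySpace I I' Q K) (x₁ t) (x₂ t)
        (isotropyProj I I' Q K X) (isotropyProj I I' Q K Y) =
          x₁ t * Q (orthProj Q 𝔭₁ X) (orthProj Q 𝔭₁ Y) +
            x₂ t * Q (orthProj Q 𝔭₂ X) (orthProj Q 𝔭₂ Y) :=
      fun t => diagMetric_proj ht h𝔭 _ _ X Y
    simp only [e]
    simpa using (hx₁.mul_const (Q (orthProj Q 𝔭₁ X) (orthProj Q 𝔭₁ Y))).add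
      (hx₂.mul_const (Q (orthProj Q 𝔭₂ X) (orthProj Q 𝔭₂ Y)))
  set N : ℝ → GroupLieAlgebra I G → ℝ := fun t X =>
    √(diagMetric Q 𝔭₁ 𝔭₂ (isotropySpace I I' Q K) (x₁ t) (x₂ t)
      (isotropyProj I I' Q K X) (isotropyProj I I' Q K X)) with hNdef
  set N₀ : GroupLieAlgebra I G → ℝ := fun X =>
    √((ℓ • Q.restrict (isotropySpace I I'' Q H)) (isotropyProj I I'' Q H X)
      (isotropyProj I I'' Q H X)) with hN₀def
  have hN : ∀ t, IsHomogeneous (N t) := fun t => isHomogeneous_sqrt _ (isotropyProj I I' Q K)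
  have hN₀ : IsHomogeneous N₀ := isHomogeneous_sqrt _ (isotropyProj I I'' Q H)
  have hN₀e : ∀ X, N₀ X = √ℓ * √(Q (orthProj Q 𝔭₂ X) (orthProj Q 𝔭₂ X)) := fun X => by
    simp only [hN₀def]
    rw [hB, Real.sqrt_mul hℓ.le]
  have hP : ∀ X, √(Q (orthProj Q 𝔭₂ X) (orthProj Q 𝔭₂ X)) ≤ √(Q X X) := fun X =>
    Real.sqrt_le_sqrt (ht.inner.orthProj_apply_self_le 𝔭₂ X)
  have hs₂ : Tendsto (fun t => √(x₂ t)) (𝓝[<] T) (𝓝 √ℓ) :=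
    (Real.continuous_sqrt.tendsto ℓ).comp hx₂
  have hsℓ : 0 < √ℓ := Real.sqrt_pos.2 hℓ
  obtain ⟨c, hc0, hc⟩ := exists_sqrt_le_modelNorm Q
  have hm : ∀ X : GroupLieAlgebra I G, 0 ≤ modelNorm X := fun X => norm_nonneg (E := E) X
  obtain ⟨D, hD⟩ := exists_fibreEDist_le hHc ht h𝔭 h𝔥
  have hsurj : Function.Surjective (Subgroup.quotientMapOfLE hKH) := fun y => by
    obtain ⟨a, rfl⟩ := QuotientGroup.mk_surjective y
    exact ⟨a, Subgroup.quotientMapOfLE_apply_mk hKH a⟩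
  have : ConnectedSpace (G ⧸ H) := hsurj.connectedSpace (continuous_id.quotient_map' _)
  obtain ⟨D', hD'0, hD'⟩ := exists_bound_cosetEDist (S := H) (N := N₀) hN₀ (c := √ℓ * c) fun X => by
    rw [hN₀e, mul_assoc]
    gcongr
    exact (hP X).trans (hc X)
  -- `√x₂ ≤ 2 √ℓ` and `√x₁ ≤ 1` near `T`, which gives the constant `(1 + 2 √ℓ) c`
  refine tendsto_gromovHausdorffEDist (N := N) (N₀ := N₀) (c := (1 + 2 * √ℓ) * c) hKH hN ?_ hN₀
    (fun s hs X => sqrt_isotropyProj_Ad hH hQ (isInvariantMetric_smul_restrict hQ hℓ) hs X)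
    (by positivity) ?_ (fun X => ?_) (fun δ hδ => ?_) (fun δ hδ => ?_) (fun ε hε => ?_) hD'0 hD'
  · filter_upwards [hp] with t ht s hs X
    exact sqrt_isotropyProj_Ad hK hQ (isInvariantMetric_diagMetric h h𝔭 ht.1 ht.2) hs X
  · filter_upwards [hp, eventually_sqrt_mul_le hx₁ 1 one_pos,
      hs₂.eventually (Iic_mem_nhds (show √ℓ < 2 * √ℓ by linarith))] with t hpt h1 h2 X
    have h2 : √(x₂ t) ≤ 2 * √ℓ := h2
    calc N t X ≤ √(x₁ t) * √(Q X X) + √(x₂ t) * √(Q (orthProj Q 𝔭₂ X) (orthProj Q 𝔭₂ X)) :=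
          sqrt_diagMetric_proj_le ht h𝔭 hpt.1.le hpt.2.le X
      _ ≤ 1 * (c * modelNorm X) + (2 * √ℓ) * (c * modelNorm X) := by
          gcongr
          · linarith
          · exact hc X
          · exact (hP X).trans (hc X)
      _ = (1 + 2 * √ℓ) * c * modelNorm X := by ring
  · rw [hN₀e]
    calc √ℓ * √(Q (orthProj Q 𝔭₂ X) (orthProj Q 𝔭₂ X)) ≤ (1 + 2 * √ℓ) * (c * modelNorm X) := by
          have := hm X
          gcongr
          · linarith
          · exact (hP X).trans (hc X)
      _ = (1 + 2 * √ℓ) * c * modelNorm X := by ring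
  · filter_upwards [hp, eventually_sqrt_mul_le hx₁ c hδ,
      hs₂.eventually (Iic_mem_nhds (show √ℓ < (1 + δ) * √ℓ by nlinarith))] with t hpt h1 h2 X
    have h2 : √(x₂ t) ≤ (1 + δ) * √ℓ := h2
    have := hm X
    calc N t X ≤ √(x₁ t) * √(Q X X) + √(x₂ t) * √(Q (orthProj Q 𝔭₂ X) (orthProj Q 𝔭₂ X)) :=
          sqrt_diagMetric_proj_le ht h𝔭 hpt.1.le hpt.2.le X
      _ ≤ √(x₁ t) * (c * modelNorm X) +
            (1 + δ) * √ℓ * √(Q (orthProj Q 𝔭₂ X) (orthProj Q 𝔭₂ X)) := by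
          gcongr
          exact hc X
      _ = (1 + δ) * N₀ X + √(x₁ t) * c * modelNorm X := by rw [hN₀e]; ring
      _ ≤ (1 + δ) * N₀ X + δ * modelNorm X := by gcongr
  · have hlt : √ℓ < √ℓ * (1 + δ) := by nlinarith
    filter_upwards [hp, (hs₂.mul_const (1 + δ)).eventually (Ici_mem_nhds hlt)] with t hpt h2 X
    have h2 : √ℓ ≤ √(x₂ t) * (1 + δ) := h2
    rw [hN₀e]
    calc √ℓ * √(Q (orthProj Q 𝔭₂ X) (orthProj Q 𝔭₂ X))
        ≤ √(x₂ t) * (1 + δ) * √(Q (orthProj Q 𝔭₂ X) (orthProj Q 𝔭₂ X)) := by gcongr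
      _ = (1 + δ) * (√(x₂ t) * √(Q (orthProj Q 𝔭₂ X) (orthProj Q 𝔭₂ X))) := by ring
      _ ≤ (1 + δ) * N t X := by
          gcongr
          exact sqrt_mul_sqrt_le_sqrt_diagMetric_proj ht h𝔭 hpt.1.le hpt.2.le X
  · filter_upwards [hp, eventually_sqrt_mul_le hx₁ D hε] with t hpt h1 a ha
    refine (cosetEDist_inclusion_le (N' := fun X => N t (lieInclusion I I'' H X)) hH (hN t)
      (isHomogeneous_sqrt _ (isotropyProj I I' Q K ∘ₗ lieInclusion I I'' H))
      (fun X => le_rfl) (1 : H) ⟨a, ha⟩).trans ?_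
    refine (hD (x₁ t) (x₂ t) hpt.1 _ _).trans ?_
    rw [← ENNReal.ofReal_mul (Real.sqrt_nonneg _)]
    exact ENNReal.ofReal_le_ofReal h1

end SingularBehaviour

end HomogeneousRicci

end

open HomogeneousRicci in
theorem mainTheorem1 {n m l d₁ d₂ : ℕ}
    {G : Type*} [TopologicalSpace G] [T2Space G] [CompactSpace G]
    [ChartedSpace (EuclideanSpace ℝ (Fin n)) G] [Group G] [LieGroup (𝓡 n) ∞ G]
    -- closed Lie subgroups `K < H < G`, with `G/K` and `H/K` connected
    (K H : Subgroup G)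
    [ChartedSpace (EuclideanSpace ℝ (Fin m)) K] [LieGroup (𝓡 m) ∞ K]
    [ChartedSpace (EuclideanSpace ℝ (Fin l)) H] [LieGroup (𝓡 l) ∞ H]
    (hK : IsClosedLieSubgroup (𝓡 n) (𝓡 m) K) (hH : IsClosedLieSubgroup (𝓡 n) (𝓡 l) H)
    (hKH : K < H) (hHG : H < ⊤)
    [ConnectedSpace (G ⧸ K)] [ConnectedSpace (H ⧸ K.subgroupOf H)]
    -- the background inner product
    (Q : LinearMap.BilinForm ℝ (GroupLieAlgebra (𝓡 n) G))
    (hQ : IsAdInvariantInner (𝓡 n) Q)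
    -- the two inequivalent irreducible summands of the isotropy representation `𝔭 = 𝔭₁ ⊕ 𝔭₂`
    (𝔭₁ 𝔭₂ : Submodule ℝ (GroupLieAlgebra (𝓡 n) G))
    (h𝔭₁ : IsIrreducibleSummand (𝓡 n) K 𝔭₁) (h𝔭₂ : IsIrreducibleSummand (𝓡 n) K 𝔭₂)
    (h𝔭 : 𝔭₁ ⊔ 𝔭₂ = isotropySpace (𝓡 n) (𝓡 m) Q K) (hdisj : Disjoint 𝔭₁ 𝔭₂)
    (hineq : ¬ AreEquivalent (𝓡 n) K 𝔭₁ 𝔭₂)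
    -- the Lie algebra of `H` is `𝔥 = 𝔨 ⊕ 𝔭₁`
    (h𝔥 : lieAlgebra (𝓡 n) (𝓡 l) H = lieAlgebra (𝓡 n) (𝓡 m) K ⊔ 𝔭₁)
    -- `Q`-orthonormal bases of the summands
    (e₁ : Module.Basis (Fin d₁) ℝ 𝔭₁) (e₂ : Module.Basis (Fin d₂) ℝ 𝔭₂)
    (he₁ : IsOrthonormal Q fun i => (e₁ i : GroupLieAlgebra (𝓡 n) G))
    (he₂ : IsOrthonormal Q fun i => (e₂ i : GroupLieAlgebra (𝓡 n) G))
    -- the constant `b₁`, the structure constants `[111]` and `[122]`, and the constant `C`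
    (b₁ s₁₁₁ s₁₂₂ C : ℝ)
    (hb₁ : ∀ X ∈ 𝔭₁, ∀ Y ∈ 𝔭₁, -killingForm ℝ (GroupLieAlgebra (𝓡 n) G) X Y = b₁ * Q X Y)
    (hs₁₁₁ : s₁₁₁ = structConst Q (fun i => (e₁ i : GroupLieAlgebra (𝓡 n) G))
      (fun i => (e₁ i : GroupLieAlgebra (𝓡 n) G)) (fun i => (e₁ i : GroupLieAlgebra (𝓡 n) G)))
    (hs₁₂₂ : s₁₂₂ = structConst Q (fun i => (e₁ i : GroupLieAlgebra (𝓡 n) G))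
      (fun i => (e₂ i : GroupLieAlgebra (𝓡 n) G)) (fun i => (e₂ i : GroupLieAlgebra (𝓡 n) G)))
    (hs₁₂₂_pos : 0 < s₁₂₂)
    (hC : C = b₁ - s₁₁₁ / (2 * d₁) - s₁₂₂ / d₁) (hC_pos : 0 < C)
    -- the initial metric
    (g₀ : LinearMap.BilinForm ℝ (isotropySpace (𝓡 n) (𝓡 m) Q K))
    (hg₀ : IsInvariantMetric (𝓡 n) (𝓡 m) Q K g₀) :
    ∃ (T : ℝ) (g : ℝ → LinearMap.BilinForm ℝ (isotropySpace (𝓡 n) (𝓡 m) Q K)),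
      0 < T ∧
      IsHomogeneousRicciFlow (𝓡 n) (𝓡 m) Q K g₀ T g ∧
      -- maximality of `[0, T)` and uniqueness
      (∀ T' g', IsHomogeneousRicciFlow (𝓡 n) (𝓡 m) Q K g₀ T' g' →
        T' ≤ T ∧ ∀ t ∈ Set.Ico 0 T', g' t = g t) ∧
      IsTypeISingularity (𝓡 n) (𝓡 m) Q K T g ∧
      -- the two singular behaviours: the whole space shrinks to a point, or the fibre `H/K` does
      -- and `G/K` converges to `G/H` with some invariant metric
      (ShrinksToPoint (𝓡 n) (𝓡 m) Q K T g ∨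
        (FibreShrinksToPoint (𝓡 n) (𝓡 m) (𝓡 l) Q K H T g ∧
          ∃ gB, IsInvariantMetric (𝓡 n) (𝓡 l) Q H gB ∧
            ConvergesToBase (𝓡 n) (𝓡 m) (𝓡 l) Q K H T g gB)) ∧
      -- the necessary condition for the first behaviour
      (ShrinksToPoint (𝓡 n) (𝓡 m) Q K T g → ∃ gE, IsInvariantEinstein (𝓡 n) (𝓡 m) Q K gE) := by
  have hinv := isIrreducibleTwoSummand hK.contMDiff hH.contMDiff hQ h𝔭₁ h𝔭₂ h𝔭 hineq h𝔥
  have hts := hinv.toIsTwoSummand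
  -- the summands are nonzero
  have hd₁ : 0 < d₁ := by
    refine Nat.pos_of_ne_zero fun h0 => h𝔭₁.ne_bot ?_
    subst h0
    have := e₁.repr.toEquiv.subsingleton
    exact Submodule.eq_bot_of_subsingleton
  have hd₂ : 0 < d₂ := by
    refine Nat.pos_of_ne_zero fun h0 => h𝔭₂.ne_bot ?_
    subst h0
    have := e₂.repr.toEquiv.subsingleton
    exact Submodule.eq_bot_of_subsingleton
  obtain ⟨β, hRic⟩ := hinv.exists_ricciForm_eq h𝔭 he₁ he₂ hd₁ hd₂
    (fun X hX => hb₁ X hX X hX) hs₁₁₁ hs₁₂₂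
  rw [← hC] at hRic
  have ha : 0 < s₁₂₂ / (2 * d₁) := by positivity
  have hb : 0 < s₁₂₂ / d₂ := by positivity
  set a := s₁₂₂ / (2 * d₁)
  set b := s₁₂₂ / d₂
  -- unit vectors of the two summands
  set v₁ : isotropySpace (𝓡 n) (𝓡 m) Q K := ⟨e₁ ⟨0, hd₁⟩, h𝔭.le (Submodule.mem_sup_left (e₁ _).2)⟩
  set v₂ : isotropySpace (𝓡 n) (𝓡 m) Q K := ⟨e₂ ⟨0, hd₂⟩, h𝔭.le (Submodule.mem_sup_right (e₂ _).2)⟩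
  have hv₁ : (v₁ : GroupLieAlgebra (𝓡 n) G) ∈ 𝔭₁ := (e₁ _).2
  have hv₂ : (v₂ : GroupLieAlgebra (𝓡 n) G) ∈ 𝔭₂ := (e₂ _).2
  have hn₁ : Q (v₁ : GroupLieAlgebra (𝓡 n) G) v₁ = 1 := he₁.1 _
  have hn₂ : Q (v₂ : GroupLieAlgebra (𝓡 n) G) v₂ = 1 := he₂.1 _
  have hdiag : ∀ g, IsInvariantMetric (𝓡 n) (𝓡 m) Q K g → ∃ x₁ x₂ : ℝ, 0 < x₁ ∧ 0 < x₂ ∧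
      g = diagMetric Q 𝔭₁ 𝔭₂ _ x₁ x₂ := fun g hg =>
    hinv.exists_pos_eq_diagMetric h𝔭 hg.toIsInner fun i => hg.invariant i i.2
  obtain ⟨y₁, y₂, hy₁, hy₂, rfl⟩ := hdiag g₀ hg₀
  obtain ⟨T, hT, x₁, x₂, hx, hmax⟩ := exists_maximal_isScalingFlow ha.le hC_pos β b hy₁ hy₂
  obtain ⟨hx₁, hcases⟩ := hx.singular_behaviour hT ha hb hC_pos hmax
  have hp : ∀ᶠ t in 𝓝[<] T, 0 < x₁ t ∧ 0 < x₂ t := by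
    filter_upwards [Ico_mem_nhdsLT hT] with t ht using ⟨hx.pos₁ t ht, hx.pos₂ t ht⟩
  refine ⟨T, fun t => diagMetric Q 𝔭₁ 𝔭₂ _ (x₁ t) (x₂ t), hT, ⟨?_, ?_, ?_⟩, ?_, ⟨?_, ?_⟩, ?_, ?_⟩
  · simp only [hx.init₁, hx.init₂]
  · exact fun t ht => isInvariantMetric_diagMetric hinv h𝔭 (hx.pos₁ t ht) (hx.pos₂ t ht)
  · exact fun t ht X Y =>
      IsIrreducibleTwoSummand.hasDerivWithinAt_diagMetric hRic hx ht X Y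
  · intro T' g' hg'
    obtain ⟨hx', hdiag'⟩ := hinv.isScalingFlow_of_hasDerivWithinAt hRic hv₁ hv₂ hn₁ hn₂ hg'.init
      (fun t ht => hdiag _ (hg'.metric t ht)) hg'.flow
    have hT' := hmax T' _ _ hx'
    refine ⟨hT', fun t ht => ?_⟩
    obtain ⟨h₁, h₂⟩ := hx'.unique (hx.mono hT') ha.le hC_pos.le hy₁.le ht
    rw [hdiag' t ht, h₁, h₂]
  · exact hinv.not_bddAbove_curvatureNorm h𝔭 hRic ha.le hC_pos hv₁ hn₁ hT hx hx₁
  · exact IsIrreducibleTwoSummand.bddAbove_mul_curvatureNorm hts h𝔭 ha hb hC_pos hx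
  · rcases hcases with ⟨hx₂, -⟩ | ⟨ℓ, hℓ, hx₂⟩
    · exact Or.inl (shrinksToPoint_diagMetric hts h𝔭 hp hx₁ hx₂)
    · exact Or.inr ⟨fibreShrinksToPoint_diagMetric hH.isClosed hts h𝔭 h𝔥 hp hx₁, _,
        isInvariantMetric_smul_restrict hQ hℓ,
        convergesToBase_diagMetric hK.contMDiff hH.contMDiff hH.isClosed hKH.le hQ hinv h𝔭 h𝔥 hp
          hx₁ hℓ hx₂⟩
  · intro hs
    rcases hcases with ⟨-, u, hu, hroot⟩ | ⟨ℓ, hℓ, hx₂⟩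
    · exact ⟨_, isInvariantMetric_diagMetric hinv h𝔭 hu one_pos, _,
        IsIrreducibleTwoSummand.ricci_eq_of_root hRic hu hroot⟩
    · -- a unit vector of `𝔭₂` has length tending to `ℓ ≠ 0`
      have h0 := hs.metric v₂
      simp only [IsIrreducibleTwoSummand.diagMetric_of_mem₂ hts _ _ hv₂ hv₂, hn₂, mul_one] at h0
      exact absurd (tendsto_nhds_unique h0 hx₂) hℓ.ne
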